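/- **Setting.** Let $d,n_1,n_2\ge 1$ and $m\ge 2$. Consider the problem $\frac{\partial u}{\partial x_0}-\sum_{i=1}^d\frac{\partial^2 u}{\partial x_i^2}=f$ in the interior of a space-time domain, with $u=g$ on its initial and lateral boundary, where $x=(x_0,x_1,\dots,x_d)\in\mathbb R^{d+1}$. Let $x_1,\dots,x_{n_1}$ (interior samples) and $y_1,\dots,y_{n_2}$ (boundary samples) be points of $\mathbb R^{d+1}$ of Euclidean norm at most $1$, and let $f,g$ satisfy $|f(x_p)|\le K$, $|g(y_j)|\le K$ at the samples. Write $\tilde x=(x^T,1)^T\in\mathbb R^{d+2}$ and assume that no two of the $n_1+n_2$ vectors $\tilde x_p,\tilde y_j$ are parallel. The network is $$\phi(x;w,a)=\frac1{\sqrt m}\sum_{r=1}^m a_r\,\sigma(w_r^T\tilde x),\qquad w_r\in\mathbb R^{d+2},$$ the residuals are $$s_p(w)=\tfrac1{\sqrt{n_1}}\Big(\tfrac{\partial\phi}{\partial x_0}(x_p)-\sum_{i=1}^d\tfrac{\partial^2\phi}{\partial x_i^2}(x_p)-f(x_p)\Big),\qquad h_j(w)=\tfrac1{\sqrt{n_2}}\big(\phi(y_j)-g(y_j)\big),$$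 and the loss is $L(w)=\frac12(\|s(w)\|_2^2+\|h(w)\|_2^2)$. Let $J(w)\in\mathbb R^{(n_1+n_2)\times m(d+2)}$ be the Jacobian of $(s,h)$ with respect to $w=(w_1,\dots,w_m)$; for $\sigma=\mathrm{ReLU}^3$, that is $\sigma(z)=\max(z,0)^3$, it is computed with the convention $\sigma'''(z)=6\cdot 1\{z\ge 0\}$. At initialization the $w_r(0)\sim\mathcal N(0,I)$ and $a_r\sim\mathrm{Unif}\{-1,1\}$, $r=1,\dots,m$, are all independent; the $a_r$ stay fixed and $$w(k+1)=w(k)-\eta\,J(k)^T\big(J(k)J(k)^T\big)^{-1}\begin{pmatrix}s(k)\\ h(k)\end{pmatrix},\qquad k=0,1,2,\dots,$$ where $J(k),s(k),h(k)$ are evaluated at $w(k)$. Put $L(k)=L(w(k))$. Let $H^\infty=\mathbb E[J(0)J(0)^T]$ (which does not depend on $m$) and let $\lambda_0=\lambda_{\min}(H^\infty)$ be its least eigenvalue. **Theorem.** Let $\eta\in(0,1)$ and $\delta\in(0,1)$. (1) Let $\sigma=\mathrm{ReLU}^3$. Then $\lambda_0>0$, and there is a constant $C>0$ depending only on $K$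 such that, if $$m\ \ge\ C\,\frac{1}{(1-\eta)^2}\,\frac{d^{12}}{\lambda_0^4}\,\log^6\!\Big(\frac{md}{\delta}\Big)\log\!\Big(\frac{n_1+n_2}{\delta}\Big),$$ then with probability at least $1-\delta$ over the initialization, for all $k\in\mathbb N$ the matrix $J(k)J(k)^T$ is invertible and $L(k)\le(1-\eta)^kL(0)$. (2) Let $\sigma:\mathbb R\to\mathbb R$ be real analytic and not a polynomial, with $|\sigma(0)|\le c$ and $|\sigma^{(k)}(z)-\sigma^{(k)}(z')|\le c|z-z'|$ for all $z,z'\in\mathbb R$ and $k\in\{0,1,2,3\}$. Then $\lambda_0>0$, and there is a constant $C>0$ depending only on $c$ and $K$ such that, if $$m\ \ge\ C\,\frac{1}{1-\eta}\,\frac{d^{6}}{\lambda_0^3}\,\log^2\!\Big(\frac{md}{\delta}\Big)\log\!\Big(\frac{n_1+n_2}{\delta}\Big),$$ then with probability at least $1-\delta$ over the initialization, for all $k\in\mathbb N$ the matrix $J(k)J(k)^T$ is invertible and $L(k)\le(1-\eta)^kL(0)$. -/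

import Mathlib

open MeasureTheory ProbabilityTheory Matrix

noncomputable section

namespace PINN

/-- Space-time points `(x₀, x₁, …, x_d)`, with `x₀` the time variable. -/
abbrev Point (d : ℕ) := EuclideanSpace ℝ (Fin (d + 1))

/-- Weight vectors of one hidden neuron, `(w₀, w₁, …, w_d, bias)`. -/
abbrev Weight (d : ℕ) := EuclideanSpace ℝ (Fin (d + 2))

/-- The augmented input `(xᵀ, 1)ᵀ`. -/
def aug {d : ℕ} (x : Point d) : Weight d :=
  WithLp.toLp 2 (Fin.snoc (α := fun _ => ℝ) (fun i => x i) 1)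

/-- The two-layer network `φ(x; w, a) = m^{-1/2} ∑ᵣ aᵣ σ(wᵣᵀ x̃)`. -/
def net (σ : ℝ → ℝ) {d m : ℕ} (a : Fin m → ℝ) (w : Fin m → Weight d) (x : Point d) : ℝ :=
  (1 / √(m : ℝ)) * ∑ r, a r * σ (inner ℝ (w r) (aug x))

/-- The heat operator `∂u/∂x₀ - ∑_{i=1}^d ∂²u/∂xᵢ²` at the point `x`. -/
def heatOp {d : ℕ} (u : Point d → ℝ) (x : Point d) : ℝ :=
  deriv (fun t : ℝ => u (x + t • EuclideanSpace.single 0 1)) 0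
    - ∑ i : Fin d,
        iteratedDeriv 2 (fun t : ℝ => u (x + t • EuclideanSpace.single i.succ 1)) 0

/-- Training data: interior samples `x₁, …, x_{n₁}`, boundary samples `y₁, …, y_{n₂}`, the
source term `f` and the boundary data `g`. -/
structure Data (d n₁ n₂ : ℕ) where
  x : Fin n₁ → Point d
  y : Fin n₂ → Point d
  f : Point d → ℝ
  g : Point d → ℝ

variable {d n₁ n₂ m : ℕ}

/-- All samples, the interior ones first. -/
def Data.sample (D : Data d n₁ n₂) : Fin n₁ ⊕ Fin n₂ → Point d := Sum.elim D.x D.y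

/-- No two of the augmented samples are parallel. -/
def Data.NoTwoParallel (D : Data d n₁ n₂) : Prop :=
  ∀ i j, i ≠ j → ∀ α : ℝ, aug (D.sample i) ≠ α • aug (D.sample j)

/-- The residual vector `(s(w), h(w))`. -/
def residual (σ : ℝ → ℝ) (D : Data d n₁ n₂) (a : Fin m → ℝ) (w : Fin m → Weight d) :
    Fin n₁ ⊕ Fin n₂ → ℝ :=
  Sum.elim
    (fun p => (1 / √(n₁ : ℝ)) * (heatOp (net σ a w) (D.x p) - D.f (D.x p)))
    (fun j => (1 / √(n₂ : ℝ)) * (net σ a w (D.y j) - D.g (D.y j)))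

/-- The empirical loss `L(w) = ½ (‖s(w)‖² + ‖h(w)‖²)`. -/
def loss (σ : ℝ → ℝ) (D : Data d n₁ n₂) (a : Fin m → ℝ) (w : Fin m → Weight d) : ℝ :=
  (1 / 2) * ((∑ p : Fin n₁, residual σ D a w (Sum.inl p) ^ 2)
    + ∑ j : Fin n₂, residual σ D a w (Sum.inr j) ^ 2)

/-- The spatial part `(0, w₁, …, w_d, 0)` of a weight vector. -/
def spatial (w : Weight d) : Weight d :=
  WithLp.toLp 2 (fun i => if i = 0 ∨ i = Fin.last (d + 1) then 0 else w i)

/-- The third derivative of the activation, as the right derivative of `σ''`. It is `σ'''` where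
`σ''` is differentiable; for the cube of the ReLU it is `6 · 1{z ≥ 0}`. -/
def thirdDeriv (σ : ℝ → ℝ) (z : ℝ) : ℝ := derivWithin (deriv (deriv σ)) (Set.Ici z) z

/-- The gradient with respect to `w` of the contribution
`σ'(wᵀx̃) w₀ - σ''(wᵀx̃) ∑_{i=1}^d wᵢ²` of one neuron to the heat operator at `x`. -/
def interiorGrad (σ : ℝ → ℝ) (x : Point d) (w : Weight d) : Weight d :=
  (deriv (deriv σ) (inner ℝ w (aug x)) * w 0) • aug x
    + deriv σ (inner ℝ w (aug x)) • EuclideanSpace.single 0 1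
    - (thirdDeriv σ (inner ℝ w (aug x)) * ‖spatial w‖ ^ 2) • aug x
    - (2 * deriv (deriv σ) (inner ℝ w (aug x))) • spatial w

/-- The gradient with respect to `w` of `σ(wᵀỹ)`. -/
def boundaryGrad (σ : ℝ → ℝ) (y : Point d) (w : Weight d) : Weight d :=
  deriv σ (inner ℝ w (aug y)) • aug y

/-- The normalized gradients of one neuron, for all samples. -/
def neuronGrad (σ : ℝ → ℝ) (D : Data d n₁ n₂) (w : Weight d) : Fin n₁ ⊕ Fin n₂ → Weight d :=
  Sum.elim (fun p => (1 / √(n₁ : ℝ)) • interiorGrad σ (D.x p) w)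
    (fun j => (1 / √(n₂ : ℝ)) • boundaryGrad σ (D.y j) w)

/-- The Jacobian of the residual vector with respect to all hidden weights; the row of a sample
lists the gradients of its residual with respect to `w₁, …, w_m`
(see `hasGradientAt_residual`). -/
def jacobian (σ : ℝ → ℝ) (D : Data d n₁ n₂) (a : Fin m → ℝ) (w : Fin m → Weight d) :
    Matrix (Fin n₁ ⊕ Fin n₂) (Fin m × Fin (d + 2)) ℝ :=
  Matrix.of fun i q => (a q.1 / √(m : ℝ)) * neuronGrad σ D (w q.1) i q.2

/-- The Gram matrix `J Jᵀ`. -/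
def gram (σ : ℝ → ℝ) (D : Data d n₁ n₂) (a : Fin m → ℝ) (w : Fin m → Weight d) :
    Matrix (Fin n₁ ⊕ Fin n₂) (Fin n₁ ⊕ Fin n₂) ℝ :=
  jacobian σ D a w * (jacobian σ D a w)ᵀ

/-- One step `w ↦ w - η Jᵀ (J Jᵀ)⁻¹ (s, h)` of natural gradient descent. -/
def ngdStep (σ : ℝ → ℝ) (D : Data d n₁ n₂) (η : ℝ) (a : Fin m → ℝ) (w : Fin m → Weight d) :
    Fin m → Weight d :=
  fun r => w r - η • WithLp.toLp 2 (fun c =>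
    ((jacobian σ D a w)ᵀ *ᵥ ((gram σ D a w)⁻¹ *ᵥ residual σ D a w)) (r, c))

/-- The iterates `w(k)` of natural gradient descent started at `w(0) = w`. -/
def ngd (σ : ℝ → ℝ) (D : Data d n₁ n₂) (η : ℝ) (a : Fin m → ℝ) (w : Fin m → Weight d) :
    ℕ → Fin m → Weight d
  | 0 => w
  | k + 1 => ngdStep σ D η a (ngd σ D η a w k)

/-- The law of the initialization: `w₁(0), …, w_m(0)` i.i.d. standard Gaussian and `a₁, …, a_m`
i.i.d. uniform on `{-1, 1}`, all independent. -/
def initLaw (d m : ℕ) : Measure ((Fin m → Weight d) × (Fin m → ℝ)) :=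
  (Measure.pi fun _ => stdGaussian (Weight d)).prod
    (Measure.pi fun _ => uniformOn ({-1, 1} : Set ℝ))

/-- The expected Gram matrix `H^∞` under a standard Gaussian weight vector (since `aᵣ² = 1` and
the `wᵣ` are identically distributed, it is the expectation of `gram` for every width). -/
def gramInf (σ : ℝ → ℝ) (D : Data d n₁ n₂) : Matrix (Fin n₁ ⊕ Fin n₂) (Fin n₁ ⊕ Fin n₂) ℝ :=
  Matrix.of fun i j =>
    ∫ w, inner ℝ (neuronGrad σ D w i) (neuronGrad σ D w j) ∂(stdGaussian (Weight d))

/-- The least eigenvalue `λ₀` of `H^∞` (a real symmetric matrix). -/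
def lambda₀ (σ : ℝ → ℝ) (D : Data d n₁ n₂) : ℝ := sInf (spectrum ℝ (gramInf σ D))

/-- The cubed ReLU. -/
def relu3 (z : ℝ) : ℝ := max z 0 ^ 3

/-- Smooth activations: `|σ(0)| ≤ c`, the derivatives of orders `0, 1, 2, 3` are `c`-Lipschitz,
and `σ` is real analytic on `ℝ` and not a polynomial. -/
structure SmoothActivation (c : ℝ) (σ : ℝ → ℝ) : Prop where
  abs_zero_le : |σ 0| ≤ c
  lipschitz : ∀ k ≤ 3, ∀ z z' : ℝ, |iteratedDeriv k σ z - iteratedDeriv k σ z'| ≤ c * |z - z'|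
  analytic : ∀ z, AnalyticAt ℝ σ z
  not_polynomial : ¬ ∃ q : Polynomial ℝ, ∀ z, σ z = q.eval z

/-- With probability at least `1 - δ` over the initialization, for every `k` the matrix inverted
in the step from `w(k)` is invertible and `L(k) ≤ (1 - η)ᵏ L(0)`. The exceptional set is bounded
in outer measure, so no measurability is presupposed. -/
def ConvergesWithProb (σ : ℝ → ℝ) (D : Data d n₁ n₂) (m : ℕ) (η δ : ℝ) : Prop :=
  initLaw d m {ω | ¬ ∀ k : ℕ,
      IsUnit (gram σ D ω.2 (ngd σ D η ω.2 ω.1 k)) ∧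
      loss σ D ω.2 (ngd σ D η ω.2 ω.1 k) ≤ (1 - η) ^ k * loss σ D ω.2 ω.1}
    ≤ ENNReal.ofReal δ

/-! Checks of the closed-form gradients. -/

lemma inner_aug_add (w : Weight d) (x : Point d) (i : Fin (d + 1)) (t : ℝ) :
    inner ℝ w (aug (x + t • EuclideanSpace.single i 1)) = inner ℝ w (aug x) + t * w i.castSucc := by
  have : aug (x + t • EuclideanSpace.single i 1)
      = aug x + t • EuclideanSpace.single i.castSucc (1 : ℝ) := by
    ext j
    refine Fin.lastCases ?_ (fun j => ?_) j
    · simp [aug, Fin.ext_iff, i.isLt.ne']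
    · simp [aug]
  rw [this, inner_add_right, inner_smul_right]
  simp [EuclideanSpace.inner_single_right]

lemma norm_spatial_sq (w : Weight d) : ‖spatial w‖ ^ 2 = ∑ i : Fin d, w i.succ.castSucc ^ 2 := by
  rw [EuclideanSpace.norm_sq_eq, Fin.sum_univ_castSucc, Fin.sum_univ_succ]
  simp [spatial, sq_abs]

/-- The heat operator of the network in closed form. -/
theorem heatOp_net {σ : ℝ → ℝ} (hσ : ContDiff ℝ 2 σ) (a : Fin m → ℝ) (w : Fin m → Weight d)
    (x : Point d) :
    heatOp (net σ a w) x = (1 / √(m : ℝ)) * ∑ r, a r *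
      (deriv σ (inner ℝ (w r) (aug x)) * w r 0
        - deriv (deriv σ) (inner ℝ (w r) (aug x)) * ‖spatial (w r)‖ ^ 2) := by
  have hd : Differentiable ℝ σ := hσ.differentiable (by norm_num)
  have hd' : Differentiable ℝ (deriv σ) :=
    (hσ.iterate_deriv' 1 1).differentiable (by norm_num)
  have h1 (i : Fin (d + 1)) (t : ℝ) :
      HasDerivAt (fun t : ℝ => net σ a w (x + t • EuclideanSpace.single i 1))
        ((1 / √(m : ℝ)) * ∑ r, a r *
          (deriv σ (inner ℝ (w r) (aug x) + t * w r i.castSucc) * w r i.castSucc)) t := by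
    simp only [net, inner_aug_add]
    refine HasDerivAt.const_mul _ (HasDerivAt.fun_sum fun r _ => HasDerivAt.const_mul _ ?_)
    exact (hd _).hasDerivAt.comp t (((hasDerivAt_id t).mul_const _).const_add _ |>.congr_deriv
      (by simp))
  have h2 (i : Fin (d + 1)) :
      iteratedDeriv 2 (fun t : ℝ => net σ a w (x + t • EuclideanSpace.single i 1)) 0
        = (1 / √(m : ℝ)) * ∑ r, a r *
          (deriv (deriv σ) (inner ℝ (w r) (aug x)) * w r i.castSucc ^ 2) := by
    rw [iteratedDeriv_succ, iteratedDeriv_one, funext fun t => (h1 i t).deriv]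
    refine HasDerivAt.deriv (HasDerivAt.const_mul _ (HasDerivAt.fun_sum fun r _ =>
      HasDerivAt.const_mul _ ?_))
    have := ((hd' (inner ℝ (w r) (aug x) + 0 * w r i.castSucc)).hasDerivAt.comp 0
      (((hasDerivAt_id (0 : ℝ)).mul_const (w r i.castSucc)).const_add
        (inner ℝ (w r) (aug x)))).mul_const (w r i.castSucc)
    refine this.congr_deriv ?_
    simp
    ring
  rw [heatOp, (h1 0 0).deriv]
  simp only [h2, norm_spatial_sq]
  rw [← Finset.mul_sum, Finset.sum_comm, ← mul_sub, ← Finset.sum_sub_distrib]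
  congr 1
  refine Finset.sum_congr rfl fun r _ => ?_
  rw [← Finset.mul_sum, ← Finset.mul_sum, ← mul_sub]
  simp

lemma hasFDerivAt_norm_spatial_sq (w : Weight d) :
    HasFDerivAt (fun v : Weight d => ‖spatial v‖ ^ 2) (2 • innerSL ℝ (spatial w)) w := by
  let S : Weight d →L[ℝ] Weight d := LinearMap.toContinuousLinearMap
    { toFun := spatial
      map_add' := fun u v => by
        ext i; by_cases h : i = 0 ∨ i = Fin.last (d + 1) <;> simp [spatial, h]
      map_smul' := fun t v => by
        ext i; by_cases h : i = 0 ∨ i = Fin.last (d + 1) <;> simp [spatial, h] }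
  have hS (v : Weight d) : S v = spatial v := rfl
  have h := (S.hasFDerivAt (x := w)).norm_sq
  simp only [hS] at h
  refine h.congr_fderiv ?_
  ext v
  have : inner ℝ (spatial w) (spatial v) = inner ℝ (spatial w) v := by
    simp only [PiLp.inner_apply]
    refine Finset.sum_congr rfl fun i _ => ?_
    by_cases h : i = 0 ∨ i = Fin.last (d + 1) <;> simp [spatial, h]
  simp [hS, this]

lemma hasFDerivAt_inner_left (x w : Weight d) :
    HasFDerivAt (fun v : Weight d => inner ℝ v x) (innerSL ℝ x) w := by
  refine (innerSL ℝ x).hasFDerivAt.congr_of_eventuallyEq (Filter.Eventually.of_forall fun v => ?_)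
  simp [real_inner_comm]

lemma hasGradientAt_interior {σ : ℝ → ℝ} (hσ : ContDiff ℝ 2 σ) (x : Point d) (w : Weight d)
    (h3 : DifferentiableAt ℝ (deriv (deriv σ)) (inner ℝ w (aug x))) :
    HasGradientAt (fun v : Weight d => deriv σ (inner ℝ v (aug x)) * v 0
      - deriv (deriv σ) (inner ℝ v (aug x)) * ‖spatial v‖ ^ 2) (interiorGrad σ x w) w := by
  have hd' : Differentiable ℝ (deriv σ) :=
    (hσ.iterate_deriv' 1 1).differentiable (by norm_num)
  have ht : thirdDeriv σ (inner ℝ w (aug x)) = deriv (deriv (deriv σ)) (inner ℝ w (aug x)) :=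
    h3.derivWithin (uniqueDiffOn_Ici _ _ Set.self_mem_Ici)
  have hz := hasFDerivAt_inner_left (aug x) w
  have e1 := (hd' _).hasDerivAt.comp_hasFDerivAt w hz
  have e2 := h3.hasDerivAt.comp_hasFDerivAt w hz
  have e0 : HasFDerivAt (fun v : Weight d => v 0) (EuclideanSpace.proj (𝕜 := ℝ) 0) w :=
    (EuclideanSpace.proj (𝕜 := ℝ) (0 : Fin (d + 2))).hasFDerivAt
  have := (e1.mul e0).sub (e2.mul (hasFDerivAt_norm_spatial_sq w))
  rw [hasGradientAt_iff_hasFDerivAt]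
  refine this.congr_fderiv ?_
  ext v
  simp [interiorGrad, ht,
    EuclideanSpace.inner_single_left]
  ring

lemma hasGradientAt_boundary {σ : ℝ → ℝ} (hσ : ContDiff ℝ 2 σ) (y : Point d) (w : Weight d) :
    HasGradientAt (fun v : Weight d => σ (inner ℝ v (aug y))) (boundaryGrad σ y w) w := by
  have hd : Differentiable ℝ σ := hσ.differentiable (by norm_num)
  have := (hd _).hasDerivAt.comp_hasFDerivAt w (hasFDerivAt_inner_left (aug y) w)
  rw [hasGradientAt_iff_hasFDerivAt]
  refine this.congr_fderiv ?_
  ext v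
  simp [boundaryGrad]

lemma hasGradientAt_block {ψ : Weight d → ℝ} {G : Weight d} (a : Fin m → ℝ)
    (w : Fin m → Weight d) (r : Fin m) (α b : ℝ) (h : HasGradientAt ψ G (w r)) :
    HasGradientAt
      (fun v => α * ((1 / √(m : ℝ)) * ∑ s, a s * ψ (Function.update w r v s) - b))
      ((a r / √(m : ℝ)) • α • G) (w r) := by
  have e (v : Weight d) : α * ((1 / √(m : ℝ)) * ∑ s, a s * ψ (Function.update w r v s) - b)
      = (a r / √(m : ℝ) * α) * ψ v
        + α * ((1 / √(m : ℝ)) * (∑ s ∈ Finset.univ.erase r, a s * ψ (w s)) - b) := by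
    rw [← Finset.add_sum_erase _ _ (Finset.mem_univ r), Function.update_self,
      Finset.sum_congr rfl fun s hs => by
        rw [Function.update_of_ne (Finset.ne_of_mem_erase hs)]]
    ring
  simp only [e]
  rw [hasGradientAt_iff_hasFDerivAt] at h ⊢
  refine ((h.const_mul (a r / √(m : ℝ) * α)).add_const _).congr_fderiv ?_
  ext v
  simp
  ring

lemma hasDerivAt_max_pow (n : ℕ) (z : ℝ) :
    HasDerivAt (fun z : ℝ => max z 0 ^ (n + 2)) ((n + 2) * max z 0 ^ (n + 1)) z := by
  rcases lt_trichotomy z 0 with h | rfl | h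
  · have e : (fun z : ℝ => max z 0 ^ (n + 2)) =ᶠ[nhds z] fun _ => 0 := by
      filter_upwards [gt_mem_nhds h] with y hy
      simp [max_eq_right (le_of_lt hy)]
    simpa [max_eq_right h.le] using (hasDerivAt_const z (0 : ℝ)).congr_of_eventuallyEq e
  · rw [hasDerivAt_iff_isLittleO]
    simp only [max_self, ne_eq, Nat.add_eq_zero_iff, one_ne_zero, OfNat.ofNat_ne_zero, and_false,
      not_false_eq_true, zero_pow, mul_zero, smul_zero, sub_zero]
    refine Asymptotics.IsBigO.trans_isLittleO
      (g := fun z : ℝ => z ^ (n + 2)) (.of_bound 1 (Filter.Eventually.of_forall fun y => ?_))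
      (Asymptotics.isLittleO_pow_id (by omega))
    rw [one_mul]
    rw [norm_pow, norm_pow]
    gcongr
    rcases le_total y 0 with h | h <;> simp [h]
  · have e : (fun z : ℝ => max z 0 ^ (n + 2)) =ᶠ[nhds z] fun z => z ^ (n + 2) := by
      filter_upwards [lt_mem_nhds h] with y hy
      simp [max_eq_left (le_of_lt hy)]
    simpa [max_eq_left h.le] using (hasDerivAt_pow (n + 2) z).congr_of_eventuallyEq e

lemma deriv_relu3 : deriv relu3 = fun z => 3 * max z 0 ^ 2 := by
  funext z
  refine ((hasDerivAt_max_pow 1 z).congr_deriv ?_).deriv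
  norm_num

lemma deriv_deriv_relu3 : deriv (deriv relu3) = fun z => 6 * max z 0 := by
  rw [deriv_relu3]
  funext z
  refine (((hasDerivAt_max_pow 0 z).const_mul 3).congr_deriv ?_).deriv
  norm_num
  ring

lemma contDiff_relu3 : ContDiff ℝ 2 relu3 := by
  rw [show (2 : WithTop ℕ∞) = 1 + 1 by norm_num, contDiff_succ_iff_deriv]
  refine ⟨fun z => (hasDerivAt_max_pow 1 z).differentiableAt, by simp, ?_⟩
  rw [contDiff_one_iff_deriv, deriv_deriv_relu3, deriv_relu3]
  exact ⟨fun z => ((hasDerivAt_max_pow 0 z).const_mul 3).differentiableAt, by fun_prop⟩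

lemma thirdDeriv_relu3 (z : ℝ) : thirdDeriv relu3 z = if 0 ≤ z then 6 else 0 := by
  rw [thirdDeriv, deriv_deriv_relu3]
  split_ifs with h
  · have : HasDerivWithinAt (fun z : ℝ => 6 * max z 0) 6 (Set.Ici z) z := by
      refine HasDerivWithinAt.congr (f := fun z : ℝ => 6 * z) ?_ (fun y hy => ?_) ?_
      · simpa using ((hasDerivAt_id z).const_mul 6).hasDerivWithinAt
      · rw [max_eq_left (h.trans hy)]
      · rw [max_eq_left h]
    exact this.derivWithin (uniqueDiffOn_Ici _ _ Set.self_mem_Ici)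
  · have e : (fun z : ℝ => 6 * max z 0) =ᶠ[nhds z] fun _ => 0 := by
      filter_upwards [gt_mem_nhds (not_le.mp h)] with y hy
      simp [max_eq_right (le_of_lt hy)]
    exact ((hasDerivAt_const z (0 : ℝ)).congr_of_eventuallyEq e).hasDerivWithinAt.derivWithin
      (uniqueDiffOn_Ici _ _ Set.self_mem_Ici)

/-- Each block of a row of `jacobian` is the gradient of the corresponding residual with respect
to the weights of one neuron, wherever `σ''` is differentiable. -/
theorem hasGradientAt_residual {σ : ℝ → ℝ} (hσ : ContDiff ℝ 2 σ) (D : Data d n₁ n₂)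
    (a : Fin m → ℝ) (w : Fin m → Weight d) (i : Fin n₁ ⊕ Fin n₂) (r : Fin m)
    (h3 : DifferentiableAt ℝ (deriv (deriv σ)) (inner ℝ (w r) (aug (D.sample i)))) :
    HasGradientAt (fun v => residual σ D a (Function.update w r v) i)
      (WithLp.toLp 2 fun c => jacobian σ D a w i (r, c)) (w r) := by
  cases i with
  | inl p =>
    have := hasGradientAt_block a w r (1 / √(n₁ : ℝ)) (D.f (D.x p))
      (hasGradientAt_interior hσ (D.x p) (w r) h3)
    simp only [residual, Sum.elim_inl, heatOp_net hσ]
    convert this using 1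
    ext c
    simp [jacobian, neuronGrad]
  | inr j =>
    have := hasGradientAt_block a w r (1 / √(n₂ : ℝ)) (D.g (D.y j))
      (hasGradientAt_boundary hσ (D.y j) (w r))
    simp only [residual, Sum.elim_inr, net]
    convert this using 1
    ext c
    simp [jacobian, neuronGrad]

end PINN

end

/-!
Why natural gradient descent converges linearly for wide networks.

*Deterministic part.* Write `q = √(1 - η)` and suppose that at the initialization `Jᵀ` is bounded
below by `√μ`. If, on a region around the initialization, `J` varies by at most a small multiple of
`√μ` and the residual agrees with its linearization up to a small multiple of the step length, then
`J Jᵀ` stays invertible there, the step `-η Jᵀ (J Jᵀ)⁻¹ r` changes the residual `r` into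
`(1 - η) r` up to an error that is small relative to `r`, and the residual norm contracts by the
factor `q`. The steps are dominated by a geometric series, so the iterates stay in the region. Each
single weight vector moves only by `O(1 / √m)`, since every block of `J` carries the factor
`1 / √m`. This is `LocallyRegular.converges`.

*Regularity.* `ActivationBounds` collects growth and Taylor bounds of the activation which imply
those of the gradients of a neuron (`norm_rawGrad_sub_le`, `abs_neuronVal_taylor_le`). They hold
for smooth activations, and for the cubed ReLU apart from the jump of `σ'''` at `0`. The neurons
that can meet the jump at a given sample are those whose activation is initially within a multiple
of the distance travelled from `0`; they are few by a small-ball estimate for Gaussian projections.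

*Positivity of `λ₀`.* A vector in the kernel of `H^∞` gives a linear relation between the gradients
of a neuron for almost all weights; their last coordinates, the derivatives with respect to the bias,
already are independent. For the cubed ReLU (`biasGradIndep_relu3`) the relation is tested at a
point on the hyperplane of one sample only, where just that sample contributes a jump. For analytic
activations (`SmoothActivation.biasGradIndep`) it is restricted to a line `t v`; its Taylor
coefficients are exponential sums `∑ Pᵢ(k) zᵢᵏ` with `zᵢ = ⟨v, x̃ᵢ⟩` of pairwise distinct absolute
value, and they vanish for infinitely many `k` as `σ` is not a polynomial.

*Probability.* The Gram matrix, the network values and the number of possible jumps are averages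
over independent neurons. After truncating the weights at `1 + ‖w_r‖ ≤ M`, `M² ~ d log (m d / δ)`,
Bernstein's inequality `bernstein_mean` applies in its Gaussian range, with variances bounded by
moments `E (1 + ‖w‖)^{2k} = O(dᵏ)` that are free of logarithms. The width conditions needed for all
this, together with `λ₀ = O(d²)`, are implied by the stated ones.
-/

open MeasureTheory ProbabilityTheory Matrix

namespace PINN

/-! ### Concentration of means of independent variables -/

/-- One-sided Bernstein inequality in the sub-Gaussian range: for a bounded centred variable `X`
the exponential moment is at most `exp (θ² V)` as long as `θ |X| ≤ 1`. -/
lemma bernstein_one_sided {Ω : Type*} [MeasurableSpace Ω] (μ : Measure Ω) [IsProbabilityMeasure μ]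
    {m : ℕ} {X : Ω → ℝ} (hX : Measurable X) {b V t : ℝ} (hb : ∀ x, |X x| ≤ b)
    (h0 : ∫ x, X x ∂μ = 0) (hV : ∫ x, X x ^ 2 ∂μ ≤ V) (hV0 : 0 < V) (ht : 0 < t)
    (htb : t * b ≤ 2 * V) :
    (Measure.pi fun _ : Fin m => μ) {ω | m * t ≤ ∑ r, X (ω r)}
      ≤ ENNReal.ofReal (Real.exp (-(m * t ^ 2 / (4 * V)))) := by
  set θ := t / (2 * V) with hθ
  have hθ0 : 0 < θ := by positivity
  have hθX : ∀ x, |θ * X x| ≤ 1 := fun x => by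
    rw [abs_mul, abs_of_pos hθ0, hθ, div_mul_eq_mul_div, div_le_one (by positivity)]
    exact (mul_le_mul_of_nonneg_left (hb x) ht.le).trans htb
  have hint : ∀ f : Ω → ℝ, Measurable f → (∃ c, ∀ x, |f x| ≤ c) → Integrable f μ :=
    fun f hf ⟨c, hc⟩ => Integrable.of_bound hf.aestronglyMeasurable c (ae_of_all _ hc)
  have hXi : Integrable X μ := hint X hX ⟨b, hb⟩
  have hX2i : Integrable (fun x => X x ^ 2) μ := hint _ (hX.pow_const 2)
    ⟨b ^ 2, fun x => by rw [abs_pow]; exact pow_le_pow_left₀ (abs_nonneg _) (hb x) 2⟩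
  have hei : Integrable (fun x => Real.exp (θ * X x)) μ :=
    hint _ (by fun_prop) ⟨Real.exp 1, fun x => by
      rw [abs_of_pos (Real.exp_pos _)]
      exact Real.exp_le_exp.2 ((le_abs_self _).trans (hθX x))⟩
  have hmgf : ∫ x, Real.exp (θ * X x) ∂μ ≤ Real.exp (θ ^ 2 * V) := by
    calc ∫ x, Real.exp (θ * X x) ∂μ ≤ ∫ x, (1 + θ * X x + θ ^ 2 * X x ^ 2) ∂μ := by
          refine integral_mono hei ?_ fun x => ?_
          · exact ((integrable_const _).add (hXi.const_mul _)).add (hX2i.const_mul _)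
          · have := (abs_le.1 (Real.abs_exp_sub_one_sub_id_le (hθX x))).2
            rw [mul_pow] at this
            dsimp only
            linarith
      _ = 1 + θ ^ 2 * ∫ x, X x ^ 2 ∂μ := by
          have hc : Integrable (fun _ : Ω => (1 : ℝ)) μ := integrable_const _
          have hl : Integrable (fun x => 1 + θ * X x) μ := hc.add (hXi.const_mul θ)
          rw [integral_add hl (hX2i.const_mul _), integral_add hc (hXi.const_mul _),
            integral_const_mul, integral_const_mul, h0]
          simp
      _ ≤ θ ^ 2 * V + 1 := by
          have := mul_le_mul_of_nonneg_left hV (sq_nonneg θ)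
          linarith
      _ ≤ _ := Real.add_one_le_exp _
  set P := Measure.pi fun _ : Fin m => μ
  have hprod : ∀ ω : Fin m → Ω, Real.exp (θ * ∑ r, X (ω r)) = ∏ r, Real.exp (θ * X (ω r)) :=
    fun ω => by rw [Finset.mul_sum, Real.exp_sum]
  have hmk := measure_ge_le_exp_mul_mgf (X := fun ω : Fin m → Ω => ∑ r, X (ω r)) (μ := P)
    (m * t) hθ0.le (by
      simp only [hprod]
      exact Integrable.fintype_prod (f := fun _ x => Real.exp (θ * X x)) fun _ => hei)
  have hm : mgf (fun ω : Fin m → Ω => ∑ r, X (ω r)) P θ ≤ Real.exp (θ ^ 2 * V) ^ m := by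
    rw [mgf]
    simp only [hprod]
    rw [integral_fintype_prod_eq_prod (fun _ x => Real.exp (θ * X x))]
    simp only [Finset.prod_const, Finset.card_univ, Fintype.card_fin]
    exact pow_le_pow_left₀ (integral_nonneg fun x => (Real.exp_pos _).le) hmgf m
  rw [← ofReal_measureReal]
  refine ENNReal.ofReal_le_ofReal (hmk.trans ?_)
  calc Real.exp (-θ * (m * t)) * mgf (fun ω : Fin m → Ω => ∑ r, X (ω r)) P θ
      ≤ Real.exp (-θ * (m * t)) * Real.exp (θ ^ 2 * V) ^ m :=
        mul_le_mul_of_nonneg_left hm (Real.exp_pos _).le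
    _ = Real.exp (-(m * t ^ 2 / (4 * V))) := by
        rw [← Real.exp_nat_mul, ← Real.exp_add]
        congr 1
        rw [hθ]
        field_simp
        ring

/-- Bernstein's inequality for the mean of `m` independent copies of a bounded variable, in the
range `t B ≤ V` where the tail is Gaussian. -/
lemma bernstein_mean {Ω : Type*} [MeasurableSpace Ω] (μ : Measure Ω) [IsProbabilityMeasure μ]
    {m : ℕ} (hm : 0 < m) {Y : Ω → ℝ} (hY : Measurable Y) {B V t : ℝ} (hB : ∀ x, |Y x| ≤ B)
    (hV : ∫ x, Y x ^ 2 ∂μ ≤ V) (hV0 : 0 < V) (ht : 0 < t) (htB : t * B ≤ V) :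
    (Measure.pi fun _ : Fin m => μ) {ω | t ≤ |(∑ r, Y (ω r)) / m - ∫ x, Y x ∂μ|}
      ≤ ENNReal.ofReal (2 * Real.exp (-(m * t ^ 2 / (4 * V)))) := by
  set e := ∫ x, Y x ∂μ with he
  have hYi : Integrable Y μ := Integrable.of_bound hY.aestronglyMeasurable B (ae_of_all _ hB)
  have hY2i : Integrable (fun x => Y x ^ 2) μ :=
    Integrable.of_bound (hY.pow_const 2).aestronglyMeasurable (B ^ 2) (ae_of_all _ fun x => by
      rw [Real.norm_eq_abs, abs_pow]; exact pow_le_pow_left₀ (abs_nonneg _) (hB x) 2)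
  have heB : |e| ≤ B := by
    have := norm_integral_le_of_norm_le_const (μ := μ) (f := Y) (C := B) (ae_of_all _ hB)
    simpa using this
  have hvar : ∫ x, (Y x - e) ^ 2 ∂μ ≤ V := by
    have : ∫ x, (Y x - e) ^ 2 ∂μ = ∫ x, Y x ^ 2 ∂μ - e ^ 2 := by
      calc ∫ x, (Y x - e) ^ 2 ∂μ = ∫ x, (Y x ^ 2 - 2 * e * Y x + e ^ 2) ∂μ := by
            congr 1; ext x; ring
        _ = _ := by
            have hl : Integrable (fun x => Y x ^ 2 - 2 * e * Y x) μ :=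
              hY2i.sub (hYi.const_mul _)
            rw [integral_add hl (integrable_const _), integral_sub hY2i (hYi.const_mul _),
              integral_const_mul, ← he]
            simp
            ring
    rw [this]
    linarith [sq_nonneg e]
  have hb : ∀ x, |Y x - e| ≤ 2 * B := fun x => by
    linarith [abs_sub (Y x) e, hB x]
  have h1 := bernstein_one_sided μ (m := m) (X := fun x => Y x - e) (hY.sub_const e) hb
    (by rw [integral_sub hYi (integrable_const _)]; simp [he]) hvar hV0 ht (by linarith)
  have h2 := bernstein_one_sided μ (m := m) (X := fun x => e - Y x) (hY.const_sub e)
    (fun x => by rw [abs_sub_comm]; exact hb x)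
    (by rw [integral_sub (integrable_const _) hYi]; simp [he])
    (by simpa only [sub_sq_comm] using hvar) hV0 ht (by linarith)
  have hm' : (0 : ℝ) < m := Nat.cast_pos.2 hm
  have hsub : {ω : Fin m → Ω | t ≤ |(∑ r, Y (ω r)) / m - e|}
      ⊆ {ω | m * t ≤ ∑ r, (Y (ω r) - e)} ∪ {ω | m * t ≤ ∑ r, (e - Y (ω r))} := by
    intro ω hω
    simp only [Set.mem_ofPred_eq, Set.mem_union, Finset.sum_sub_distrib, Finset.sum_const,
      Finset.card_univ, Fintype.card_fin, nsmul_eq_mul] at hω ⊢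
    have e1 : (m : ℝ) * ((∑ r, Y (ω r)) / m - e) = ∑ r, Y (ω r) - m * e := by field_simp
    rcases le_abs.1 hω with h | h
    · left; rw [← e1]; exact mul_le_mul_of_nonneg_left h hm'.le
    · right
      have := mul_le_mul_of_nonneg_left h hm'.le
      linarith
  refine (measure_mono hsub).trans ((measure_union_le _ _).trans ((add_le_add h1 h2).trans ?_))
  rw [← ENNReal.ofReal_add (Real.exp_pos _).le (Real.exp_pos _).le, two_mul]

/-! ### The standard Gaussian measure -/

lemma map_inner_stdGaussian {n : ℕ} (v : EuclideanSpace ℝ (Fin n)) :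
    (stdGaussian (EuclideanSpace ℝ (Fin n))).map (fun w => inner ℝ w v)
      = gaussianReal 0 (‖v‖ ^ 2).toNNReal := by
  have h := IsGaussian.map_eq_gaussianReal (μ := stdGaussian (EuclideanSpace ℝ (Fin n)))
    (innerSL ℝ v)
  rw [integral_strongDual_stdGaussian, variance_dual_stdGaussian, innerSL_apply_norm] at h
  rw [← h]
  congr 1
  ext w
  simp [real_inner_comm]

lemma map_coord_stdGaussian {n : ℕ} (i : Fin n) :
    (stdGaussian (EuclideanSpace ℝ (Fin n))).map (fun w => w i) = gaussianReal 0 1 := by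
  have h := map_inner_stdGaussian (EuclideanSpace.single i (1 : ℝ))
  simpa [EuclideanSpace.inner_single_right] using h

instance isOpenPosMeasure_stdGaussian {n : ℕ} :
    (stdGaussian (EuclideanSpace ℝ (Fin n))).IsOpenPosMeasure := by
  rw [← map_pi_eq_stdGaussian]
  have : (gaussianReal 0 1).IsOpenPosMeasure :=
    (gaussianReal_absolutelyContinuous' 0 one_ne_zero).isOpenPosMeasure
  exact (PiLp.continuous_toLp 2 _).isOpenPosMeasure_map (WithLp.toLp_surjective 2)

lemma integrable_norm_pow_stdGaussian (n k : ℕ) :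
    Integrable (fun w : EuclideanSpace ℝ (Fin n) => ‖w‖ ^ k) (stdGaussian _) := by
  rcases eq_or_ne k 0 with rfl | hk
  · simp
  · exact (IsGaussian.memLp_id _ (k : ENNReal) (by simp)).integrable_norm_pow hk

lemma integrable_one_add_norm_pow (n k : ℕ) :
    Integrable (fun w : EuclideanSpace ℝ (Fin n) => (1 + ‖w‖) ^ k) (stdGaussian _) := by
  have : (fun w : EuclideanSpace ℝ (Fin n) => (1 + ‖w‖) ^ k)
      = fun w => ∑ j ∈ Finset.range (k + 1), ‖w‖ ^ (k - j) * (k.choose j : ℝ) := by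
    ext w
    rw [add_pow]
    simp
  rw [this]
  exact integrable_finsetSum _ fun j _ => (integrable_norm_pow_stdGaussian n _).mul_const _

/-- Moments of the norm: `E (1 + ‖w‖)^{2k} = O(d^k)`. -/
lemma exists_moment_bound (k : ℕ) : ∃ C : ℝ, 0 < C ∧ ∀ d : ℕ, 1 ≤ d →
    ∫ w : Weight d, (1 + ‖w‖) ^ (2 * k) ∂(stdGaussian (Weight d)) ≤ C * (d : ℝ) ^ k := by
  rcases Nat.eq_zero_or_pos k with rfl | hk
  · exact ⟨1, one_pos, fun d _ => by simp⟩
  obtain ⟨k, rfl⟩ : ∃ j, k = j + 1 := ⟨k - 1, by omega⟩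
  set E := ∫ z : ℝ, (1 + z ^ 2) ^ (k + 1) ∂(gaussianReal 0 1) with hE
  have hgi : Integrable (fun z : ℝ => (1 + z ^ 2) ^ (k + 1)) (gaussianReal 0 1) := by
    have : (fun z : ℝ => (1 + z ^ 2) ^ (k + 1))
        = fun z => ∑ j ∈ Finset.range (k + 1 + 1), ‖z‖ ^ (2 * (k + 1 - j)) *
          ((k + 1).choose j : ℝ) := by
      ext z
      rw [add_pow]
      refine Finset.sum_congr rfl fun j _ => ?_
      rw [pow_mul ‖z‖, Real.norm_eq_abs, sq_abs, one_pow, one_mul]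
    rw [this]
    refine integrable_finsetSum _ fun j _ => Integrable.mul_const ?_ _
    rcases eq_or_ne (2 * (k + 1 - j)) 0 with h | h
    · simp [h]
    · exact (memLp_id_gaussianReal' _ (ENNReal.natCast_ne_top _)).integrable_norm_pow h
  have hE0 : 0 ≤ E := integral_nonneg fun z => by positivity
  refine ⟨2 ^ (k + 1) * 3 ^ (k + 1) * (E + 1), by positivity, fun d hd => ?_⟩
  have hD : (0 : ℝ) < ((d + 2 : ℕ) : ℝ) := by positivity
  have hpt : ∀ w : Weight d, (1 + ‖w‖) ^ (2 * (k + 1))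
      ≤ 2 ^ (k + 1) * ((d + 2 : ℕ) : ℝ) ^ k * ∑ i, (1 + w i ^ 2) ^ (k + 1) := by
    intro w
    have h1 : (1 + ‖w‖) ^ 2 ≤ 2 * ∑ i, (1 + w i ^ 2) := by
      rw [Finset.sum_add_distrib]
      simp only [Finset.sum_const, Finset.card_univ, Fintype.card_fin, nsmul_eq_mul, mul_one]
      have := EuclideanSpace.real_norm_sq_eq w
      have : (1 : ℝ) ≤ ((d + 2 : ℕ) : ℝ) := by exact_mod_cast (by omega : 1 ≤ d + 2)
      nlinarith [sq_nonneg (1 - ‖w‖)]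
    have h2 := pow_sum_div_card_le_sum_pow (s := Finset.univ)
      (f := fun i : Fin (d + 2) => 1 + w i ^ 2) (fun i _ => by positivity) k
    rw [Finset.card_univ, Fintype.card_fin, div_le_iff₀ (by positivity)] at h2
    calc (1 + ‖w‖) ^ (2 * (k + 1)) = ((1 + ‖w‖) ^ 2) ^ (k + 1) := by rw [pow_mul]
      _ ≤ (2 * ∑ i, (1 + w i ^ 2)) ^ (k + 1) := pow_le_pow_left₀ (by positivity) h1 _
      _ = 2 ^ (k + 1) * (∑ i, (1 + w i ^ 2)) ^ (k + 1) := by rw [mul_pow]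
      _ ≤ 2 ^ (k + 1) * ((∑ i, (1 + w i ^ 2) ^ (k + 1)) * ((d + 2 : ℕ) : ℝ) ^ k) := by gcongr
      _ = _ := by ring
  have hci : ∀ i : Fin (d + 2), Integrable (fun w : Weight d => (1 + w i ^ 2) ^ (k + 1))
      (stdGaussian (Weight d)) := fun i => by
    have := map_coord_stdGaussian i
    rw [← this] at hgi
    exact hgi.comp_measurable (f := fun w : Weight d => w i) (by fun_prop)
  have hcE : ∀ i : Fin (d + 2), ∫ w : Weight d, (1 + w i ^ 2) ^ (k + 1) ∂(stdGaussian (Weight d))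
      = E := fun i => by
    rw [hE, ← map_coord_stdGaussian i, integral_map (by fun_prop) (by fun_prop)]
  calc ∫ w : Weight d, (1 + ‖w‖) ^ (2 * (k + 1)) ∂(stdGaussian (Weight d))
      ≤ ∫ w : Weight d, 2 ^ (k + 1) * ((d + 2 : ℕ) : ℝ) ^ k * ∑ i, (1 + w i ^ 2) ^ (k + 1)
          ∂(stdGaussian (Weight d)) :=
        integral_mono (integrable_one_add_norm_pow _ _)
          ((integrable_finsetSum _ fun i _ => hci i).const_mul _) hpt
    _ = 2 ^ (k + 1) * ((d + 2 : ℕ) : ℝ) ^ (k + 1) * E := by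
        rw [integral_const_mul, integral_finsetSum _ fun i _ => hci i]
        simp only [hcE, Finset.sum_const, Finset.card_univ, Fintype.card_fin, nsmul_eq_mul]
        ring
    _ ≤ 2 ^ (k + 1) * (3 * d) ^ (k + 1) * (E + 1) := by
        gcongr
        · push_cast
          have : (1 : ℝ) ≤ d := by exact_mod_cast hd
          linarith
        · linarith
    _ = _ := by rw [mul_pow]; ring

lemma gaussianReal_abs_ge_le {u : ℝ} (hu : 0 ≤ u) :
    gaussianReal 0 1 {z | u ≤ |z|} ≤ ENNReal.ofReal (2 * Real.exp (-(u ^ 2 / 2))) := by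
  have h1 := measure_ge_le_exp_mul_mgf (X := (id : ℝ → ℝ)) (μ := gaussianReal 0 1) u hu
    (integrable_exp_mul_gaussianReal u)
  have h2 := measure_le_le_exp_mul_mgf (X := (id : ℝ → ℝ)) (μ := gaussianReal 0 1) (t := -u) (-u)
    (neg_nonpos.2 hu) (integrable_exp_mul_gaussianReal (-u))
  rw [mgf_id_gaussianReal, ← Real.exp_add] at h1 h2
  have hsub : {z : ℝ | u ≤ |z|} ⊆ {z | u ≤ id z} ∪ {z | id z ≤ -u} := by
    intro z hz
    rw [Set.mem_ofPred_eq] at hz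
    rcases le_abs.1 hz with h | h
    · exact Or.inl h
    · exact Or.inr (by simp only [id, Set.mem_ofPred_eq]; linarith)
  rw [← ofReal_measureReal]
  refine ENNReal.ofReal_le_ofReal ?_
  refine (measureReal_mono hsub).trans ((measureReal_union_le _ _).trans ?_)
  have e1 : -u * u + (0 * u + ((1 : NNReal) : ℝ) * u ^ 2 / 2) = -(u ^ 2 / 2) := by simp; ring
  have e2 : - -u * -u + (0 * -u + ((1 : NNReal) : ℝ) * (-u) ^ 2 / 2) = -(u ^ 2 / 2) := by
    simp; ring
  rw [e1] at h1
  rw [e2] at h2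
  linarith

/-- If all coordinates are below `u` then `‖w‖² ≤ (d + 2) u²`. -/
lemma stdGaussian_norm_gt_le {d : ℕ} {u : ℝ} (hu : 0 ≤ u) :
    stdGaussian (Weight d) {w | (d + 2 : ℕ) * u ^ 2 < ‖w‖ ^ 2}
      ≤ ENNReal.ofReal ((d + 2 : ℕ) * (2 * Real.exp (-(u ^ 2 / 2)))) := by
  have hsub : {w : Weight d | (d + 2 : ℕ) * u ^ 2 < ‖w‖ ^ 2} ⊆ ⋃ i, {w | u ≤ |w i|} := by
    intro w hw
    by_contra hcon
    simp only [Set.mem_iUnion, Set.mem_ofPred_eq, not_exists, not_le] at hcon hw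
    rw [EuclideanSpace.real_norm_sq_eq] at hw
    have : ∑ i, w i ^ 2 ≤ ∑ _i : Fin (d + 2), u ^ 2 := Finset.sum_le_sum fun i _ => by
      rw [← sq_abs]
      exact pow_le_pow_left₀ (abs_nonneg _) (hcon i).le 2
    simp only [Finset.sum_const, Finset.card_univ, Fintype.card_fin, nsmul_eq_mul] at this
    linarith
  refine (measure_mono hsub).trans ((measure_iUnion_fintype_le _ _).trans ?_)
  have hi : ∀ i : Fin (d + 2), stdGaussian (Weight d) {w | u ≤ |w i|}
      ≤ ENNReal.ofReal (2 * Real.exp (-(u ^ 2 / 2))) := fun i => by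
    have := gaussianReal_abs_ge_le hu
    rw [← map_coord_stdGaussian i, Measure.map_apply (by fun_prop)
      (measurableSet_le measurable_const (by fun_prop))] at this
    exact this
  refine (Finset.sum_le_sum fun i _ => hi i).trans ?_
  simp only [Finset.sum_const, Finset.card_univ, Fintype.card_fin, nsmul_eq_mul]
  rw [ENNReal.ofReal_mul (by positivity) (p := ((d + 2 : ℕ) : ℝ)), ENNReal.ofReal_natCast]

/-- Small-ball estimate: a Gaussian projection of standard deviation at least one has density at
most `1/2`. -/
lemma stdGaussian_abs_inner_le {n : ℕ} {v : EuclideanSpace ℝ (Fin n)} (hv : 1 ≤ ‖v‖) (s : ℝ) :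
    stdGaussian (EuclideanSpace ℝ (Fin n)) {w | |inner ℝ w v| ≤ s} ≤ ENNReal.ofReal s := by
  have hms : MeasurableSet {z : ℝ | |z| ≤ s} := measurableSet_le (by fun_prop) measurable_const
  have h1 : stdGaussian (EuclideanSpace ℝ (Fin n)) {w | |inner ℝ w v| ≤ s}
      = gaussianReal 0 (‖v‖ ^ 2).toNNReal {z | |z| ≤ s} := by
    rw [← map_inner_stdGaussian v, Measure.map_apply (by fun_prop) hms]
    rfl
  have hv0 : (‖v‖ ^ 2).toNNReal ≠ 0 := by
    rw [ne_eq, Real.toNNReal_eq_zero, not_le]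
    positivity
  have hpdf : ∀ z, gaussianPDF 0 (‖v‖ ^ 2).toNNReal z ≤ ENNReal.ofReal (1 / 2) := fun z => by
    refine ENNReal.ofReal_le_ofReal ?_
    rw [gaussianPDFReal, Real.coe_toNNReal _ (sq_nonneg _)]
    have he : Real.exp (-(z - 0) ^ 2 / (2 * ‖v‖ ^ 2)) ≤ 1 := by
      rw [Real.exp_le_one_iff]
      exact div_nonpos_of_nonpos_of_nonneg (by nlinarith [sq_nonneg (z - 0)]) (by positivity)
    have hs2 : (2 : ℝ) ≤ √(2 * Real.pi * ‖v‖ ^ 2) := by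
      apply Real.le_sqrt_of_sq_le
      nlinarith [Real.pi_gt_three, one_le_pow₀ hv (n := 2)]
    calc (√(2 * Real.pi * ‖v‖ ^ 2))⁻¹ * Real.exp (-(z - 0) ^ 2 / (2 * ‖v‖ ^ 2))
        ≤ (2 : ℝ)⁻¹ * 1 := by gcongr
      _ = 1 / 2 := by norm_num
  rw [h1, gaussianReal_apply _ hv0]
  have hset : {z : ℝ | |z| ≤ s} = Set.Icc (-s) s := by ext z; simp [abs_le]
  calc ∫⁻ z in {z | |z| ≤ s}, gaussianPDF 0 (‖v‖ ^ 2).toNNReal z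
      ≤ ∫⁻ _ in {z : ℝ | |z| ≤ s}, ENNReal.ofReal (1 / 2) := lintegral_mono hpdf
    _ = ENNReal.ofReal s := by
        rw [setLIntegral_const, hset, Real.volume_Icc, ← ENNReal.ofReal_mul (by norm_num)]
        congr 1
        ring

/-! ### The law of the initialization -/

/-- The joint law of the weight vector and the sign of one neuron. -/
noncomputable def neuronLaw (d : ℕ) : Measure (Weight d × ℝ) :=
  (stdGaussian (Weight d)).prod (uniformOn ({-1, 1} : Set ℝ))

instance : IsProbabilityMeasure (uniformOn ({-1, 1} : Set ℝ)) :=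
  isProbabilityMeasure_uniformOn (Set.toFinite _) (Set.insert_nonempty _ _)

instance (d : ℕ) : IsProbabilityMeasure (neuronLaw d) := by
  unfold neuronLaw; infer_instance

/-- The initialization consists of `m` independent neurons. -/
lemma initLaw_le_pi {d m : ℕ} (S : Set ((Fin m → Weight d) × (Fin m → ℝ)))
    (T : Set (Fin m → Weight d × ℝ))
    (h : ∀ ω, (fun r => (ω r).1, fun r => (ω r).2) ∈ S → ω ∈ T) :
    initLaw d m S ≤ (Measure.pi fun _ : Fin m => neuronLaw d) T := by
  have hp := measurePreserving_arrowProdEquivProdArrow (Weight d) ℝ (Fin m)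
    (fun _ => stdGaussian (Weight d)) (fun _ => uniformOn ({-1, 1} : Set ℝ))
  have h1 := hp.measure_preimage_equiv S
  rw [initLaw, ← h1]
  exact measure_mono fun ω hω => h ω hω

lemma ae_sign_eq : ∀ᵐ a ∂(uniformOn ({-1, 1} : Set ℝ)), a = -1 ∨ a = 1 := by
  have : (uniformOn ({-1, 1} : Set ℝ)) ({-1, 1} : Set ℝ)ᶜ = 0 := by
    rw [uniformOn_eq_zero_iff (Set.toFinite _)]
    simp
  filter_upwards [compl_mem_ae_iff.2 this] with a ha
  simpa using ha

lemma uniformOn_signs :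
    uniformOn ({-1, 1} : Set ℝ)
      = (2 : ENNReal)⁻¹ • (Measure.dirac (-1) + Measure.dirac 1) := by
  have hne : (-1 : ℝ) ≠ 1 := by norm_num
  rw [uniformOn, ProbabilityTheory.cond]
  congr 1
  · congr 1
    rw [Measure.count_apply_finite _ (Set.toFinite _)]
    have : (Set.toFinite ({-1, 1} : Set ℝ)).toFinset = ({-1, 1} : Finset ℝ) := by ext; simp
    rw [this, Finset.card_pair hne]
    norm_num
  · rw [Set.insert_eq, Measure.restrict_union (by simpa using hne) (measurableSet_singleton _)]
    rw [Measure.restrict_singleton, Measure.restrict_singleton]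
    simp

lemma integral_sign : ∫ a : ℝ, a ∂(uniformOn ({-1, 1} : Set ℝ)) = 0 := by
  rw [uniformOn_signs, integral_smul_measure, integral_add_measure]
  · simp
  · exact integrable_dirac (by simp)
  · exact integrable_dirac (by simp)

variable {d n₁ n₂ m : ℕ}

/-! ### Values and gradients of a single neuron -/

lemma norm_aug_sq (x : Point d) : ‖aug x‖ ^ 2 = ‖x‖ ^ 2 + 1 := by
  rw [EuclideanSpace.real_norm_sq_eq, EuclideanSpace.real_norm_sq_eq, Fin.sum_univ_castSucc]
  simp [aug]

lemma one_le_norm_aug (x : Point d) : 1 ≤ ‖aug x‖ := by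
  nlinarith [norm_aug_sq x, sq_nonneg ‖x‖, norm_nonneg (aug x)]

lemma norm_aug_le {x : Point d} (hx : ‖x‖ ≤ 1) : ‖aug x‖ ≤ 2 := by
  nlinarith [norm_aug_sq x, norm_nonneg x, norm_nonneg (aug x)]

lemma aug_last (x : Point d) : aug x (Fin.last (d + 1)) = 1 := by simp [aug]

lemma abs_coord_le (w : Weight d) (i : Fin (d + 2)) : |w i| ≤ ‖w‖ := by
  simpa using PiLp.norm_apply_le w i

lemma norm_spatial_le (w : Weight d) : ‖spatial w‖ ≤ ‖w‖ := by
  rw [← abs_of_nonneg (norm_nonneg (spatial w)), ← abs_of_nonneg (norm_nonneg w), ← sq_le_sq,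
    EuclideanSpace.real_norm_sq_eq, EuclideanSpace.real_norm_sq_eq]
  refine Finset.sum_le_sum fun i _ => ?_
  by_cases h : i = 0 ∨ i = Fin.last (d + 1) <;> simp [spatial, h, sq_nonneg]

lemma spatial_sub (v w : Weight d) : spatial (v - w) = spatial v - spatial w := by
  ext i; by_cases h : i = 0 ∨ i = Fin.last (d + 1) <;> simp [spatial, h]

lemma inner_spatial_left (v w : Weight d) :
    inner ℝ (spatial w) v = inner ℝ (spatial w) (spatial v) := by
  simp only [PiLp.inner_apply]
  refine Finset.sum_congr rfl fun i _ => ?_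
  by_cases h : i = 0 ∨ i = Fin.last (d + 1) <;> simp [spatial, h]

lemma continuous_spatial : Continuous (spatial : Weight d → Weight d) := by
  refine (PiLp.continuous_toLp 2 _).comp (continuous_pi fun i => ?_)
  by_cases h : i = 0 ∨ i = Fin.last (d + 1)
  · simp only [h, if_true]; fun_prop
  · simp only [h, if_false]; fun_prop

/-- The contribution of one neuron (without sign and scaling) to the heat operator of the network
at the interior samples and to its value at the boundary samples. -/
noncomputable def neuronVal (σ : ℝ → ℝ) (D : Data d n₁ n₂) (w : Weight d) :
    Fin n₁ ⊕ Fin n₂ → ℝ :=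
  Sum.elim (fun p => deriv σ (inner ℝ w (aug (D.x p))) * w 0
      - deriv (deriv σ) (inner ℝ w (aug (D.x p))) * ‖spatial w‖ ^ 2)
    (fun j => σ (inner ℝ w (aug (D.y j))))

/-- The gradients of `neuronVal`, that is `neuronGrad` without the normalization. -/
noncomputable def rawGrad (σ : ℝ → ℝ) (D : Data d n₁ n₂) (w : Weight d) :
    Fin n₁ ⊕ Fin n₂ → Weight d :=
  Sum.elim (fun p => interiorGrad σ (D.x p) w) (fun j => boundaryGrad σ (D.y j) w)

/-- Quantitative growth and regularity of an activation. On the interval `|z| ≤ 4 M` the orders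
of growth are those of a function of degree `g + 2`, and first-order Taylor expansions hold with
quadratic error, except that `σ'''` may jump: `κ z z'` dominates the indicator of the event that
a jump lies between `z` and `z'`. -/
structure ActivationBounds (σ : ℝ → ℝ) (g : ℕ) (κ : ℝ → ℝ → ℝ) (A : ℝ) : Prop where
  contDiff : ContDiff ℝ 2 σ
  measurable_third : Measurable (thirdDeriv σ)
  le_one : g ≤ 1
  pos : 0 < A
  jump_nonneg : ∀ z z', 0 ≤ κ z z'
  val_le : ∀ M z : ℝ, 1 ≤ M → |z| ≤ 4 * M → |σ z| ≤ A * M ^ (g + 2)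
  deriv_le : ∀ M z : ℝ, 1 ≤ M → |z| ≤ 4 * M → |deriv σ z| ≤ A * M ^ (g + 1)
  deriv2_le : ∀ M z : ℝ, 1 ≤ M → |z| ≤ 4 * M → |deriv (deriv σ) z| ≤ A * M ^ g
  third_le : ∀ z, |thirdDeriv σ z| ≤ A
  taylor_val : ∀ M z z' : ℝ, 1 ≤ M → |z| ≤ 4 * M → |z'| ≤ 4 * M →
    |σ z' - σ z - deriv σ z * (z' - z)| ≤ A * M * (z' - z) ^ 2
  taylor_deriv : ∀ z z' : ℝ,
    |deriv σ z' - deriv σ z - deriv (deriv σ) z * (z' - z)| ≤ A * (z' - z) ^ 2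
  taylor_deriv2 : ∀ z z' : ℝ,
    |deriv (deriv σ) z' - deriv (deriv σ) z - thirdDeriv σ z * (z' - z)|
      ≤ A * ((z' - z) ^ 2 + |z' - z| * κ z z')
  lip_deriv : ∀ M z z' : ℝ, 1 ≤ M → |z| ≤ 4 * M → |z'| ≤ 4 * M →
    |deriv σ z' - deriv σ z| ≤ A * M * |z' - z|
  lip_deriv2 : ∀ z z' : ℝ, |deriv (deriv σ) z' - deriv (deriv σ) z| ≤ A * |z' - z|
  lip_third : ∀ z z' : ℝ, |thirdDeriv σ z' - thirdDeriv σ z| ≤ A * (|z' - z| + κ z z')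

lemma abs_mul_le_mul {a b α β : ℝ} (ha : |a| ≤ α) (hb : |b| ≤ β) : |a * b| ≤ α * β := by
  rw [abs_mul]
  exact mul_le_mul ha hb (abs_nonneg _) ((abs_nonneg _).trans ha)

lemma abs_inner_aug_le {x : Point d} (hx : ‖x‖ ≤ 1) (w : Weight d) :
    |inner ℝ w (aug x)| ≤ 2 * ‖w‖ := by
  refine (abs_real_inner_le_norm _ _).trans ?_
  rw [mul_comm]
  exact mul_le_mul_of_nonneg_right (norm_aug_le hx) (norm_nonneg _)

lemma abs_norm_spatial_sq_sub_le {M : ℝ} {w w' : Weight d} (hw : ‖w‖ ≤ 2 * M)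
    (hw' : ‖w'‖ ≤ 2 * M) : |‖spatial w'‖ ^ 2 - ‖spatial w‖ ^ 2| ≤ ‖w' - w‖ * (4 * M) := by
  have e : ‖spatial w'‖ ^ 2 - ‖spatial w‖ ^ 2
      = (‖spatial w'‖ - ‖spatial w‖) * (‖spatial w'‖ + ‖spatial w‖) := by ring
  rw [e]
  refine abs_mul_le_mul ?_ ?_
  · refine (abs_norm_sub_norm_le _ _).trans ?_
    rw [← spatial_sub]
    exact norm_spatial_le _
  · rw [abs_of_nonneg (by positivity)]
    linarith [norm_spatial_le w, norm_spatial_le w']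

section Bounds

variable {σ : ℝ → ℝ} {g : ℕ} {κ : ℝ → ℝ → ℝ} {A M : ℝ}

lemma ActivationBounds.deriv_le_sq (h : ActivationBounds σ g κ A) (hM : 1 ≤ M) {z : ℝ}
    (hz : |z| ≤ 4 * M) : |deriv σ z| ≤ A * M ^ 2 :=
  (h.deriv_le M z hM hz).trans
    (mul_le_mul_of_nonneg_left (pow_le_pow_right₀ hM (by have := h.le_one; omega)) h.pos.le)

lemma ActivationBounds.deriv2_le_self (h : ActivationBounds σ g κ A) (hM : 1 ≤ M) {z : ℝ}
    (hz : |z| ≤ 4 * M) : |deriv (deriv σ) z| ≤ A * M := by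
  refine (h.deriv2_le M z hM hz).trans (mul_le_mul_of_nonneg_left ?_ h.pos.le)
  calc M ^ g ≤ M ^ 1 := pow_le_pow_right₀ hM h.le_one
    _ = M := pow_one M

lemma norm_rawGrad_le (h : ActivationBounds σ g κ A) (D : Data d n₁ n₂)
    (hD : ∀ i, ‖D.sample i‖ ≤ 1) (hM : 1 ≤ M) {w : Weight d} (hw : ‖w‖ ≤ 2 * M)
    (i : Fin n₁ ⊕ Fin n₂) : ‖rawGrad σ D w i‖ ≤ 100 * A * M ^ 2 := by
  have hA := h.pos
  have hAM : 0 < A * M ^ 2 := by positivity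
  have hz : |inner ℝ w (aug (D.sample i))| ≤ 4 * M :=
    (abs_inner_aug_le (hD i) w).trans (by linarith)
  have h1 := h.deriv_le_sq hM hz
  have h2 := h.deriv2_le_self hM hz
  have h3 := h.third_le (inner ℝ w (aug (D.sample i)))
  have hx := norm_aug_le (hD i)
  rcases i with p | j
  · simp only [Data.sample, Sum.elim_inl] at hz h1 h2 h3 hx
    simp only [rawGrad, Sum.elim_inl, interiorGrad]
    have hs := (norm_spatial_le w).trans hw
    have hP : |‖spatial w‖ ^ 2| ≤ 4 * M ^ 2 := by
      rw [abs_of_nonneg (by positivity)]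
      nlinarith [norm_nonneg (spatial w)]
    have a1 := abs_mul_le_mul (abs_mul_le_mul h2 ((abs_coord_le w 0).trans hw))
      ((abs_of_nonneg (norm_nonneg _)).trans_le hx)
    have a3 := abs_mul_le_mul (abs_mul_le_mul h3 hP)
      ((abs_of_nonneg (norm_nonneg _)).trans_le hx)
    have a4 := abs_mul_le_mul h2 ((abs_of_nonneg (norm_nonneg _)).trans_le hs)
    refine (norm_sub_le _ _).trans ((add_le_add_left ((norm_sub_le _ _).trans
      (add_le_add_left (norm_add_le _ _) _)) _).trans ?_)
    rw [abs_mul _ ‖aug (D.x p)‖, abs_of_nonneg (norm_nonneg _)] at a1 a3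
    rw [abs_mul _ ‖spatial w‖, abs_of_nonneg (norm_nonneg _)] at a4
    simp only [norm_smul, PiLp.norm_single, Real.norm_eq_abs, abs_one, mul_one]
    rw [abs_mul (2 : ℝ), abs_two]
    nlinarith
  · simp only [Data.sample, Sum.elim_inr] at hz h1 h2 h3 hx
    simp only [rawGrad, Sum.elim_inr, boundaryGrad, norm_smul, Real.norm_eq_abs]
    have := mul_le_mul h1 hx (norm_nonneg _) hAM.le
    linarith

/-- The gradient of a neuron is Lipschitz with constant of order `M²`, up to jumps of `σ'''`. -/
lemma norm_rawGrad_sub_le (h : ActivationBounds σ g κ A) (D : Data d n₁ n₂)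
    (hD : ∀ i, ‖D.sample i‖ ≤ 1) (hM : 1 ≤ M) {w w' : Weight d} (hw : ‖w‖ ≤ 2 * M)
    (hw' : ‖w'‖ ≤ 2 * M) (i : Fin n₁ ⊕ Fin n₂) :
    ‖rawGrad σ D w' i - rawGrad σ D w i‖ ≤ 100 * A * M ^ 2 *
      (‖w' - w‖ + κ (inner ℝ w (aug (D.sample i))) (inner ℝ w' (aug (D.sample i)))) := by
  have hA := h.pos
  set δ := ‖w' - w‖ with hδ
  have hδ0 : 0 ≤ δ := norm_nonneg _
  have hz : |inner ℝ w (aug (D.sample i))| ≤ 4 * M :=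
    (abs_inner_aug_le (hD i) w).trans (by linarith)
  have hz' : |inner ℝ w' (aug (D.sample i))| ≤ 4 * M :=
    (abs_inner_aug_le (hD i) w').trans (by linarith)
  have hΔ : |inner ℝ w' (aug (D.sample i)) - inner ℝ w (aug (D.sample i))| ≤ 2 * δ := by
    rw [← inner_sub_left]; exact abs_inner_aug_le (hD i) _
  have h1 := h.lip_deriv M _ _ hM hz hz'
  have h2 := h.lip_deriv2 (inner ℝ w (aug (D.sample i))) (inner ℝ w' (aug (D.sample i)))
  have h3 := h.lip_third (inner ℝ w (aug (D.sample i))) (inner ℝ w' (aug (D.sample i)))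
  have b2 := h.deriv2_le_self hM hz
  have b3 := h.third_le (inner ℝ w (aug (D.sample i)))
  have hκ := h.jump_nonneg (inner ℝ w (aug (D.sample i))) (inner ℝ w' (aug (D.sample i)))
  have hx := norm_aug_le (hD i)
  set z := inner ℝ w (aug (D.sample i))
  set z' := inner ℝ w' (aug (D.sample i))
  set k := κ z z'
  have hM2 : M ≤ M ^ 2 := by nlinarith
  have hAMδ : A * M * δ ≤ A * M ^ 2 * δ := by gcongr
  have hAMδ0 : 0 ≤ A * M * δ := by positivity
  have hAκ : 0 ≤ A * M ^ 2 * k := by positivity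
  have h1' : |deriv σ z' - deriv σ z| ≤ 2 * (A * M * δ) := h1.trans (by
    calc A * M * |z' - z| ≤ A * M * (2 * δ) := by gcongr
      _ = _ := by ring)
  have h2' : |deriv (deriv σ) z' - deriv (deriv σ) z| ≤ 2 * A * δ := h2.trans (by
    calc A * |z' - z| ≤ A * (2 * δ) := by gcongr
      _ = _ := by ring)
  have h3' : |thirdDeriv σ z' - thirdDeriv σ z| ≤ A * (2 * δ + k) := h3.trans (by gcongr)
  rcases i with p | j
  · simp only [Data.sample, Sum.elim_inl] at hx z z'
    simp only [rawGrad, Sum.elim_inl, interiorGrad]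
    change ‖(deriv (deriv σ) z' * w' 0) • aug (D.x p) + deriv σ z' • EuclideanSpace.single 0 1
      - (thirdDeriv σ z' * ‖spatial w'‖ ^ 2) • aug (D.x p)
      - (2 * deriv (deriv σ) z') • spatial w'
      - ((deriv (deriv σ) z * w 0) • aug (D.x p) + deriv σ z • EuclideanSpace.single 0 1
      - (thirdDeriv σ z * ‖spatial w‖ ^ 2) • aug (D.x p)
      - (2 * deriv (deriv σ) z) • spatial w)‖ ≤ _
    have c0 : |w' 0 - w 0| ≤ δ := abs_coord_le (w' - w) 0
    have hs := (norm_spatial_le w').trans hw'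
    have hsd : ‖spatial (w' - w)‖ ≤ δ := norm_spatial_le _
    have hP : |‖spatial w'‖ ^ 2| ≤ 4 * M ^ 2 := by
      rw [abs_of_nonneg (by positivity)]
      nlinarith [norm_nonneg (spatial w')]
    have hPd := abs_norm_spatial_sq_sub_le hw hw'
    have e1 := abs_mul_le_mul h2' ((abs_coord_le w' 0).trans hw')
    have e2 := abs_mul_le_mul b2 c0
    have e3 := abs_mul_le_mul h3' hP
    have e4 := abs_mul_le_mul b3 hPd
    have hcoef : |(deriv (deriv σ) z' - deriv (deriv σ) z) * w' 0
        + deriv (deriv σ) z * (w' 0 - w 0)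
        - (thirdDeriv σ z' - thirdDeriv σ z) * ‖spatial w'‖ ^ 2
        - thirdDeriv σ z * (‖spatial w'‖ ^ 2 - ‖spatial w‖ ^ 2)|
        ≤ 17 * (A * M ^ 2 * δ) + 4 * (A * M ^ 2 * k) := by
      refine (abs_sub _ _).trans ((add_le_add_left ((abs_sub _ _).trans
        (add_le_add_left (abs_add_le _ _) _)) _).trans ?_)
      linarith
    have e5 := abs_mul_le_mul h2' ((abs_of_nonneg (norm_nonneg _)).trans_le hs)
    have e6 := abs_mul_le_mul b2 ((abs_of_nonneg (norm_nonneg _)).trans_le hsd)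
    rw [abs_mul _ ‖spatial _‖, abs_of_nonneg (norm_nonneg _)] at e5 e6
    have e7 := mul_le_mul hcoef hx (norm_nonneg _) (by positivity)
    have key : (deriv (deriv σ) z' * w' 0) • aug (D.x p)
      + deriv σ z' • EuclideanSpace.single 0 1
      - (thirdDeriv σ z' * ‖spatial w'‖ ^ 2) • aug (D.x p)
      - (2 * deriv (deriv σ) z') • spatial w'
      - ((deriv (deriv σ) z * w 0) • aug (D.x p) + deriv σ z • EuclideanSpace.single 0 1
      - (thirdDeriv σ z * ‖spatial w‖ ^ 2) • aug (D.x p)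
      - (2 * deriv (deriv σ) z) • spatial w)
      = ((deriv (deriv σ) z' - deriv (deriv σ) z) * w' 0
        + deriv (deriv σ) z * (w' 0 - w 0)
        - (thirdDeriv σ z' - thirdDeriv σ z) * ‖spatial w'‖ ^ 2
        - thirdDeriv σ z * (‖spatial w'‖ ^ 2 - ‖spatial w‖ ^ 2)) • aug (D.x p)
        + (deriv σ z' - deriv σ z) • EuclideanSpace.single 0 1
        - (2 : ℝ) • ((deriv (deriv σ) z' - deriv (deriv σ) z) • spatial w'
          + deriv (deriv σ) z • spatial (w' - w)) := by
      rw [spatial_sub]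
      module
    rw [key]
    refine (norm_sub_le _ _).trans ((add_le_add (norm_add_le _ _) le_rfl).trans ?_)
    have e8 : ‖(2 : ℝ) • ((deriv (deriv σ) z' - deriv (deriv σ) z) • spatial w'
          + deriv (deriv σ) z • spatial (w' - w))‖
        ≤ 2 * (2 * A * δ * (2 * M) + A * M * δ) := by
      rw [norm_smul, Real.norm_eq_abs, abs_two]
      refine mul_le_mul_of_nonneg_left ((norm_add_le _ _).trans ?_) (by norm_num)
      rw [norm_smul, norm_smul, Real.norm_eq_abs, Real.norm_eq_abs]
      exact add_le_add e5 e6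
    refine (add_le_add le_rfl e8).trans ?_
    rw [norm_smul, norm_smul, Real.norm_eq_abs, Real.norm_eq_abs, PiLp.norm_single,
      norm_one, mul_one]
    linarith
  · simp only [Data.sample, Sum.elim_inr] at hx
    simp only [rawGrad, Sum.elim_inr, boundaryGrad]
    rw [← sub_smul, norm_smul, Real.norm_eq_abs]
    have := mul_le_mul h1' hx (norm_nonneg _) (by positivity)
    refine this.trans ?_
    have : 0 ≤ A * M ^ 2 * δ := by positivity
    linarith

/-- First-order Taylor expansion in the weights. A jump of `σ'''` between the two activations costs an
error proportional to the distance instead of its square. -/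
lemma abs_neuronVal_taylor_le (h : ActivationBounds σ g κ A) (D : Data d n₁ n₂)
    (hD : ∀ i, ‖D.sample i‖ ≤ 1) (hM : 1 ≤ M) {w w' : Weight d} (hw : ‖w‖ ≤ 2 * M)
    (hw' : ‖w'‖ ≤ 2 * M) (i : Fin n₁ ⊕ Fin n₂) :
    |neuronVal σ D w' i - neuronVal σ D w i - inner ℝ (rawGrad σ D w i) (w' - w)|
      ≤ 100 * A * M ^ 2 * (‖w' - w‖ ^ 2 + ‖w' - w‖
        * κ (inner ℝ w (aug (D.sample i))) (inner ℝ w' (aug (D.sample i)))) := by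
  have hA := h.pos
  set δ := ‖w' - w‖ with hδ
  have hδ0 : 0 ≤ δ := norm_nonneg _
  have hz : |inner ℝ w (aug (D.sample i))| ≤ 4 * M :=
    (abs_inner_aug_le (hD i) w).trans (by linarith)
  have hz' : |inner ℝ w' (aug (D.sample i))| ≤ 4 * M :=
    (abs_inner_aug_le (hD i) w').trans (by linarith)
  have hΔ : |inner ℝ w' (aug (D.sample i)) - inner ℝ w (aug (D.sample i))| ≤ 2 * δ := by
    rw [← inner_sub_left]; exact abs_inner_aug_le (hD i) _
  have hin : inner ℝ (aug (D.sample i)) (w' - w)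
      = inner ℝ w' (aug (D.sample i)) - inner ℝ w (aug (D.sample i)) := by
    rw [inner_sub_right, real_inner_comm w', real_inner_comm w]
  have h0 := h.taylor_val M _ _ hM hz hz'
  have h1 := h.taylor_deriv (inner ℝ w (aug (D.sample i))) (inner ℝ w' (aug (D.sample i)))
  have h2 := h.taylor_deriv2 (inner ℝ w (aug (D.sample i))) (inner ℝ w' (aug (D.sample i)))
  have b2 := h.deriv2_le_self hM hz
  have b3 := h.third_le (inner ℝ w (aug (D.sample i)))
  have hκ := h.jump_nonneg (inner ℝ w (aug (D.sample i))) (inner ℝ w' (aug (D.sample i)))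
  set z := inner ℝ w (aug (D.sample i))
  set z' := inner ℝ w' (aug (D.sample i))
  set k := κ z z'
  have hM2 : M ≤ M ^ 2 := by nlinarith
  have hM1 : 1 ≤ M ^ 2 := by nlinarith
  have hΔ2 : (z' - z) ^ 2 ≤ 4 * δ ^ 2 := by
    rw [← sq_abs]; nlinarith [abs_nonneg (z' - z)]
  have hAMδ : A * M * δ ^ 2 ≤ A * M ^ 2 * δ ^ 2 := by gcongr
  have hAMδ0 : 0 ≤ A * M * δ ^ 2 := by positivity
  have hAκ : 0 ≤ A * M ^ 2 * (δ * k) := by positivity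
  rcases i with p | j
  · simp only [Data.sample, Sum.elim_inl] at hin z z'
    simp only [neuronVal, rawGrad, Sum.elim_inl, interiorGrad]
    change |deriv σ z' * w' 0 - deriv (deriv σ) z' * ‖spatial w'‖ ^ 2
      - (deriv σ z * w 0 - deriv (deriv σ) z * ‖spatial w‖ ^ 2)
      - inner ℝ ((deriv (deriv σ) z * w 0) • aug (D.x p)
      + deriv σ z • EuclideanSpace.single 0 1
      - (thirdDeriv σ z * ‖spatial w‖ ^ 2) • aug (D.x p)
      - (2 * deriv (deriv σ) z) • spatial w) (w' - w)| ≤ _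
    have c0 : |w' 0 - w 0| ≤ δ := abs_coord_le (w' - w) 0
    have hs := (norm_spatial_le w').trans hw'
    have hsd : ‖spatial (w' - w)‖ ≤ δ := norm_spatial_le _
    have hP : |‖spatial w'‖ ^ 2| ≤ 4 * M ^ 2 := by
      rw [abs_of_nonneg (by positivity)]
      nlinarith [norm_nonneg (spatial w')]
    have hPd := abs_norm_spatial_sq_sub_le hw hw'
    have hsq : |‖spatial (w' - w)‖ ^ 2| ≤ δ ^ 2 := by
      rw [abs_of_nonneg (by positivity)]
      exact pow_le_pow_left₀ (norm_nonneg _) hsd 2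
    have hpol : ‖spatial w'‖ ^ 2 - ‖spatial w‖ ^ 2
        = 2 * inner ℝ (spatial w) (w' - w) + ‖spatial (w' - w)‖ ^ 2 := by
      rw [inner_spatial_left, spatial_sub, norm_sub_sq_real, inner_sub_right,
        real_inner_self_eq_norm_sq, real_inner_comm (spatial w) (spatial w')]
      ring
    have hin' : inner ℝ (aug (D.x p)) (w' - w) = z' - z := hin
    have h1' : |deriv σ z' - deriv σ z - deriv (deriv σ) z * (z' - z)| ≤ 4 * A * δ ^ 2 :=
      h1.trans (by nlinarith)
    have h2' : |deriv (deriv σ) z' - deriv (deriv σ) z - thirdDeriv σ z * (z' - z)|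
        ≤ A * (4 * δ ^ 2 + 2 * δ * k) := h2.trans (by gcongr)
    have e1 := abs_mul_le_mul h1' ((abs_coord_le w' 0).trans hw')
    have e2 := abs_mul_le_mul (abs_mul_le_mul b2 hΔ) c0
    have e3 := abs_mul_le_mul h2' hP
    have e4 := abs_mul_le_mul (abs_mul_le_mul b3 hΔ) hPd
    have e5 := abs_mul_le_mul b2 hsq
    have key : deriv σ z' * w' 0 - deriv (deriv σ) z' * ‖spatial w'‖ ^ 2
      - (deriv σ z * w 0 - deriv (deriv σ) z * ‖spatial w‖ ^ 2)
      - inner ℝ ((deriv (deriv σ) z * w 0) • aug (D.x p)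
      + deriv σ z • EuclideanSpace.single 0 1
      - (thirdDeriv σ z * ‖spatial w‖ ^ 2) • aug (D.x p)
      - (2 * deriv (deriv σ) z) • spatial w) (w' - w)
      = (deriv σ z' - deriv σ z - deriv (deriv σ) z * (z' - z)) * w' 0
        + deriv (deriv σ) z * (z' - z) * (w' 0 - w 0)
        - (deriv (deriv σ) z' - deriv (deriv σ) z - thirdDeriv σ z * (z' - z))
            * ‖spatial w'‖ ^ 2
        - thirdDeriv σ z * (z' - z) * (‖spatial w'‖ ^ 2 - ‖spatial w‖ ^ 2)
        - deriv (deriv σ) z * ‖spatial (w' - w)‖ ^ 2 := by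
      have hpol' : ‖spatial (w' - w)‖ ^ 2
        = ‖spatial w'‖ ^ 2 - ‖spatial w‖ ^ 2 - 2 * inner ℝ (spatial w) (w' - w) := by
        rw [hpol]; ring
      rw [hpol', inner_sub_left, inner_sub_left, inner_add_left]
      simp only [real_inner_smul_left, hin', EuclideanSpace.inner_single_left]
      simp
      ring
    rw [key]
    refine (abs_sub _ _).trans ((add_le_add_left ((abs_sub _ _).trans
      (add_le_add_left ((abs_sub _ _).trans (add_le_add_left (abs_add_le _ _) _)) _)) _).trans ?_)
    linarith
  · simp only [Data.sample, Sum.elim_inr] at hin z z'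
    simp only [neuronVal, rawGrad, Sum.elim_inr, boundaryGrad, real_inner_smul_left]
    rw [hin]
    refine h0.trans ?_
    have : A * M * (z' - z) ^ 2 ≤ A * M * (4 * δ ^ 2) := by gcongr
    linarith

lemma abs_neuronVal_le (h : ActivationBounds σ g κ A) (D : Data d n₁ n₂)
    (hD : ∀ i, ‖D.sample i‖ ≤ 1) (w : Weight d) (i : Fin n₁ ⊕ Fin n₂) :
    |neuronVal σ D w i| ≤ 100 * A * (1 + ‖w‖) ^ (g + 2) := by
  have hA := h.pos
  have hM : 1 ≤ 1 + ‖w‖ := by linarith [norm_nonneg w]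
  have hz : |inner ℝ w (aug (D.sample i))| ≤ 4 * (1 + ‖w‖) :=
    (abs_inner_aug_le (hD i) w).trans (by linarith [norm_nonneg w])
  have h0 := h.val_le _ _ hM hz
  have h1 := h.deriv_le _ _ hM hz
  have h2 := h.deriv2_le _ _ hM hz
  have hw : ‖w‖ ≤ 1 + ‖w‖ := by linarith
  have hpos : 0 ≤ A * (1 + ‖w‖) ^ (g + 2) := by positivity
  rcases i with p | j
  · simp only [neuronVal, Sum.elim_inl]
    have e1 := abs_mul_le_mul h1 ((abs_coord_le w 0).trans hw)
    have hP : |‖spatial w‖ ^ 2| ≤ (1 + ‖w‖) ^ 2 := by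
      rw [abs_of_nonneg (by positivity)]
      exact pow_le_pow_left₀ (norm_nonneg _) ((norm_spatial_le w).trans hw) 2
    have e2 := abs_mul_le_mul h2 hP
    refine (abs_sub _ _).trans ((add_le_add e1 e2).trans ?_)
    have : A * (1 + ‖w‖) ^ (g + 1) * (1 + ‖w‖) + A * (1 + ‖w‖) ^ g * (1 + ‖w‖) ^ 2
      = 2 * (A * (1 + ‖w‖) ^ (g + 2)) := by ring
    rw [this]
    linarith
  · simp only [neuronVal, Sum.elim_inr]
    refine h0.trans ?_
    linarith

lemma measurable_neuronVal (h : ActivationBounds σ g κ A) (D : Data d n₁ n₂)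
    (i : Fin n₁ ⊕ Fin n₂) : Measurable (fun w => neuronVal σ D w i) := by
  have c0 : Continuous σ := h.contDiff.continuous
  have c1 : Continuous (deriv σ) := (h.contDiff.iterate_deriv' 1 1).continuous
  have c2 : Continuous (deriv (deriv σ)) := (h.contDiff.iterate_deriv' 0 2).continuous
  have cs := continuous_spatial (d := d)
  rcases i with p | j
  · simp only [neuronVal, Sum.elim_inl]
    exact Continuous.measurable (by fun_prop)
  · simp only [neuronVal, Sum.elim_inr]
    exact Continuous.measurable (by fun_prop)

lemma measurable_rawGrad (h : ActivationBounds σ g κ A) (D : Data d n₁ n₂)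
    (i : Fin n₁ ⊕ Fin n₂) : Measurable (fun w => rawGrad σ D w i) := by
  have c1 : Measurable (deriv σ) := measurable_deriv _
  have c2 : Measurable (deriv (deriv σ)) := measurable_deriv _
  have c3 := h.measurable_third
  have cs := (continuous_spatial (d := d)).measurable
  rcases i with p | j
  · simp only [rawGrad, Sum.elim_inl, interiorGrad]
    fun_prop
  · simp only [rawGrad, Sum.elim_inr, boundaryGrad]
    fun_prop

end Bounds

/-! ### The two classes of activations -/

/-- The indicator that `σ'''` jumps between `z` and `z'`, for the cubed ReLU. -/
noncomputable def signFlip (z z' : ℝ) : ℝ := if (0 ≤ z ↔ 0 ≤ z') then 0 else 1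

lemma activationBounds_relu3 : ActivationBounds relu3 1 signFlip 100 where
  contDiff := contDiff_relu3
  measurable_third := by
    have : thirdDeriv relu3 = fun z => if 0 ≤ z then 6 else 0 := funext thirdDeriv_relu3
    rw [this]
    exact Measurable.ite measurableSet_Ici measurable_const measurable_const
  le_one := le_rfl
  pos := by norm_num
  jump_nonneg z z' := by unfold signFlip; split_ifs <;> norm_num
  val_le M z hM hz := by
    have h0 : 0 ≤ max z 0 := le_max_right _ _
    have h1 : max z 0 ≤ 4 * M := max_le ((le_abs_self z).trans hz) (by linarith)
    rw [relu3, abs_of_nonneg (by positivity)]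
    calc max z 0 ^ 3 ≤ (4 * M) ^ 3 := pow_le_pow_left₀ h0 h1 3
      _ = 64 * M ^ 3 := by ring
      _ ≤ _ := by have : 0 < M ^ 3 := by positivity
                  norm_num
                  linarith
  deriv_le M z hM hz := by
    have h0 : 0 ≤ max z 0 := le_max_right _ _
    have h1 : max z 0 ≤ 4 * M := max_le ((le_abs_self z).trans hz) (by linarith)
    rw [deriv_relu3, abs_of_nonneg (by positivity)]
    have := pow_le_pow_left₀ h0 h1 2
    norm_num
    nlinarith
  deriv2_le M z hM hz := by
    have h0 : 0 ≤ max z 0 := le_max_right _ _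
    have h1 : max z 0 ≤ 4 * M := max_le ((le_abs_self z).trans hz) (by linarith)
    rw [deriv_deriv_relu3, abs_of_nonneg (by positivity), pow_one]
    linarith
  third_le z := by
    rw [thirdDeriv_relu3]; split_ifs <;> norm_num
  taylor_val M z z' hM hz hz' := by
    rw [deriv_relu3]
    simp only [relu3]
    rw [abs_le] at hz hz'
    rw [abs_le]
    rcases le_total z 0 with h | h <;> rcases le_total z' 0 with h' | h'
    · rw [max_eq_right h, max_eq_right h']
      constructor <;> nlinarith [mul_nonneg (by linarith : (0 : ℝ) ≤ M) (sq_nonneg (z' - z))]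
    · rw [max_eq_right h, max_eq_left h']
      have : z' ^ 2 ≤ (z' - z) ^ 2 := by nlinarith
      have a : z' ^ 3 ≤ 4 * M * (z' - z) ^ 2 := by
        calc z' ^ 3 = z' * z' ^ 2 := by ring
          _ ≤ 4 * M * (z' - z) ^ 2 := mul_le_mul hz'.2 this (sq_nonneg _) (by linarith)
      have b : 0 ≤ z' ^ 3 := by positivity
      have c : 0 ≤ M * (z' - z) ^ 2 := by positivity
      constructor <;> nlinarith
    · rw [max_eq_left h, max_eq_right h']
      have e : (0 : ℝ) ^ 3 - z ^ 3 - 3 * z ^ 2 * (z' - z) = z * (2 * z ^ 2 - 3 * z * z') := by ring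
      have a : 2 * z ^ 2 - 3 * z * z' ≤ 2 * (z' - z) ^ 2 := by nlinarith
      have a0 : 0 ≤ 2 * z ^ 2 - 3 * z * z' := by nlinarith
      have b : z * (2 * z ^ 2 - 3 * z * z') ≤ 4 * M * (2 * (z' - z) ^ 2) :=
        mul_le_mul hz.2 a a0 (by linarith)
      have c : 0 ≤ M * (z' - z) ^ 2 := by positivity
      have b0 : 0 ≤ z * (2 * z ^ 2 - 3 * z * z') := by positivity
      rw [e]
      constructor <;> nlinarith
    · rw [max_eq_left h, max_eq_left h']
      have e : z' ^ 3 - z ^ 3 - 3 * z ^ 2 * (z' - z) = (z' + 2 * z) * (z' - z) ^ 2 := by ring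
      have c : 0 ≤ M * (z' - z) ^ 2 := by positivity
      have a : (z' + 2 * z) * (z' - z) ^ 2 ≤ 12 * M * (z' - z) ^ 2 := by
        refine mul_le_mul_of_nonneg_right (by linarith) (sq_nonneg _)
      have b : 0 ≤ (z' + 2 * z) * (z' - z) ^ 2 := by positivity
      rw [e]
      constructor <;> nlinarith
  taylor_deriv z z' := by
    rw [deriv_deriv_relu3, deriv_relu3]
    simp only
    rw [abs_le]
    rcases le_total z 0 with h | h <;> rcases le_total z' 0 with h' | h'
    · rw [max_eq_right h, max_eq_right h']
      constructor <;> nlinarith [sq_nonneg (z' - z)]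
    · rw [max_eq_right h, max_eq_left h']
      constructor <;> nlinarith [sq_nonneg (z' - z)]
    · rw [max_eq_left h, max_eq_right h']
      constructor <;> nlinarith [sq_nonneg (z' - z), mul_nonneg h (neg_nonneg.2 h')]
    · rw [max_eq_left h, max_eq_left h']
      constructor <;> nlinarith [sq_nonneg (z' - z)]
  taylor_deriv2 z z' := by
    rw [thirdDeriv_relu3, deriv_deriv_relu3]
    simp only [signFlip]
    rcases le_or_gt 0 z with h | h <;> rcases le_or_gt 0 z' with h' | h'
    · simp only [h, h', max_eq_left]
      have : 6 * z' - 6 * z - (if True then 6 else 0) * (z' - z) = 0 := by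
        simp only [if_true]; ring
      rw [this]
      simp only [abs_zero]
      simp
      positivity
    · simp only [h, h'.not_ge, max_eq_left, max_eq_right h'.le, if_true, iff_false, not_true,
        if_false]
      have : 6 * 0 - 6 * z - 6 * (z' - z) = 6 * -z' := by ring
      rw [this, abs_of_nonneg (by linarith), abs_of_nonpos (by linarith)]
      nlinarith [sq_nonneg (z' - z)]
    · simp only [h', h.not_ge, max_eq_left, max_eq_right h.le, if_false, false_iff, not_true]
      rw [abs_of_nonneg (by linarith), abs_of_nonneg (by linarith)]
      nlinarith [sq_nonneg (z' - z)]
    · simp only [h.not_ge, h'.not_ge, max_eq_right h.le, max_eq_right h'.le, if_false]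
      simp
      positivity
  lip_deriv M z z' hM hz hz' := by
    rw [deriv_relu3]
    simp only
    have h0 : 0 ≤ max z 0 := le_max_right _ _
    have h1 : max z 0 ≤ 4 * M := max_le ((le_abs_self z).trans hz) (by linarith)
    have h0' : 0 ≤ max z' 0 := le_max_right _ _
    have h1' : max z' 0 ≤ 4 * M := max_le ((le_abs_self z').trans hz') (by linarith)
    have e : 3 * max z' 0 ^ 2 - 3 * max z 0 ^ 2
        = 3 * (max z' 0 + max z 0) * (max z' 0 - max z 0) := by ring
    have h2 : |max z' 0 - max z 0| ≤ |z' - z| := abs_max_sub_max_le_abs z' z 0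
    have h3 : |3 * (max z' 0 + max z 0)| ≤ 24 * M := by
      rw [abs_of_nonneg (by positivity)]; linarith
    rw [e]
    refine (abs_mul_le_mul h3 h2).trans ?_
    have : 0 ≤ M * |z' - z| := by positivity
    nlinarith
  lip_deriv2 z z' := by
    rw [deriv_deriv_relu3]
    simp only
    have h2 : |max z' 0 - max z 0| ≤ |z' - z| := abs_max_sub_max_le_abs z' z 0
    rw [← mul_sub, abs_mul, abs_of_nonneg (by norm_num : (0 : ℝ) ≤ 6)]
    linarith [abs_nonneg (z' - z)]
  lip_third z z' := by
    rw [thirdDeriv_relu3, thirdDeriv_relu3]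
    simp only [signFlip]
    have := abs_nonneg (z' - z)
    rcases le_or_gt 0 z with h | h <;> rcases le_or_gt 0 z' with h' | h'
    · simp [h, h']
    · simp only [h, h'.not_ge, if_true, if_false, iff_false, not_true]
      norm_num; linarith
    · simp only [h', h.not_ge, if_true, if_false, false_iff, not_true]
      norm_num; linarith
    · simp [h.not_ge, h'.not_ge]

/-- First-order Taylor expansion with a Lipschitz derivative. -/
lemma abs_taylor_le_of_lipschitz {f : ℝ → ℝ} {c : ℝ} (hf : Differentiable ℝ f)
    (hl : ∀ z z', |deriv f z - deriv f z'| ≤ c * |z - z'|) (z z' : ℝ) :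
    |f z' - f z - deriv f z * (z' - z)| ≤ c * (z' - z) ^ 2 := by
  have hc : 0 ≤ c := by
    have := (abs_nonneg _).trans (hl 1 0)
    simpa using this
  have key := Convex.norm_image_sub_le_of_norm_deriv_le (𝕜 := ℝ) (s := Set.uIcc z z')
    (f := fun y => f y - deriv f z * y) (C := c * |z' - z|) (x := z) (y := z')
    (fun y _ => ((hf y).sub (by fun_prop)))
    (fun y hy => by
      have e : deriv (fun y => f y - deriv f z * y) y = deriv f y - deriv f z := by
        have : HasDerivAt (fun y => f y - deriv f z * y) (deriv f y - deriv f z * 1) y :=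
          (hf y).hasDerivAt.sub ((hasDerivAt_id y).const_mul (deriv f z))
        rw [this.deriv, mul_one]
      rw [e, Real.norm_eq_abs]
      refine (hl y z).trans (mul_le_mul_of_nonneg_left ?_ hc)
      exact Set.abs_sub_left_of_mem_uIcc hy)
    (convex_uIcc z z') Set.left_mem_uIcc Set.right_mem_uIcc
  simp only [Real.norm_eq_abs] at key
  calc |f z' - f z - deriv f z * (z' - z)|
      = |f z' - deriv f z * z' - (f z - deriv f z * z)| := by congr 1; ring
    _ ≤ c * |z' - z| * |z' - z| := key
    _ = c * (z' - z) ^ 2 := by rw [mul_assoc, abs_mul_abs_self, sq]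

lemma abs_deriv_le_of_lipschitz {f : ℝ → ℝ} {c : ℝ} (hl : ∀ z z', |f z - f z'| ≤ c * |z - z'|)
    (z : ℝ) : |deriv f z| ≤ c := by
  have hc : 0 ≤ c := by
    have := (abs_nonneg _).trans (hl 1 0)
    simpa using this
  lift c to NNReal using hc
  have : LipschitzWith c f := LipschitzWith.of_dist_le_mul fun x y => by
    simpa [Real.dist_eq] using hl x y
  simpa using norm_deriv_le_of_lipschitz this (x₀ := z)

lemma SmoothActivation.contDiff {c : ℝ} {σ : ℝ → ℝ} (h : SmoothActivation c σ)
    (n : WithTop ℕ∞) :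
    ContDiff ℝ n σ :=
  contDiff_iff_contDiffAt.2 fun z => (h.analytic z).contDiffAt

lemma SmoothActivation.thirdDeriv_eq {c : ℝ} {σ : ℝ → ℝ} (h : SmoothActivation c σ) :
    thirdDeriv σ = deriv (deriv (deriv σ)) := by
  funext z
  have hd : Differentiable ℝ (deriv (deriv σ)) :=
    ((h.contDiff 3).iterate_deriv' 1 2).differentiable (by norm_num)
  exact (hd z).derivWithin (uniqueDiffOn_Ici _ _ Set.self_mem_Ici)

lemma SmoothActivation.activationBounds {c : ℝ} {σ : ℝ → ℝ} (h : SmoothActivation c σ) :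
    ActivationBounds σ 0 (fun _ _ => 0) (5 * c + 1) := by
  have hc : 0 ≤ c := (abs_nonneg _).trans h.abs_zero_le
  have l0 : ∀ z z' : ℝ, |σ z - σ z'| ≤ c * |z - z'| := fun z z' => by
    simpa using h.lipschitz 0 (by norm_num) z z'
  have l1 : ∀ z z' : ℝ, |deriv σ z - deriv σ z'| ≤ c * |z - z'| := fun z z' => by
    simpa [iteratedDeriv_succ] using h.lipschitz 1 (by norm_num) z z'
  have l2 : ∀ z z' : ℝ, |deriv (deriv σ) z - deriv (deriv σ) z'| ≤ c * |z - z'| := fun z z' => by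
    simpa [iteratedDeriv_succ] using h.lipschitz 2 (by norm_num) z z'
  have l3 : ∀ z z' : ℝ,
      |deriv (deriv (deriv σ)) z - deriv (deriv (deriv σ)) z'| ≤ c * |z - z'| := fun z z' => by
    simpa [iteratedDeriv_succ] using h.lipschitz 3 (by norm_num) z z'
  have d0 : Differentiable ℝ σ := (h.contDiff 1).differentiable (by norm_num)
  have d1 : Differentiable ℝ (deriv σ) :=
    ((h.contDiff 2).iterate_deriv' 1 1).differentiable (by norm_num)
  have d2 : Differentiable ℝ (deriv (deriv σ)) :=
    ((h.contDiff 3).iterate_deriv' 1 2).differentiable (by norm_num)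
  have hcA : c ≤ 5 * c + 1 := by linarith
  refine ⟨h.contDiff 2, ?_, zero_le_one, by linarith, fun _ _ => le_rfl, fun M z hM hz => ?_,
    fun M z hM hz => ?_, fun M z hM hz => ?_, fun z => ?_, fun M z z' hM _ _ => ?_,
    fun z z' => ?_, fun z z' => ?_, fun M z z' hM _ _ => ?_, fun z z' => ?_, fun z z' => ?_⟩
  · rw [h.thirdDeriv_eq]; exact measurable_deriv _
  · have h1 := l0 z 0
    rw [sub_zero] at h1
    have h2 : |σ z| ≤ c + c * (4 * M) := by
      have := abs_sub_abs_le_abs_sub (σ z) (σ 0)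
      nlinarith [h.abs_zero_le, mul_le_mul_of_nonneg_left hz hc]
    refine h2.trans ?_
    have hM2 : M ≤ M ^ 2 := by nlinarith
    have : c * M ≤ c * M ^ 2 := by gcongr
    have : c ≤ c * M := le_mul_of_one_le_right hc hM
    norm_num
    nlinarith
  · refine (abs_deriv_le_of_lipschitz l0 z).trans ?_
    norm_num
    nlinarith
  · refine (abs_deriv_le_of_lipschitz l1 z).trans ?_
    simpa using hcA
  · rw [h.thirdDeriv_eq]
    exact (abs_deriv_le_of_lipschitz l2 z).trans hcA
  · refine (abs_taylor_le_of_lipschitz d0 l1 z z').trans ?_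
    refine mul_le_mul_of_nonneg_right ?_ (sq_nonneg _)
    nlinarith
  · exact (abs_taylor_le_of_lipschitz d1 l2 z z').trans
      (mul_le_mul_of_nonneg_right hcA (sq_nonneg _))
  · rw [h.thirdDeriv_eq, mul_zero, add_zero]
    exact (abs_taylor_le_of_lipschitz d2 l3 z z').trans
      (mul_le_mul_of_nonneg_right hcA (sq_nonneg _))
  · refine (l1 z' z).trans (mul_le_mul_of_nonneg_right ?_ (abs_nonneg _))
    nlinarith
  · exact (l2 z' z).trans (mul_le_mul_of_nonneg_right hcA (abs_nonneg _))
  · rw [h.thirdDeriv_eq, add_zero]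
    exact (l3 z' z).trans (mul_le_mul_of_nonneg_right hcA (abs_nonneg _))

/-! ### Euclidean norms of coordinate vectors -/

section EuclideanNorm

variable {ι κ : Type*} [Fintype ι] [Fintype κ]

/-- The Euclidean norm of a coordinate vector. -/
noncomputable def l2 (v : ι → ℝ) : ℝ := ‖(WithLp.toLp 2 v : EuclideanSpace ℝ ι)‖

/-- The Frobenius norm of a matrix. -/
noncomputable def frob (B : Matrix ι κ ℝ) : ℝ := √(∑ i, ∑ j, B i j ^ 2)

lemma l2_nonneg (v : ι → ℝ) : 0 ≤ l2 v := norm_nonneg _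

lemma l2_sq (v : ι → ℝ) : l2 v ^ 2 = ∑ i, v i ^ 2 := by
  simp [l2, EuclideanSpace.real_norm_sq_eq]

lemma l2_add_le (u v : ι → ℝ) : l2 (u + v) ≤ l2 u + l2 v := norm_add_le _ _

lemma l2_sub_le (u v : ι → ℝ) : l2 (u - v) ≤ l2 u + l2 v := norm_sub_le _ _

lemma l2_smul (t : ℝ) (v : ι → ℝ) : l2 (t • v) = |t| * l2 v := norm_smul t _

lemma l2_eq_zero {v : ι → ℝ} (h : l2 v = 0) : v = 0 := by
  have : (WithLp.toLp 2 v : EuclideanSpace ℝ ι) = 0 := norm_eq_zero.1 h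
  funext i
  simpa using congrArg (fun x : EuclideanSpace ℝ ι => x i) this

lemma dotProduct_le_l2_mul (u v : ι → ℝ) : u ⬝ᵥ v ≤ l2 u * l2 v := by
  have := real_inner_le_norm (WithLp.toLp 2 v : EuclideanSpace ℝ ι) (WithLp.toLp 2 u)
  rw [EuclideanSpace.inner_toLp_toLp] at this
  simp only [star_trivial] at this
  rwa [mul_comm (l2 u)]

lemma l2_le_of_sq_le {v : ι → ℝ} {t : ℝ} (ht : 0 ≤ t) (h : ∑ i, v i ^ 2 ≤ t ^ 2) : l2 v ≤ t := by
  rw [← l2_sq] at h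
  exact (abs_le_of_sq_le_sq' h ht).2

lemma l2_transpose_mulVec_le (B : Matrix ι κ ℝ) (v : ι → ℝ) : l2 (Bᵀ *ᵥ v) ≤ frob B * l2 v := by
  refine l2_le_of_sq_le (mul_nonneg (Real.sqrt_nonneg _) (l2_nonneg _)) ?_
  rw [mul_pow, frob, Real.sq_sqrt (by positivity), l2_sq, Finset.sum_comm, Finset.sum_mul]
  refine Finset.sum_le_sum fun j _ => ?_
  exact Finset.sum_mul_sq_le_sq_mul_sq _ _ _

lemma l2_transpose_mulVec_sq (J : Matrix ι κ ℝ) (u : ι → ℝ) :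
    l2 (Jᵀ *ᵥ u) ^ 2 = u ⬝ᵥ ((J * Jᵀ) *ᵥ u) := by
  rw [← mulVec_mulVec, dotProduct_mulVec, ← mulVec_transpose, l2_sq]
  simp only [dotProduct, sq]

/-- The matrix inverted in natural gradient descent is invertible when `Jᵀ` is bounded below, and
the minimum-norm correction has the expected size. -/
lemma gram_solve [DecidableEq ι] {J : Matrix ι κ ℝ} {s : ℝ} (hs : 0 < s)
    (h : ∀ v, s * l2 v ≤ l2 (Jᵀ *ᵥ v)) :
    IsUnit (J * Jᵀ) ∧ ∀ r : ι → ℝ, J *ᵥ (Jᵀ *ᵥ ((J * Jᵀ)⁻¹ *ᵥ r)) = r ∧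
      l2 (Jᵀ *ᵥ ((J * Jᵀ)⁻¹ *ᵥ r)) ≤ l2 r / s ∧ l2 ((J * Jᵀ)⁻¹ *ᵥ r) ≤ l2 r / s ^ 2 := by
  have hquad := l2_transpose_mulVec_sq J
  have hu : IsUnit (J * Jᵀ) := by
    rw [← mulVec_injective_iff_isUnit]
    refine (injective_iff_map_eq_zero (J * Jᵀ).mulVecLin).2 fun u hu => ?_
    have h0 : (J * Jᵀ) *ᵥ u = 0 := hu
    have h1 := hquad u
    rw [h0, dotProduct_zero] at h1
    have h2 : l2 (Jᵀ *ᵥ u) = 0 := by simpa using h1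
    refine l2_eq_zero (le_antisymm ?_ (l2_nonneg u))
    have := h u
    rw [h2] at this
    by_contra hc
    rw [not_le] at hc
    nlinarith [mul_pos hs hc]
  refine ⟨hu, fun r => ?_⟩
  set u := (J * Jᵀ)⁻¹ *ᵥ r with hudef
  have hr : (J * Jᵀ) *ᵥ u = r := by
    rw [hudef, mulVec_mulVec, mul_nonsing_inv _ ((isUnit_iff_isUnit_det _).1 hu), one_mulVec]
  have hr' : J *ᵥ (Jᵀ *ᵥ u) = r := by rw [mulVec_mulVec, hr]
  have h1 : l2 (Jᵀ *ᵥ u) ^ 2 ≤ l2 u * l2 r := by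
    rw [hquad, hr]; exact dotProduct_le_l2_mul u r
  have h2 := h u
  have h3 : l2 (Jᵀ *ᵥ u) ≤ l2 r / s := by
    rw [le_div_iff₀ hs]
    by_contra hc
    rw [not_le] at hc
    have hp : 0 < l2 (Jᵀ *ᵥ u) := by
      by_contra h0
      have : l2 (Jᵀ *ᵥ u) = 0 := le_antisymm (not_lt.1 h0) (l2_nonneg _)
      rw [this, zero_mul] at hc
      linarith [l2_nonneg r]
    have h5 : s * l2 (Jᵀ *ᵥ u) ^ 2 ≤ l2 (Jᵀ *ᵥ u) * l2 r := by
      calc s * l2 (Jᵀ *ᵥ u) ^ 2 ≤ s * (l2 u * l2 r) := by gcongr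
        _ = (s * l2 u) * l2 r := by ring
        _ ≤ _ := mul_le_mul_of_nonneg_right h2 (l2_nonneg r)
    nlinarith
  refine ⟨hr', h3, ?_⟩
  rw [le_div_iff₀ (by positivity)]
  rw [le_div_iff₀ hs] at h3
  nlinarith

end EuclideanNorm

/-! ### Residual and Jacobian in terms of single neurons -/

/-- The normalization `n₁^{-1/2}` or `n₂^{-1/2}` of a sample. -/
noncomputable def normFactor (n₁ n₂ : ℕ) : Fin n₁ ⊕ Fin n₂ → ℝ :=
  Sum.elim (fun _ => 1 / √(n₁ : ℝ)) (fun _ => 1 / √(n₂ : ℝ))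

/-- The prescribed values `f (x_p)` and `g (y_j)`. -/
noncomputable def Data.target (D : Data d n₁ n₂) : Fin n₁ ⊕ Fin n₂ → ℝ :=
  Sum.elim (fun p => D.f (D.x p)) (fun j => D.g (D.y j))

lemma normFactor_nonneg (i : Fin n₁ ⊕ Fin n₂) : 0 ≤ normFactor n₁ n₂ i := by
  rcases i with p | j <;> simp [normFactor]

lemma sum_normFactor_sq (h₁ : 1 ≤ n₁) (h₂ : 1 ≤ n₂) : ∑ i, normFactor n₁ n₂ i ^ 2 = 2 := by
  have e₁ : (n₁ : ℝ) ≠ 0 := by positivity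
  have e₂ : (n₂ : ℝ) ≠ 0 := by positivity
  rw [Fintype.sum_sum_type]
  simp [normFactor, e₁, e₂]
  norm_num

lemma neuronGrad_eq (σ : ℝ → ℝ) (D : Data d n₁ n₂) (w : Weight d) (i : Fin n₁ ⊕ Fin n₂) :
    neuronGrad σ D w i = normFactor n₁ n₂ i • rawGrad σ D w i := by
  rcases i with p | j <;> simp [neuronGrad, normFactor, rawGrad]

lemma residual_eq {σ : ℝ → ℝ} (hσ : ContDiff ℝ 2 σ) (D : Data d n₁ n₂) (a : Fin m → ℝ)
    (w : Fin m → Weight d) (i : Fin n₁ ⊕ Fin n₂) :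
    residual σ D a w i = normFactor n₁ n₂ i *
      ((1 / √(m : ℝ)) * ∑ r, a r * neuronVal σ D (w r) i - D.target i) := by
  rcases i with p | j
  · simp [residual, normFactor, neuronVal, Data.target, heatOp_net hσ]
  · simp [residual, normFactor, neuronVal, Data.target, net]

lemma jacobian_apply (σ : ℝ → ℝ) (D : Data d n₁ n₂) (a : Fin m → ℝ) (w : Fin m → Weight d)
    (i : Fin n₁ ⊕ Fin n₂) (r : Fin m) (c : Fin (d + 2)) :
    jacobian σ D a w i (r, c)
      = (a r / √(m : ℝ)) * (normFactor n₁ n₂ i * rawGrad σ D (w r) i c) := by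
  simp [jacobian, neuronGrad_eq]

/-- The coordinates of a family of weight vectors. -/
def flat (w : Fin m → Weight d) : Fin m × Fin (d + 2) → ℝ := fun q => w q.1 q.2

lemma l2_flat_sq (w : Fin m → Weight d) : l2 (flat w) ^ 2 = ∑ r, ‖w r‖ ^ 2 := by
  rw [l2_sq, Fintype.sum_prod_type]
  simp [flat, EuclideanSpace.real_norm_sq_eq]

lemma jacobian_mulVec_flat (σ : ℝ → ℝ) (D : Data d n₁ n₂) (a : Fin m → ℝ)
    (w v : Fin m → Weight d) (i : Fin n₁ ⊕ Fin n₂) :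
    (jacobian σ D a w *ᵥ flat v) i = normFactor n₁ n₂ i *
      ((1 / √(m : ℝ)) * ∑ r, a r * inner ℝ (rawGrad σ D (w r) i) (v r)) := by
  rw [mulVec, dotProduct, Fintype.sum_prod_type, Finset.mul_sum, Finset.mul_sum]
  refine Finset.sum_congr rfl fun r _ => ?_
  simp only [jacobian_apply, flat, PiLp.inner_apply, Finset.mul_sum]
  refine Finset.sum_congr rfl fun c _ => ?_
  simp
  ring

lemma gram_apply (σ : ℝ → ℝ) (D : Data d n₁ n₂) (a : Fin m → ℝ) (w : Fin m → Weight d)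
    (i j : Fin n₁ ⊕ Fin n₂) :
    gram σ D a w i j = normFactor n₁ n₂ i * normFactor n₁ n₂ j *
      ((∑ r, a r ^ 2 * inner ℝ (rawGrad σ D (w r) i) (rawGrad σ D (w r) j)) / m) := by
  rw [gram, mul_apply, Fintype.sum_prod_type, Finset.sum_div, Finset.mul_sum]
  refine Finset.sum_congr rfl fun r _ => ?_
  simp only [jacobian_apply, transpose_apply, PiLp.inner_apply, Finset.mul_sum, Finset.sum_div]
  refine Finset.sum_congr rfl fun c _ => ?_
  have : √(m : ℝ) * √(m : ℝ) = m := Real.mul_self_sqrt (Nat.cast_nonneg m)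
  have key : ∀ x y : ℝ, a r / √(m : ℝ) * x * (a r / √(m : ℝ) * y) = a r ^ 2 * (x * y) / m :=
    fun x y => by
      calc a r / √(m : ℝ) * x * (a r / √(m : ℝ) * y)
          = a r ^ 2 * (x * y) / (√(m : ℝ) * √(m : ℝ)) := by ring
        _ = _ := by rw [this]
  simp only [RCLike.inner_apply, conj_trivial]
  rw [key]
  ring

/-! ### Deterministic convergence -/

/-- Weights that stay within distance `R` of the initialization neuron by neuron, and within
distance `Rg` globally. -/
def Region (w₀ : Fin m → Weight d) (R Rg : ℝ) (w : Fin m → Weight d) : Prop :=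
  (∀ r, ‖w r - w₀ r‖ ≤ R) ∧ l2 (flat (w - w₀)) ≤ Rg

/-- The properties of the network near an initialization on which convergence rests: with `F i r`
the indicator that the activation of neuron `r` at sample `i` may reach a jump of `σ'''`, the
gradients are bounded by `b`, and their variation and the first-order Taylor error are controlled
up to those jumps, a proportion `φ` of the neurons for each sample. -/
structure LocallyRegular (σ : ℝ → ℝ) (D : Data d n₁ n₂) (w₀ : Fin m → Weight d)
    (b R Rg φ : ℝ) (F : Fin n₁ ⊕ Fin n₂ → Fin m → ℝ) : Prop where
  contDiff : ContDiff ℝ 2 σ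
  b_pos : 0 < b
  zero_or_one : ∀ i r, F i r = 0 ∨ F i r = 1
  sum_le : ∀ i, ∑ r, F i r ≤ m * φ
  grad_le : ∀ w, Region w₀ R Rg w → ∀ i r, ‖rawGrad σ D (w r) i‖ ≤ b
  grad_sub_le : ∀ w, Region w₀ R Rg w → ∀ i r,
    ‖rawGrad σ D (w r) i - rawGrad σ D (w₀ r) i‖ ≤ b * (‖w r - w₀ r‖ + F i r)
  taylor_le : ∀ w w', Region w₀ R Rg w → Region w₀ R Rg w' → ∀ i r,
    |neuronVal σ D (w' r) i - neuronVal σ D (w r) i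
      - inner ℝ (rawGrad σ D (w r) i) (w' r - w r)|
      ≤ b * (‖w' r - w r‖ ^ 2 + ‖w' r - w r‖ * F i r)

section Deterministic

variable {σ : ℝ → ℝ} {D : Data d n₁ n₂} {w₀ w w' : Fin m → Weight d} {b R Rg φ : ℝ}
  {F : Fin n₁ ⊕ Fin n₂ → Fin m → ℝ} {a : Fin m → ℝ}

/-- The variation of the Jacobian over the region. Neurons without a jump contribute through their
global distance from the initialization, a fraction `φ` of the neurons through the jump. -/
lemma LocallyRegular.frob_le (h : LocallyRegular σ D w₀ b R Rg φ F) (h₁ : 1 ≤ n₁) (h₂ : 1 ≤ n₂)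
    (hm : 0 < m) (ha : ∀ r, |a r| ≤ 1) (hφ : 0 ≤ φ) (hRg : 0 ≤ Rg) (hw : Region w₀ R Rg w) :
    frob (jacobian σ D a w - jacobian σ D a w₀) ≤ 2 * (b * (Rg / √m + √φ)) := by
  have hb := h.b_pos
  have hm' : (0 : ℝ) < m := Nat.cast_pos.2 hm
  have hmm : √(m : ℝ) ^ 2 = m := Real.sq_sqrt hm'.le
  rw [frob]
  refine Real.sqrt_le_iff.2 ⟨by positivity, ?_⟩
  have hrow : ∀ i, ∑ q, (jacobian σ D a w - jacobian σ D a w₀) i q ^ 2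
      ≤ normFactor n₁ n₂ i ^ 2 * (2 * b ^ 2 * (Rg ^ 2 / m + φ)) := by
    intro i
    have hsum : ∑ r, ‖rawGrad σ D (w r) i - rawGrad σ D (w₀ r) i‖ ^ 2
        ≤ 2 * b ^ 2 * (Rg ^ 2 + m * φ) := by
      have hpt : ∀ r, ‖rawGrad σ D (w r) i - rawGrad σ D (w₀ r) i‖ ^ 2
          ≤ 2 * b ^ 2 * (‖(w - w₀) r‖ ^ 2 + F i r) := fun r => by
        have h1 := pow_le_pow_left₀ (norm_nonneg _) (h.grad_sub_le w hw i r) 2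
        have hF : F i r ^ 2 = F i r := by
          rcases h.zero_or_one i r with e | e <;> rw [e] <;> norm_num
        have h2 : (‖w r - w₀ r‖ + F i r) ^ 2 ≤ 2 * (‖w r - w₀ r‖ ^ 2 + F i r) := by
          nlinarith [sq_nonneg (‖w r - w₀ r‖ - F i r)]
        calc _ ≤ _ := h1
          _ = b ^ 2 * (‖w r - w₀ r‖ + F i r) ^ 2 := by ring
          _ ≤ b ^ 2 * (2 * (‖w r - w₀ r‖ ^ 2 + F i r)) := by gcongr
          _ = _ := by rw [Pi.sub_apply]; ring
      refine (Finset.sum_le_sum fun r _ => hpt r).trans ?_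
      rw [← Finset.mul_sum, Finset.sum_add_distrib, ← l2_flat_sq]
      have := pow_le_pow_left₀ (l2_nonneg _) hw.2 2
      have := h.sum_le i
      gcongr
    have hq : ∑ q, (jacobian σ D a w - jacobian σ D a w₀) i q ^ 2
        = normFactor n₁ n₂ i ^ 2 *
          ((∑ r, a r ^ 2 * ‖rawGrad σ D (w r) i - rawGrad σ D (w₀ r) i‖ ^ 2) / m) := by
      rw [Fintype.sum_prod_type, Finset.sum_div, Finset.mul_sum]
      refine Finset.sum_congr rfl fun r _ => ?_
      rw [EuclideanSpace.real_norm_sq_eq, Finset.mul_sum, Finset.sum_div, Finset.mul_sum]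
      refine Finset.sum_congr rfl fun c _ => ?_
      rw [Matrix.sub_apply, jacobian_apply, jacobian_apply, PiLp.sub_apply, ← mul_sub, ← mul_sub,
        mul_pow, mul_pow, div_pow, hmm]
      ring
    rw [hq]
    refine mul_le_mul_of_nonneg_left ?_ (sq_nonneg _)
    rw [div_le_iff₀ hm']
    calc ∑ r, a r ^ 2 * ‖rawGrad σ D (w r) i - rawGrad σ D (w₀ r) i‖ ^ 2
        ≤ ∑ r, ‖rawGrad σ D (w r) i - rawGrad σ D (w₀ r) i‖ ^ 2 := by
          refine Finset.sum_le_sum fun r _ => mul_le_of_le_one_left (sq_nonneg _) ?_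
          rw [← sq_abs]
          exact pow_le_one₀ (abs_nonneg _) (ha r)
      _ ≤ _ := hsum
      _ = 2 * b ^ 2 * (Rg ^ 2 / m + φ) * m := by field_simp
  refine (Finset.sum_le_sum fun i _ => hrow i).trans ?_
  rw [← Finset.sum_mul, sum_normFactor_sq h₁ h₂]
  have e1 : (Rg / √(m : ℝ) + √φ) ^ 2 = Rg ^ 2 / m + φ + 2 * (Rg / √m * √φ) := by
    rw [add_sq, div_pow, hmm, Real.sq_sqrt hφ]; ring
  rw [mul_pow, mul_pow, e1]
  have : 0 ≤ b ^ 2 * (Rg / √(m : ℝ) * √φ) := by positivity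
  linarith

/-- The error of linearizing the residual is small relative to the step, even at a jump of `σ'''`:
by the Cauchy--Schwarz inequality the few neurons concerned account for little of the step. -/
lemma LocallyRegular.remainder_le (h : LocallyRegular σ D w₀ b R Rg φ F) (h₁ : 1 ≤ n₁)
    (h₂ : 1 ≤ n₂) (hm : 0 < m) (ha : ∀ r, |a r| ≤ 1) (hRg : 0 ≤ Rg)
    (hw : Region w₀ R Rg w) (hw' : Region w₀ R Rg w') :
    l2 (residual σ D a w' - residual σ D a w - jacobian σ D a w *ᵥ flat (w' - w))
      ≤ 3 * (b * (Rg / √m + √φ)) * l2 (flat (w' - w)) := by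
  have hb := h.b_pos
  have hm' : (0 : ℝ) < m := Nat.cast_pos.2 hm
  have hsm : 0 < √(m : ℝ) := Real.sqrt_pos.2 hm'
  set T := l2 (flat (w' - w)) with hT
  have hT0 : 0 ≤ T := l2_nonneg _
  have hT2 : T ≤ 2 * Rg := by
    have e : flat (w' - w) = flat (w' - w₀) - flat (w - w₀) := by
      ext q; simp [flat]
    rw [hT, e]
    linarith [l2_sub_le (flat (w' - w₀)) (flat (w - w₀)), hw.2, hw'.2]
  have hi : ∀ i, |(residual σ D a w' - residual σ D a w - jacobian σ D a w *ᵥ flat (w' - w)) i|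
      ≤ normFactor n₁ n₂ i * (2 * (b * (Rg / √m + √φ)) * T) := by
    intro i
    have e : (residual σ D a w' - residual σ D a w - jacobian σ D a w *ᵥ flat (w' - w)) i
        = normFactor n₁ n₂ i * ((1 / √(m : ℝ)) * ∑ r, a r *
          (neuronVal σ D (w' r) i - neuronVal σ D (w r) i
            - inner ℝ (rawGrad σ D (w r) i) (w' r - w r))) := by
      simp only [Pi.sub_apply, residual_eq h.contDiff, jacobian_mulVec_flat, mul_sub,
        Finset.sum_sub_distrib]
      ring
    rw [e, abs_mul, abs_of_nonneg (normFactor_nonneg i)]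
    refine mul_le_mul_of_nonneg_left ?_ (normFactor_nonneg i)
    rw [abs_mul, abs_of_nonneg (by positivity : 0 ≤ 1 / √(m : ℝ))]
    have hs : |∑ r, a r * (neuronVal σ D (w' r) i - neuronVal σ D (w r) i
            - inner ℝ (rawGrad σ D (w r) i) (w' r - w r))| ≤ b * (T ^ 2 + T * √(m * φ)) := by
      refine (Finset.abs_sum_le_sum_abs _ _).trans ?_
      have hpt : ∀ r, |a r * (neuronVal σ D (w' r) i - neuronVal σ D (w r) i
            - inner ℝ (rawGrad σ D (w r) i) (w' r - w r))|
          ≤ b * (‖(w' - w) r‖ ^ 2 + ‖(w' - w) r‖ * F i r) := fun r => by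
        rw [abs_mul]
        exact (mul_le_of_le_one_left (abs_nonneg _) (ha r)).trans (h.taylor_le w w' hw hw' i r)
      refine (Finset.sum_le_sum fun r _ => hpt r).trans ?_
      rw [← Finset.mul_sum, Finset.sum_add_distrib, ← l2_flat_sq]
      refine mul_le_mul_of_nonneg_left (add_le_add le_rfl ?_) hb.le
      refine (Real.sum_mul_le_sqrt_mul_sqrt _ _ _).trans ?_
      rw [← l2_flat_sq, Real.sqrt_sq hT0]
      refine mul_le_mul_of_nonneg_left (Real.sqrt_le_sqrt ?_) hT0
      refine le_trans (le_of_eq ?_) (h.sum_le i)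
      refine Finset.sum_congr rfl fun r _ => ?_
      rcases h.zero_or_one i r with e | e <;> rw [e] <;> norm_num
    have hsplit : √(m * φ) = √(m : ℝ) * √φ := Real.sqrt_mul hm'.le φ
    calc 1 / √(m : ℝ) * _ ≤ 1 / √(m : ℝ) * (b * (T ^ 2 + T * √(m * φ))) := by gcongr
      _ ≤ 1 / √(m : ℝ) * (b * (2 * Rg * T + T * √(m * φ))) := by
          have : T ^ 2 ≤ 2 * Rg * T := by nlinarith
          gcongr
      _ = b * (2 * Rg / √m + √φ) * T := by rw [hsplit]; field_simp
      _ ≤ _ := by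
          have : 0 ≤ b * √φ * T := by positivity
          have e : 2 * (b * (Rg / √(m : ℝ) + √φ)) * T = b * (2 * Rg / √m + √φ) * T + b * √φ * T := by
            ring
          linarith
  have hκ : 0 ≤ b * (Rg / √(m : ℝ) + √φ) := by positivity
  refine l2_le_of_sq_le (by positivity) ?_
  calc ∑ i, _ ≤ ∑ i, normFactor n₁ n₂ i ^ 2 * (2 * (b * (Rg / √m + √φ)) * T) ^ 2 := by
        refine Finset.sum_le_sum fun i _ => ?_
        rw [← mul_pow, ← sq_abs]
        exact pow_le_pow_left₀ (abs_nonneg _) (hi i) 2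
    _ = 8 * (b * (Rg / √m + √φ) * T) ^ 2 := by
        rw [← Finset.sum_mul, sum_normFactor_sq h₁ h₂]; ring
    _ ≤ _ := by nlinarith [sq_nonneg (b * (Rg / √(m : ℝ) + √φ) * T)]

/-- The part of `Jᵀ u` belonging to one neuron is smaller than `Jᵀ u` by the factor `m^{-1/2}`. -/
lemma LocallyRegular.norm_block_le (h : LocallyRegular σ D w₀ b R Rg φ F) (h₁ : 1 ≤ n₁)
    (h₂ : 1 ≤ n₂) (ha : ∀ r, |a r| ≤ 1) (hw : Region w₀ R Rg w)
    (u : Fin n₁ ⊕ Fin n₂ → ℝ) (r : Fin m) :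
    ‖(WithLp.toLp 2 (fun c => ((jacobian σ D a w)ᵀ *ᵥ u) (r, c)) : Weight d)‖
      ≤ 3 / 2 * b / √m * l2 u := by
  have hb := h.b_pos
  have e : (WithLp.toLp 2 (fun c => ((jacobian σ D a w)ᵀ *ᵥ u) (r, c)) : Weight d)
      = (a r / √(m : ℝ)) • ∑ i, (u i * normFactor n₁ n₂ i) • rawGrad σ D (w r) i := by
    ext c
    simp only [mulVec, dotProduct, transpose_apply, jacobian_apply, PiLp.smul_apply, smul_eq_mul,
      WithLp.ofLp_sum, Finset.sum_apply, Finset.mul_sum]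
    refine Finset.sum_congr rfl fun i _ => ?_
    ring
  rw [e, norm_smul, Real.norm_eq_abs, abs_div, abs_of_nonneg (Real.sqrt_nonneg _)]
  have h1 : ‖∑ i, (u i * normFactor n₁ n₂ i) • rawGrad σ D (w r) i‖ ≤ 3 / 2 * b * l2 u := by
    refine (norm_sum_le _ _).trans ?_
    have hpt : ∀ i, ‖(u i * normFactor n₁ n₂ i) • rawGrad σ D (w r) i‖
        ≤ (|u i| * normFactor n₁ n₂ i) * b := fun i => by
      rw [norm_smul, Real.norm_eq_abs, abs_mul, abs_of_nonneg (normFactor_nonneg i)]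
      exact mul_le_mul_of_nonneg_left (h.grad_le w hw i r)
        (mul_nonneg (abs_nonneg _) (normFactor_nonneg i))
    refine (Finset.sum_le_sum fun i _ => hpt i).trans ?_
    rw [← Finset.sum_mul]
    have hcs := Real.sum_mul_le_sqrt_mul_sqrt Finset.univ (fun i => |u i|) (normFactor n₁ n₂)
    simp only [sq_abs] at hcs
    rw [sum_normFactor_sq h₁ h₂, ← l2_sq, Real.sqrt_sq (l2_nonneg u)] at hcs
    have h32 : √(2 : ℝ) ≤ 3 / 2 := by
      rw [Real.sqrt_le_left (by norm_num)]; norm_num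
    calc _ ≤ (l2 u * √2) * b := by gcongr
      _ ≤ (l2 u * (3 / 2)) * b := by
          have := l2_nonneg u
          gcongr
      _ = _ := by ring
  calc |a r| / √(m : ℝ) * _ ≤ 1 / √(m : ℝ) * (3 / 2 * b * l2 u) := by
        gcongr
        exact ha r
    _ = _ := by ring

lemma loss_eq (σ : ℝ → ℝ) (D : Data d n₁ n₂) (a : Fin m → ℝ) (w : Fin m → Weight d) :
    loss σ D a w = (1 / 2) * l2 (residual σ D a w) ^ 2 := by
  rw [loss, l2_sq, Fintype.sum_sum_type]

lemma flat_ngdStep_sub (σ : ℝ → ℝ) (D : Data d n₁ n₂) (η : ℝ) (a : Fin m → ℝ)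
    (w : Fin m → Weight d) :
    flat (ngdStep σ D η a w - w) = (-η) • ((jacobian σ D a w)ᵀ *ᵥ
      ((gram σ D a w)⁻¹ *ᵥ residual σ D a w)) := by
  ext q
  simp [flat, ngdStep]

/-- The exact decrease `1 - η` leaves room for a relative error of size `η q / 2` below the rate
`q = √(1 - η)`. -/
lemma contraction_le {q η : ℝ} (hq0 : 0 ≤ q) (hq2 : q ^ 2 = 1 - η) :
    (1 - η) + η * q / 2 ≤ q := by
  obtain rfl : η = 1 - q ^ 2 := by linarith
  nlinarith [mul_nonneg hq0 (sq_nonneg (1 - q))]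

/-- Linear convergence of natural gradient descent from an initialization around which the network
is regular on a region large enough to contain all iterates. The radii are geometric series: the
`k`-th iterate stays within `R (1 - qᵏ)` and `Rg (1 - qᵏ)` with `q = √(1 - η)`. -/
theorem LocallyRegular.converges (h : LocallyRegular σ D w₀ b R Rg φ F) (h₁ : 1 ≤ n₁)
    (h₂ : 1 ≤ n₂) (hm : 0 < m) (ha : ∀ r, |a r| ≤ 1) (hφ : 0 ≤ φ) {η μ ρ : ℝ} (hη : 0 < η)
    (hη1 : η < 1) (hμ : 0 < μ) (hJ : ∀ v, √μ * l2 v ≤ l2 ((jacobian σ D a w₀)ᵀ *ᵥ v))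
    (hρ : l2 (residual σ D a w₀) ≤ ρ) (hR : 12 * b * ρ / (√m * μ) ≤ R)
    (hRg : 4 * ρ / √μ ≤ Rg) (hκ : b * (Rg / √m + √φ) ≤ √(1 - η) * √μ / 12) (k : ℕ) :
    IsUnit (gram σ D a (ngd σ D η a w₀ k)) ∧
      loss σ D a (ngd σ D η a w₀ k) ≤ (1 - η) ^ k * loss σ D a w₀ := by
  have hb := h.b_pos
  have hm' : (0 : ℝ) < m := Nat.cast_pos.2 hm
  have hsm : 0 < √(m : ℝ) := Real.sqrt_pos.2 hm'
  set q := √(1 - η) with hq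
  have hq2 : q ^ 2 = 1 - η := Real.sq_sqrt (by linarith)
  have hq0 : 0 < q := Real.sqrt_pos.2 (by linarith)
  have hq1 : q < 1 := by nlinarith
  have hηq : η ≤ 2 * (1 - q) := by nlinarith
  have hsμ : 0 < √μ := Real.sqrt_pos.2 hμ
  have hsμ2 : √μ ^ 2 = μ := Real.sq_sqrt hμ.le
  have hρ0 : 0 ≤ ρ := (l2_nonneg _).trans hρ
  have hRg0 : 0 ≤ Rg := le_trans (by positivity) hRg
  have hR0 : 0 ≤ R := le_trans (by positivity) hR
  have region_of : ∀ (w : Fin m → Weight d) (j : ℕ), (∀ r, ‖w r - w₀ r‖ ≤ R * (1 - q ^ j)) →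
      l2 (flat (w - w₀)) ≤ Rg * (1 - q ^ j) → Region w₀ R Rg w := fun w j hw1 hw2 => by
    have : 1 - q ^ j ≤ 1 := by linarith [pow_pos hq0 j]
    exact ⟨fun r => (hw1 r).trans (mul_le_of_le_one_right hR0 this),
      hw2.trans (mul_le_of_le_one_right hRg0 this)⟩
  have lower : ∀ w, Region w₀ R Rg w → ∀ v, √μ / 2 * l2 v ≤ l2 ((jacobian σ D a w)ᵀ *ᵥ v) := by
    intro w hw v
    have hf := h.frob_le h₁ h₂ hm ha hφ hRg0 hw
    have h1 := l2_transpose_mulVec_le (jacobian σ D a w - jacobian σ D a w₀) v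
    have h2 : (jacobian σ D a w₀)ᵀ *ᵥ v = (jacobian σ D a w)ᵀ *ᵥ v
        - (jacobian σ D a w - jacobian σ D a w₀)ᵀ *ᵥ v := by
      rw [transpose_sub, sub_mulVec]; abel
    have h3 := hJ v
    rw [h2] at h3
    have h4 := h3.trans (l2_sub_le _ _)
    have h5 : frob (jacobian σ D a w - jacobian σ D a w₀) ≤ √μ / 2 := by nlinarith
    have := mul_le_mul_of_nonneg_right h5 (l2_nonneg v)
    linarith
  have main : ∀ j : ℕ, l2 (residual σ D a (ngd σ D η a w₀ j)) ≤ q ^ j * l2 (residual σ D a w₀) ∧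
      (∀ r, ‖ngd σ D η a w₀ j r - w₀ r‖ ≤ R * (1 - q ^ j)) ∧
      l2 (flat (ngd σ D η a w₀ j - w₀)) ≤ Rg * (1 - q ^ j) := by
    intro j
    induction j with
    | zero =>
      refine ⟨by simp [ngd], by simp [ngd], ?_⟩
      have : flat (0 : Fin m → Weight d) = 0 := by ext; simp [flat]
      simp [ngd, this, l2]
    | succ j ih =>
      obtain ⟨ih1, ih2, ih3⟩ := ih
      set w := ngd σ D η a w₀ j with hw
      have hreg := region_of w j ih2 ih3
      obtain ⟨-, hsol⟩ := gram_solve (by positivity) (lower w hreg)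
      obtain ⟨hs1, hs2, hs3⟩ := hsol (residual σ D a w)
      have hnext : ngd σ D η a w₀ (j + 1) = ngdStep σ D η a w := rfl
      rw [hnext]
      set w' := ngdStep σ D η a w with hw'
      set ε := l2 (residual σ D a w) with hε
      have hε0 : 0 ≤ ε := l2_nonneg _
      have hερ : ε ≤ q ^ j * ρ := ih1.trans (by gcongr)
      have hΔ : l2 (flat (w' - w)) ≤ η * (2 * ε / √μ) := by
        rw [flat_ngdStep_sub, l2_smul, abs_neg, abs_of_pos hη]
        refine mul_le_mul_of_nonneg_left (hs2.trans (le_of_eq ?_)) hη.le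
        field_simp
      have hΔr : ∀ r, ‖w' r - w r‖ ≤ η * (6 * b * ε / (√m * μ)) := fun r => by
        have e : w' r - w r = -(η • (WithLp.toLp 2 (fun c => ((jacobian σ D a w)ᵀ *ᵥ
            ((gram σ D a w)⁻¹ *ᵥ residual σ D a w)) (r, c)) : Weight d)) := by
          simp [hw', ngdStep]
        rw [e, norm_neg, norm_smul, Real.norm_eq_abs, abs_of_pos hη]
        refine mul_le_mul_of_nonneg_left ?_ hη.le
        refine (h.norm_block_le h₁ h₂ ha hreg _ r).trans ?_
        calc 3 / 2 * b / √(m : ℝ) * l2 ((gram σ D a w)⁻¹ *ᵥ residual σ D a w)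
            ≤ 3 / 2 * b / √(m : ℝ) * (ε / (√μ / 2) ^ 2) := by
              refine mul_le_mul_of_nonneg_left hs3 (by positivity)
          _ = _ := by rw [div_pow, hsμ2]; field_simp; ring
      have hpow : q ^ (j + 1) = q ^ j * q := pow_succ q j
      have hqj : 0 < q ^ j := pow_pos hq0 j
      have hw1 : ∀ r, ‖w' r - w₀ r‖ ≤ R * (1 - q ^ (j + 1)) := fun r => by
        have h1 : ‖w' r - w₀ r‖ ≤ ‖w' r - w r‖ + ‖w r - w₀ r‖ :=
          norm_sub_le_norm_sub_add_norm_sub _ _ _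
        have h2 : η * (6 * b * ε / (√m * μ)) ≤ R * ((1 - q) * q ^ j) := by
          calc η * (6 * b * ε / (√m * μ)) ≤ 2 * (1 - q) * (6 * b * (q ^ j * ρ) / (√m * μ)) := by
                gcongr
            _ = (12 * b * ρ / (√m * μ)) * ((1 - q) * q ^ j) := by ring
            _ ≤ _ := mul_le_mul_of_nonneg_right hR (mul_nonneg (by linarith) hqj.le)
        have := ih2 r
        have := hΔr r
        rw [hpow]
        have e : R * (1 - q ^ j * q) = R * ((1 - q) * q ^ j) + R * (1 - q ^ j) := by ring
        linarith
      have hw2 : l2 (flat (w' - w₀)) ≤ Rg * (1 - q ^ (j + 1)) := by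
        have e : flat (w' - w₀) = flat (w' - w) + flat (w - w₀) := by ext; simp [flat]
        have h1 := l2_add_le (flat (w' - w)) (flat (w - w₀))
        rw [← e] at h1
        have h2 : η * (2 * ε / √μ) ≤ Rg * ((1 - q) * q ^ j) := by
          calc η * (2 * ε / √μ) ≤ 2 * (1 - q) * (2 * (q ^ j * ρ) / √μ) := by gcongr
            _ = (4 * ρ / √μ) * ((1 - q) * q ^ j) := by ring
            _ ≤ _ := mul_le_mul_of_nonneg_right hRg (mul_nonneg (by linarith) hqj.le)
        rw [hpow]
        have e : Rg * (1 - q ^ j * q) = Rg * ((1 - q) * q ^ j) + Rg * (1 - q ^ j) := by ring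
        linarith
      refine ⟨?_, hw1, hw2⟩
      have hreg' := region_of w' (j + 1) hw1 hw2
      have hrem := h.remainder_le h₁ h₂ hm ha hRg0 hreg hreg'
      have hJΔ : jacobian σ D a w *ᵥ flat (w' - w) = (-η) • residual σ D a w := by
        rw [flat_ngdStep_sub, mulVec_smul]
        congr 1
      rw [hJΔ] at hrem
      have e : residual σ D a w' = (1 - η) • residual σ D a w
          + (residual σ D a w' - residual σ D a w - (-η) • residual σ D a w) := by
        module
      have h1 : l2 (residual σ D a w') ≤ (1 - η) * ε
          + 3 * (b * (Rg / √m + √φ)) * l2 (flat (w' - w)) := by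
        rw [e]
        refine (l2_add_le _ _).trans (add_le_add ?_ hrem)
        rw [l2_smul, abs_of_pos (by linarith)]
      have h2 : 3 * (b * (Rg / √m + √φ)) * l2 (flat (w' - w)) ≤ η * q / 2 * ε := by
        calc 3 * (b * (Rg / √m + √φ)) * l2 (flat (w' - w))
            ≤ 3 * (q * √μ / 12) * (η * (2 * ε / √μ)) := by
              refine mul_le_mul (by linarith) hΔ (l2_nonneg _) (by positivity)
          _ = η * q / 2 * ε := by field_simp; ring
      have h3 : (1 - η) * ε + η * q / 2 * ε ≤ q * ε := by
        rw [← add_mul]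
        exact mul_le_mul_of_nonneg_right (contraction_le hq0.le hq2) hε0
      calc l2 (residual σ D a w') ≤ q * ε := by linarith
        _ ≤ q * (q ^ j * l2 (residual σ D a w₀)) := by gcongr
        _ = _ := by rw [hpow]; ring
  obtain ⟨h1, h2, h3⟩ := main k
  refine ⟨(gram_solve (by positivity) (lower _ (region_of _ k h2 h3))).1, ?_⟩
  rw [loss_eq, loss_eq]
  have := pow_le_pow_left₀ (l2_nonneg _) h1 2
  rw [mul_pow, ← pow_mul, mul_comm k 2, pow_mul, hq2] at this
  linarith

end Deterministic

/-! ### Weight vectors in general position -/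

lemma exists_inner_ne_zero {n : ℕ} {ι : Type*} [Finite ι] (b : ι → EuclideanSpace ℝ (Fin n))
    (hb : ∀ i, b i ≠ 0) : ∃ w, ∀ i, inner ℝ w (b i) ≠ 0 := by
  obtain ⟨f, hf⟩ := Module.exists_dual_forall_apply_ne_zero (K := ℝ) b hb
  refine ⟨(InnerProductSpace.toDual ℝ _).symm (LinearMap.toContinuousLinearMap f), fun i => ?_⟩
  rw [InnerProductSpace.toDual_symm_apply]
  exact hf i

lemma exists_orthogonal_inner_ne_zero {n : ℕ} {ι : Type*} [Finite ι]
    {a : EuclideanSpace ℝ (Fin n)} (ha : a ≠ 0) (b : ι → EuclideanSpace ℝ (Fin n))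
    (hb : ∀ i, ∀ t : ℝ, b i ≠ t • a) : ∃ w, inner ℝ w a = 0 ∧ ∀ i, inner ℝ w (b i) ≠ 0 := by
  have haa : inner ℝ a a ≠ 0 := inner_self_ne_zero.2 ha
  obtain ⟨w, hw⟩ := exists_inner_ne_zero (fun i => b i - (inner ℝ a (b i) / inner ℝ a a) • a)
    fun i => sub_ne_zero.2 (hb i _)
  refine ⟨w - (inner ℝ w a / inner ℝ a a) • a, ?_, fun i => ?_⟩
  · rw [inner_sub_left, real_inner_smul_left]
    field_simp
    ring
  · have := hw i
    rw [inner_sub_right, real_inner_smul_right] at this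
    rw [inner_sub_left, real_inner_smul_left]
    convert this using 2
    ring

lemma aug_ne_zero (x : Point d) : aug x ≠ 0 := by
  intro h
  have := one_le_norm_aug x
  rw [h, norm_zero] at this
  linarith

/-- The index of the first spatial coordinate. -/
def firstSpatial (d : ℕ) : Fin (d + 2) := ⟨1, by omega⟩

lemma single_ne_smul_aug (hd : 1 ≤ d) (x : Point d) (t : ℝ) :
    (EuclideanSpace.single (firstSpatial d) 1 : Weight d) ≠ t • aug x := by
  intro h
  have hne : Fin.last (d + 1) ≠ firstSpatial d := by
    rw [ne_eq, Fin.ext_iff]; simp [firstSpatial]; omega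
  have h1 := congrArg (fun v : Weight d => v (Fin.last (d + 1))) h
  simp only [PiLp.smul_apply, aug_last, smul_eq_mul, mul_one] at h1
  rw [PiLp.single_apply, if_neg hne] at h1
  rw [← h1, zero_smul] at h
  have h2 := congrArg (fun v : Weight d => v (firstSpatial d)) h
  simp at h2

lemma spatial_ne_zero (hd : 1 ≤ d) {w : Weight d}
    (hw : inner ℝ w (EuclideanSpace.single (firstSpatial d) (1 : ℝ)) ≠ 0) :
    ‖spatial w‖ ^ 2 ≠ 0 := by
  intro h
  have h0 : spatial w = 0 := by simpa using h
  have h1 := congrArg (fun v : Weight d => v (firstSpatial d)) h0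
  have hne : ¬(firstSpatial d = 0 ∨ firstSpatial d = Fin.last (d + 1)) := by
    rw [Fin.ext_iff, Fin.ext_iff]; simp [firstSpatial]; omega
  simp only [spatial, hne, if_false] at h1
  exact hw (by simpa [EuclideanSpace.inner_single_right] using h1)

/-! ### Linear independence of the neuron gradients -/

/-- The last coordinate (the derivative with respect to the bias) of the gradient of a neuron. -/
noncomputable def biasGrad (σ : ℝ → ℝ) (D : Data d n₁ n₂) (w : Weight d) :
    Fin n₁ ⊕ Fin n₂ → ℝ :=
  Sum.elim (fun p => deriv (deriv σ) (inner ℝ w (aug (D.x p))) * w 0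
      - thirdDeriv σ (inner ℝ w (aug (D.x p))) * ‖spatial w‖ ^ 2)
    (fun j => deriv σ (inner ℝ w (aug (D.y j))))

lemma rawGrad_last (σ : ℝ → ℝ) (D : Data d n₁ n₂) (w : Weight d) (i : Fin n₁ ⊕ Fin n₂) :
    rawGrad σ D w i (Fin.last (d + 1)) = biasGrad σ D w i := by
  rcases i with p | j
  · simp [rawGrad, biasGrad, interiorGrad, aug_last, spatial]
  · simp [rawGrad, biasGrad, boundaryGrad, aug_last]

/-- A linear relation with coefficients `c` between the bias derivatives that holds on a dense set
of weights is trivial. -/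
def BiasGradIndep (σ : ℝ → ℝ) (D : Data d n₁ n₂) : Prop :=
  ∀ c : Fin n₁ ⊕ Fin n₂ → ℝ, Dense {w : Weight d | ∑ i, c i * biasGrad σ D w i = 0} → c = 0

/-- A function that vanishes on a dense set cannot jump by `c q` across the hyperplane
`⟨w, a⟩ = 0` unless `c q = 0` there. -/
lemma no_jump {n : ℕ} {a w₀ : EuclideanSpace ℝ (Fin n)} (ha : a ≠ 0) (hw₀ : inner ℝ w₀ a = 0)
    {u q : EuclideanSpace ℝ (Fin n) → ℝ} (hu : ContinuousAt u w₀) (hq : ContinuousAt q w₀)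
    {Z : Set (EuclideanSpace ℝ (Fin n))} (hZ : Dense Z)
    (h : ∀ w ∈ Z, u w + (if 0 ≤ inner ℝ w a then q w else 0) = 0) : q w₀ = 0 := by
  have haa : 0 < inner ℝ a a := real_inner_self_pos.2 ha
  have side : ∀ s : ℝ, s ≠ 0 → w₀ ∈ closure ({w | 0 < s * inner ℝ w a} ∩ Z) := by
    intro s hs
    have hopen : IsOpen {w : EuclideanSpace ℝ (Fin n) | 0 < s * inner ℝ w a} :=
      isOpen_lt continuous_const (by fun_prop)
    refine closure_minimal (hZ.open_subset_closure_inter hopen) isClosed_closure ?_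
    have hlim : Filter.Tendsto (fun t : ℝ => w₀ + (t * s) • a) (nhdsWithin 0 (Set.Ioi 0))
        (nhds w₀) := by
      have : Continuous fun t : ℝ => w₀ + (t * s) • a := by fun_prop
      have h2 := this.tendsto 0
      simp only [zero_mul, zero_smul, add_zero] at h2
      exact h2.mono_left nhdsWithin_le_nhds
    refine mem_closure_of_tendsto hlim ?_
    filter_upwards [self_mem_nhdsWithin] with t ht
    have ht' : 0 < t := ht
    simp only [inner_add_left, hw₀, real_inner_smul_left, zero_add]
    have : s * (t * s * inner ℝ a a) = t * s ^ 2 * inner ℝ a a := by ring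
    rw [this]
    positivity
  have hpos : u w₀ + q w₀ = 0 := by
    have := mem_closure_iff_nhdsWithin_neBot.1 (side 1 one_ne_zero)
    refine tendsto_nhds_unique ((hu.add hq).mono_left
      (nhdsWithin_le_nhds (s := {w | 0 < 1 * inner ℝ w a} ∩ Z)))
      (tendsto_const_nhds.congr' ?_)
    filter_upwards [self_mem_nhdsWithin] with w hw
    have h1 := h w hw.2
    have h2 : 0 < 1 * inner ℝ w a := hw.1
    rw [if_pos (by linarith)] at h1
    exact h1.symm
  have hneg : u w₀ = 0 := by
    have := mem_closure_iff_nhdsWithin_neBot.1 (side (-1) (by norm_num))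
    refine tendsto_nhds_unique (hu.mono_left
      (nhdsWithin_le_nhds (s := {w | 0 < -1 * inner ℝ w a} ∩ Z))) (tendsto_const_nhds.congr' ?_)
    filter_upwards [self_mem_nhdsWithin] with w hw
    have h1 := h w hw.2
    have h2 : 0 < -1 * inner ℝ w a := hw.1
    rw [if_neg (by linarith), add_zero] at h1
    exact h1.symm
  linarith

/-- For each sample there is a weight vector on its hyperplane, on no other sample's hyperplane, and
with non-zero spatial part. -/
lemma exists_on_single_hyperplane (hd : 1 ≤ d) (D : Data d n₁ n₂) (hD : D.NoTwoParallel)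
    (i : Fin n₁ ⊕ Fin n₂) : ∃ w : Weight d, inner ℝ w (aug (D.sample i)) = 0 ∧
      (∀ j, j ≠ i → inner ℝ w (aug (D.sample j)) ≠ 0) ∧ ‖spatial w‖ ^ 2 ≠ 0 := by
  obtain ⟨w, hw, hb⟩ := exists_orthogonal_inner_ne_zero (aug_ne_zero (D.sample i))
    (fun o : Option {j // j ≠ i} => o.elim (EuclideanSpace.single (firstSpatial d) 1)
      fun j => aug (D.sample j.1))
    (by
      rintro (_ | ⟨j, hj⟩) t
      · exact single_ne_smul_aug hd _ t
      · exact hD j i hj t)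
  exact ⟨w, hw, fun j hj => hb (some ⟨j, hj⟩), spatial_ne_zero hd (hb none)⟩

lemma continuousAt_thirdDeriv_relu3 {z : ℝ} (hz : z ≠ 0) : ContinuousAt (thirdDeriv relu3) z := by
  have e : thirdDeriv relu3 = fun z => if 0 ≤ z then 6 else 0 := funext thirdDeriv_relu3
  rw [e]
  rcases hz.lt_or_gt with h | h
  · refine (continuousAt_const (y := (0 : ℝ))).congr ?_
    filter_upwards [gt_mem_nhds h] with y hy
    rw [if_neg (not_le.2 hy)]
  · refine (continuousAt_const (y := (6 : ℝ))).congr ?_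
    filter_upwards [lt_mem_nhds h] with y hy
    rw [if_pos (le_of_lt hy)]

/-- For the cubed ReLU, crossing the hyperplane of an interior sample makes `σ'''` jump, which
isolates its coefficient; the boundary terms are then differentiated once more. -/
lemma biasGradIndep_relu3 (hd : 1 ≤ d) (D : Data d n₁ n₂) (hD : D.NoTwoParallel) :
    BiasGradIndep relu3 D := by
  intro c hc
  have cz : ∀ x : Point d, Continuous fun w : Weight d => (inner ℝ w (aug x) : ℝ) := fun x => by
    fun_prop
  have c1 : Continuous (deriv relu3) := by rw [deriv_relu3]; fun_prop
  have c2 : Continuous (deriv (deriv relu3)) := by rw [deriv_deriv_relu3]; fun_prop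
  have cs := continuous_spatial (d := d)
  have hin : ∀ p, c (Sum.inl p) = 0 := by
    intro p
    obtain ⟨w₀, hw₀, hoth, hsp⟩ := exists_on_single_hyperplane hd D hD (Sum.inl p)
    have hcont : ∀ i, i ≠ Sum.inl p → ContinuousAt (fun w => c i * biasGrad relu3 D w i) w₀ := by
      intro i hi
      have hz := hoth i hi
      rcases i with p' | j
      · have h3 : ContinuousAt (fun w : Weight d => thirdDeriv relu3 (inner ℝ w (aug (D.x p'))))
            w₀ := ContinuousAt.comp (f := fun w : Weight d => (inner ℝ w (aug (D.x p')) : ℝ))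
              (continuousAt_thirdDeriv_relu3 hz) (cz _).continuousAt
        simp only [biasGrad, Sum.elim_inl]
        have h2 : ContinuousAt (fun w : Weight d =>
            deriv (deriv relu3) (inner ℝ w (aug (D.x p'))) * w 0) w₀ :=
          Continuous.continuousAt (by fun_prop)
        have h4 : ContinuousAt (fun w : Weight d => ‖spatial w‖ ^ 2) w₀ :=
          Continuous.continuousAt (by fun_prop)
        exact continuousAt_const.mul (h2.sub (h3.mul h4))
      · simp only [biasGrad, Sum.elim_inr]
        exact Continuous.continuousAt (by fun_prop)
    have key := no_jump (aug_ne_zero (D.x p)) hw₀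
      (u := fun w => ∑ i ∈ Finset.univ.erase (Sum.inl p), c i * biasGrad relu3 D w i)
      (q := fun w => c (Sum.inl p)
        * (6 * inner ℝ w (aug (D.x p)) * w 0 - 6 * ‖spatial w‖ ^ 2))
      (tendsto_finsetSum _ fun i hi => hcont i (Finset.ne_of_mem_erase hi))
      (Continuous.continuousAt (by fun_prop)) hc (fun w hw => by
        rw [Set.mem_ofPred_eq, ← Finset.sum_erase_add _ _ (Finset.mem_univ (Sum.inl p))] at hw
        refine Eq.trans ?_ hw
        congr 1
        simp only [biasGrad, Sum.elim_inl, thirdDeriv_relu3, deriv_deriv_relu3]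
        split_ifs with h
        · rw [max_eq_left h]
        · rw [max_eq_right (not_le.1 h).le]; ring)
    have hw₀' : inner ℝ w₀ (aug (D.x p)) = 0 := hw₀
    simp only [hw₀', mul_zero, zero_mul, zero_sub, mul_neg, neg_eq_zero, mul_eq_zero] at key
    rcases key with h | h | h
    · exact h
    · norm_num at h
    · exact absurd h hsp
  have hall : ∀ w : Weight d, ∑ j, c (Sum.inr j) * deriv relu3 (inner ℝ w (aug (D.y j))) = 0 := by
    have : (fun w : Weight d => ∑ j, c (Sum.inr j) * deriv relu3 (inner ℝ w (aug (D.y j))))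
        = fun _ => 0 := by
      refine Continuous.ext_on hc (by fun_prop) continuous_const fun w hw => ?_
      rw [Set.mem_ofPred_eq, Fintype.sum_sum_type] at hw
      simpa [hin, biasGrad] using hw
    exact fun w => congrFun this w
  have hinner : ∀ (w : Weight d) (x : Point d) (t : ℝ),
      inner ℝ (w + t • EuclideanSpace.single (Fin.last (d + 1)) (1 : ℝ)) (aug x)
        = inner ℝ w (aug x) + t := by
    intro w x t
    rw [inner_add_left, real_inner_smul_left, EuclideanSpace.inner_single_left]
    simp [aug_last]
  -- differentiate along the bias direction
  have hall2 : ∀ w : Weight d,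
      ∑ j, c (Sum.inr j) * deriv (deriv relu3) (inner ℝ w (aug (D.y j))) = 0 := by
    intro w
    have hd1 : Differentiable ℝ (deriv relu3) :=
      (contDiff_relu3.iterate_deriv' 1 1).differentiable (by norm_num)
    have hder : HasDerivAt (fun t : ℝ => ∑ j, c (Sum.inr j)
        * deriv relu3 (inner ℝ w (aug (D.y j)) + t))
        (∑ j, c (Sum.inr j) * deriv (deriv relu3) (inner ℝ w (aug (D.y j)) + 0)) 0 :=
      HasDerivAt.fun_sum fun j _ => HasDerivAt.const_mul _ ((hd1 _).hasDerivAt.comp_const_add _ _)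
    have hz : (fun t : ℝ => ∑ j, c (Sum.inr j) * deriv relu3 (inner ℝ w (aug (D.y j)) + t))
        = fun _ => 0 := by
      funext t
      have := hall (w + t • EuclideanSpace.single (Fin.last (d + 1)) (1 : ℝ))
      simpa only [hinner] using this
    rw [hz] at hder
    simpa using hder.unique (hasDerivAt_const 0 (0 : ℝ))
  -- the right derivative along the bias direction
  have hall3 : ∀ w : Weight d,
      ∑ j, c (Sum.inr j) * thirdDeriv relu3 (inner ℝ w (aug (D.y j))) = 0 := by
    intro w
    have hr : ∀ z : ℝ, HasDerivWithinAt (fun t : ℝ => deriv (deriv relu3) (z + t))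
        (thirdDeriv relu3 z) (Set.Ici 0) 0 := by
      intro z
      rw [thirdDeriv_relu3, deriv_deriv_relu3]
      simp only
      split_ifs with h
      · refine HasDerivWithinAt.congr (f := fun t : ℝ => 6 * (z + t)) ?_ (fun y hy => ?_) ?_
        · simpa using (((hasDerivAt_id (0 : ℝ)).const_add z).const_mul 6).hasDerivWithinAt
        · have hy' : (0 : ℝ) ≤ y := hy
          rw [max_eq_left (by linarith)]
        · rw [max_eq_left (by linarith)]
      · have h' : z < 0 := not_le.1 h
        refine ((hasDerivAt_const (0 : ℝ) (0 : ℝ)).congr_of_eventuallyEq ?_).hasDerivWithinAt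
        have : ∀ᶠ t : ℝ in nhds 0, t < -z := gt_mem_nhds (by linarith)
        filter_upwards [this] with t ht
        rw [max_eq_right (by linarith), mul_zero]
    have hder : HasDerivWithinAt (fun t : ℝ => ∑ j, c (Sum.inr j)
        * deriv (deriv relu3) (inner ℝ w (aug (D.y j)) + t))
        (∑ j, c (Sum.inr j) * thirdDeriv relu3 (inner ℝ w (aug (D.y j)))) (Set.Ici 0) 0 :=
      HasDerivWithinAt.fun_sum fun j _ => HasDerivWithinAt.const_mul _ (hr _)
    have hz : (fun t : ℝ => ∑ j, c (Sum.inr j)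
        * deriv (deriv relu3) (inner ℝ w (aug (D.y j)) + t)) = fun _ => 0 := by
      funext t
      have := hall2 (w + t • EuclideanSpace.single (Fin.last (d + 1)) (1 : ℝ))
      simpa only [hinner] using this
    rw [hz] at hder
    exact (uniqueDiffWithinAt_Ici (0 : ℝ)).eq_deriv _ hder
      (hasDerivWithinAt_const (0 : ℝ) _ (0 : ℝ))
  have hbd : ∀ j, c (Sum.inr j) = 0 := by
    intro j
    obtain ⟨w₀, hw₀, hoth, -⟩ := exists_on_single_hyperplane hd D hD (Sum.inr j)
    have key := no_jump (aug_ne_zero (D.y j)) hw₀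
      (u := fun w => ∑ j' ∈ Finset.univ.erase j,
        c (Sum.inr j') * thirdDeriv relu3 (inner ℝ w (aug (D.y j'))))
      (q := fun _ => c (Sum.inr j) * 6)
      (tendsto_finsetSum _ fun j' hj' => continuousAt_const.mul
        (ContinuousAt.comp (f := fun w : Weight d => (inner ℝ w (aug (D.y j')) : ℝ))
          (continuousAt_thirdDeriv_relu3 (hoth (Sum.inr j') (by
            simpa using Finset.ne_of_mem_erase hj'))) (cz _).continuousAt))
      continuousAt_const dense_univ (fun w _ => by
        have hw := hall3 w
        rw [← Finset.sum_erase_add _ _ (Finset.mem_univ j)] at hw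
        refine Eq.trans ?_ hw
        congr 1
        rw [thirdDeriv_relu3]
        split_ifs <;> simp)
    simpa using key
  funext i
  rcases i with p | j
  · exact hin p
  · exact hbd j

/-- Exponential sums with polynomially bounded coefficients and bases of distinct modulus: if the
sum vanishes for arbitrarily large exponents, the coefficient of the largest base has to vanish. -/
lemma coefficients_eq_zero {ι : Type*} [Fintype ι] {z : ι → ℝ} (hz : ∀ i, z i ≠ 0)
    (hne : ∀ i j, i ≠ j → |z i| ≠ |z j|) {P : ι → ℕ → ℝ}
    (hP : ∀ i, (∀ k, P i k = 0) ∨ ∃ ε > 0, ∀ᶠ k in Filter.atTop, ε ≤ |P i k|)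
    (hgrow : ∀ i, ∃ B, ∀ k : ℕ, |P i k| ≤ B * (1 + (k : ℝ) ^ 2))
    (h : ∃ᶠ k in Filter.atTop, ∑ i, P i k * z i ^ k = 0) : ∀ i k, P i k = 0 := by
  classical
  by_contra hcon
  push Not at hcon
  obtain ⟨i₀, k₀, hk₀⟩ := hcon
  set S : Finset ι := Finset.univ.filter fun i => ¬ ∀ k, P i k = 0 with hS
  have hSne : S.Nonempty := ⟨i₀, by
    simp only [hS, Finset.mem_filter, Finset.mem_univ, true_and]
    exact fun h => hk₀ (h k₀)⟩
  obtain ⟨i, hiS, hmax⟩ := S.exists_max_image (fun i => |z i|) hSne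
  have hi : ¬ ∀ k, P i k = 0 := by simpa [hS] using hiS
  obtain ⟨ε, hε, hlow⟩ := (hP i).resolve_left hi
  have hsmall : ∀ j, j ≠ i → Filter.Tendsto (fun k => P j k * (z j / z i) ^ k) Filter.atTop
      (nhds 0) := by
    intro j hj
    by_cases hj0 : ∀ k, P j k = 0
    · simp [hj0]
    · have hjS : j ∈ S := by
        simp only [hS, Finset.mem_filter, Finset.mem_univ, true_and]; exact hj0
      have hlt : |z j| < |z i| := lt_of_le_of_ne (hmax j hjS) (hne j i hj)
      have hr : |(|z j / z i|)| < 1 := by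
        rw [abs_abs, abs_div, div_lt_one (abs_pos.2 (hz i))]; exact hlt
      obtain ⟨B, hB⟩ := hgrow j
      have t0 := tendsto_pow_const_mul_const_pow_of_abs_lt_one 0 hr
      have t2 := tendsto_pow_const_mul_const_pow_of_abs_lt_one 2 hr
      have t := (t0.add t2).const_mul B
      rw [add_zero, mul_zero] at t
      refine squeeze_zero_norm (fun k => ?_) t
      rw [Real.norm_eq_abs, abs_mul, abs_pow]
      calc |P j k| * |z j / z i| ^ k ≤ B * (1 + (k : ℝ) ^ 2) * |z j / z i| ^ k := by
            gcongr; exact hB k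
        _ = _ := by ring
  have hsum : Filter.Tendsto (fun k => ∑ j ∈ Finset.univ.erase i, P j k * (z j / z i) ^ k)
      Filter.atTop (nhds 0) := by
    have := tendsto_finsetSum (Finset.univ.erase i)
      fun j hj => hsmall j (Finset.ne_of_mem_erase hj)
    simpa using this
  have hev : ∀ᶠ k in Filter.atTop,
      |∑ j ∈ Finset.univ.erase i, P j k * (z j / z i) ^ k| < ε := by
    have := hsum.abs
    rw [abs_zero] at this
    exact this.eventually (gt_mem_nhds hε)
  obtain ⟨k, hk, hk1, hk2⟩ := (h.and_eventually (hlow.and hev)).exists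
  have hzk : z i ^ k ≠ 0 := pow_ne_zero _ (hz i)
  have e : P i k + ∑ j ∈ Finset.univ.erase i, P j k * (z j / z i) ^ k = 0 := by
    have : (∑ j, P j k * z j ^ k) / z i ^ k = 0 := by rw [hk, zero_div]
    rw [← Finset.add_sum_erase _ _ (Finset.mem_univ i), add_div, Finset.sum_div,
      mul_div_cancel_right₀ _ hzk] at this
    rw [← this]
    congr 1
    refine Finset.sum_congr rfl fun j _ => ?_
    rw [div_pow, mul_div_assoc]
  have : P i k = -∑ j ∈ Finset.univ.erase i, P j k * (z j / z i) ^ k := by linarith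
  rw [this, abs_neg] at hk1
  linarith

/-- Taylor coefficients of `t F'(t)`. -/
lemma iteratedDeriv_mul_deriv {F : ℝ → ℝ} (hF : ContDiff ℝ (⊤ : ℕ∞) F) (k : ℕ) :
    iteratedDeriv k (fun t => t * deriv F t)
      = fun t => t * iteratedDeriv (k + 1) F t + k * iteratedDeriv k F t := by
  have hdiff : ∀ n : ℕ, Differentiable ℝ (iteratedDeriv n F) := fun n =>
    hF.differentiable_iteratedDeriv n (by exact_mod_cast WithTop.coe_lt_top n)
  induction k with
  | zero => funext t; simp [iteratedDeriv_one]
  | succ k ih =>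
    rw [iteratedDeriv_succ, ih]
    funext t
    have h1 : HasDerivAt (iteratedDeriv (k + 1) F) (iteratedDeriv (k + 2) F t) t := by
      rw [iteratedDeriv_succ (n := k + 1)]; exact (hdiff (k + 1) t).hasDerivAt
    have h0 : HasDerivAt (iteratedDeriv k F) (iteratedDeriv (k + 1) F t) t := by
      rw [iteratedDeriv_succ (n := k)]; exact (hdiff k t).hasDerivAt
    have := ((hasDerivAt_id t).mul h1).add (h0.const_mul (k : ℝ))
    have h2 : HasDerivAt (fun t => t * iteratedDeriv (k + 1) F t + k * iteratedDeriv k F t)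
        (1 * iteratedDeriv (k + 1) F t + t * iteratedDeriv (k + 2) F t
          + k * iteratedDeriv (k + 1) F t) t := this
    rw [h2.deriv]
    push_cast
    ring

/-- A non-polynomial analytic function has infinitely many non-zero Taylor coefficients. -/
lemma SmoothActivation.frequently_ne_zero {c : ℝ} {σ : ℝ → ℝ} (h : SmoothActivation c σ) :
    ∃ᶠ k in Filter.atTop, iteratedDeriv k (deriv σ) 0 ≠ 0 := by
  intro hcon
  simp only [not_not] at hcon
  obtain ⟨N, hN⟩ := Filter.eventually_atTop.1 hcon
  have hzero : ∀ n, N + 1 ≤ n → iteratedDeriv n σ 0 = 0 := fun n hn => by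
    obtain ⟨k, rfl⟩ : ∃ k, n = k + 1 := ⟨n - 1, by omega⟩
    rw [iteratedDeriv_succ']
    exact hN k (by omega)
  apply h.not_polynomial
  set Q : Polynomial ℝ := ∑ n ∈ Finset.range (N + 1),
    Polynomial.C (iteratedDeriv n σ 0 / n.factorial) * Polynomial.X ^ n with hQ
  refine ⟨Q, ?_⟩
  have hloc : σ =ᶠ[nhds 0] fun z => Q.eval z := by
    filter_upwards [(h.analytic 0).hasFPowerSeriesAt.eventually_hasSum] with y hy
    rw [zero_add] at hy
    refine hy.unique ?_
    have : ∀ n ∉ Finset.range (N + 1), (FormalMultilinearSeries.ofScalars ℝ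
        (fun n ↦ iteratedDeriv n σ 0 / n.factorial) n) (fun _ => y) = 0 := fun n hn => by
      have := hzero n (by simpa using hn)
      simp [this]
    have hs : HasSum (fun n => (FormalMultilinearSeries.ofScalars ℝ
        (fun n ↦ iteratedDeriv n σ 0 / n.factorial) n) (fun _ => y)) _ :=
      hasSum_sum_of_ne_finset_zero this
    convert! hs using 1
    rw [hQ, Polynomial.eval_finsetSum]
    refine Finset.sum_congr rfl fun n _ => ?_
    simp
    ring
  have han : AnalyticOnNhd ℝ σ Set.univ := fun z _ => h.analytic z
  have hQan : AnalyticOnNhd ℝ (fun z => Q.eval z) Set.univ := fun z _ => by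
    have := AnalyticAt.aeval_polynomial (𝕜 := ℝ) (f := fun z : ℝ => z) (z := z) analyticAt_id Q
    simpa using this
  exact fun z => congrFun (AnalyticOnNhd.eq_of_eventuallyEq han hQan hloc) z

/-- The quadratic polynomials in `k` that occur as Taylor coefficients of the interior terms stay
away from zero for large `k`. -/
lemma exists_scalar_lower {A S c : ℝ} (hS : 0 < S) (hc : c ≠ 0) : ∃ ε > 0,
    ∀ᶠ k : ℕ in Filter.atTop, ε ≤ |c * (k * A - (k * k - k) * S)| := by
  refine ⟨|c|, abs_pos.2 hc, ?_⟩
  obtain ⟨N, hN⟩ := exists_nat_ge ((S + |A| + 1) / S)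
  filter_upwards [Filter.eventually_ge_atTop (max N 1)] with k hk
  have hk1 : (1 : ℝ) ≤ k := by exact_mod_cast (le_max_right N 1).trans hk
  have hkN : (N : ℝ) ≤ k := by exact_mod_cast (le_max_left N 1).trans hk
  have h1 : S + |A| + 1 ≤ k * S := by
    have := hN.trans hkN
    rwa [div_le_iff₀ hS] at this
  rw [abs_mul]
  refine le_mul_of_one_le_right (abs_nonneg c) ?_
  rw [abs_sub_comm]
  refine le_trans ?_ (le_abs_self _)
  have e : ((k : ℝ) * k - k) * S - k * A = k * (k * S - S - A) := by ring
  rw [e]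
  have : 1 ≤ k * S - S - A := by linarith [le_abs_self A]
  nlinarith

/-- For a smooth activation, restrict a relation to a line `t v` with `v` in general position. Its
Taylor coefficients are exponential sums with bases `⟨v, x̃ᵢ⟩`. -/
lemma SmoothActivation.biasGradIndep {C : ℝ} {σ : ℝ → ℝ} (h : SmoothActivation C σ) (hd : 1 ≤ d)
    (D : Data d n₁ n₂) (hD : D.NoTwoParallel) : BiasGradIndep σ D := by
  intro c hc
  have c1 : Continuous (deriv σ) := ((h.contDiff 2).iterate_deriv' 1 1).continuous
  have c2 : Continuous (deriv (deriv σ)) := ((h.contDiff 2).iterate_deriv' 0 2).continuous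
  have c3 : Continuous (thirdDeriv σ) := by
    rw [h.thirdDeriv_eq]; exact ((h.contDiff 3).iterate_deriv' 0 3).continuous
  have cs := continuous_spatial (d := d)
  have hall : ∀ w : Weight d, ∑ i, c i * biasGrad σ D w i = 0 := by
    have : (fun w : Weight d => ∑ i, c i * biasGrad σ D w i) = fun _ => 0 := by
      refine Continuous.ext_on hc ?_ continuous_const fun w hw => hw
      refine continuous_finsetSum _ fun i _ => continuous_const.mul ?_
      rcases i with p | j
      · simp only [biasGrad, Sum.elim_inl]; fun_prop
      · simp only [biasGrad, Sum.elim_inr]; fun_prop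
    exact fun w => congrFun this w
  -- a direction in general position
  obtain ⟨v, hv⟩ := exists_inner_ne_zero (n := d + 2)
    (Sum.elim (fun ij : (Fin n₁ ⊕ Fin n₂) × (Fin n₁ ⊕ Fin n₂) =>
        aug (D.sample ij.1) + aug (D.sample ij.2))
      (Sum.elim (fun ij : {ij : (Fin n₁ ⊕ Fin n₂) × (Fin n₁ ⊕ Fin n₂) // ij.1 ≠ ij.2} =>
          aug (D.sample ij.1.1) - aug (D.sample ij.1.2))
        (fun _ : Unit => EuclideanSpace.single (firstSpatial d) 1)))
    (by
      rintro (ij | ij | _)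
      · intro h0
        have := congrArg (fun u : Weight d => u (Fin.last (d + 1))) h0
        simp [aug_last] at this
      · have := hD ij.1.1 ij.1.2 ij.2 1
        rw [one_smul] at this
        exact sub_ne_zero.2 this
      · have := single_ne_smul_aug (d := d) hd 0 0
        rwa [zero_smul] at this)
  set z : Fin n₁ ⊕ Fin n₂ → ℝ := fun i => inner ℝ v (aug (D.sample i)) with hz
  have hz0 : ∀ i, z i ≠ 0 := fun i hi => by
    have := hv (Sum.inl (i, i))
    simp only [Sum.elim_inl, inner_add_right] at this
    exact this (by simp only [hz] at hi; rw [hi, add_zero])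
  have hzne : ∀ i j, i ≠ j → |z i| ≠ |z j| := fun i j hij habs => by
    rcases abs_eq_abs.1 habs with h1 | h1
    · have := hv (Sum.inr (Sum.inl ⟨(i, j), hij⟩))
      simp only [Sum.elim_inl, Sum.elim_inr, inner_sub_right] at this
      exact this (sub_eq_zero.2 h1)
    · have := hv (Sum.inl (i, j))
      simp only [Sum.elim_inl, inner_add_right] at this
      exact this (by simp only [hz] at h1; rw [h1]; ring)
  have hS : 0 < ‖spatial v‖ ^ 2 :=
    lt_of_le_of_ne (sq_nonneg _) (spatial_ne_zero hd (hv (Sum.inr (Sum.inr ())))).symm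
  set S := ‖spatial v‖ ^ 2
  set f : Fin n₁ ⊕ Fin n₂ → ℝ → ℝ := fun i t => deriv σ (z i * t) with hf
  have hσ1 : ContDiff ℝ (⊤ : ℕ∞) (deriv σ) :=
    (contDiff_infty_iff_deriv.1 (h.contDiff _)).2
  have hfs : ∀ i, ContDiff ℝ (⊤ : ℕ∞) (f i) := fun i => hσ1.comp (contDiff_const.mul contDiff_id)
  have hd1 : Differentiable ℝ (deriv σ) := hσ1.differentiable (by simp)
  have hd2 : Differentiable ℝ (deriv (deriv σ)) :=
    ((h.contDiff 3).iterate_deriv' 1 2).differentiable (by norm_num)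
  have hf1 : ∀ i, deriv (f i) = fun t => z i * deriv (deriv σ) (z i * t) := fun i => by
    funext t
    have := (hd1 (z i * t)).hasDerivAt.comp t ((hasDerivAt_id t).const_mul (z i))
    refine (HasDerivAt.deriv (f := f i) this).trans ?_
    ring
  have hf2 : ∀ i, deriv (fun t => t * deriv (f i) t)
      = fun t => z i * deriv (deriv σ) (z i * t) + t * (z i ^ 2 * thirdDeriv σ (z i * t)) := by
    intro i
    funext t
    rw [hf1, h.thirdDeriv_eq]
    have h1 : HasDerivAt (fun t => deriv (deriv σ) (z i * t)) _ t :=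
      (hd2 (z i * t)).hasDerivAt.comp t ((hasDerivAt_id t).const_mul (z i))
    have h2 : HasDerivAt (fun t => t * (z i * deriv (deriv σ) (z i * t))) _ t :=
      (hasDerivAt_id t).mul (h1.const_mul (z i))
    rw [h2.deriv]
    simp only [id]
    ring
  -- the Euler operator `t d/dt` acts diagonally on Taylor coefficients
  set θ : (ℝ → ℝ) → ℝ → ℝ := fun F t => t * deriv F t with hθ
  have hθs : ∀ F, ContDiff ℝ (⊤ : ℕ∞) F → ContDiff ℝ (⊤ : ℕ∞) (θ F) := fun F hF =>
    contDiff_id.mul (contDiff_infty_iff_deriv.1 hF).2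
  have hθk : ∀ F, ContDiff ℝ (⊤ : ℕ∞) F → ∀ k, iteratedDeriv k (θ F) 0
      = k * iteratedDeriv k F 0 := fun F hF k => by
    rw [hθ]
    simp only [iteratedDeriv_mul_deriv hF]
    ring
  have hfk : ∀ i k, iteratedDeriv k (f i) 0 = z i ^ k * iteratedDeriv k (deriv σ) 0 := by
    intro i k
    have := congrFun (iteratedDeriv_comp_const_mul (n := k) (hσ1.of_le (by exact_mod_cast le_top))
      (z i)) 0
    simpa using this
  set T : Fin n₁ ⊕ Fin n₂ → ℝ → ℝ := Sum.elim
    (fun p t => v 0 / z (Sum.inl p) * θ (f (Sum.inl p)) t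
      - S / z (Sum.inl p) ^ 2 * (θ (θ (f (Sum.inl p))) t - θ (f (Sum.inl p)) t))
    (fun j t => f (Sum.inr j) t) with hT
  have hTs : ∀ i, ContDiff ℝ (⊤ : ℕ∞) (T i) := by
    rintro (p | j)
    · exact (contDiff_const.mul (hθs _ (hfs _))).sub
        (contDiff_const.mul ((hθs _ (hθs _ (hfs _))).sub (hθs _ (hfs _))))
    · exact hfs _
  have hTb : ∀ i t, T i t = biasGrad σ D (t • v) i := by
    rintro (p | j) t
    · have hsp : ‖spatial (t • v)‖ ^ 2 = t ^ 2 * S := by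
        have : spatial (t • v) = t • spatial v := by
          ext i; by_cases h : i = 0 ∨ i = Fin.last (d + 1) <;> simp [spatial, h]
        rw [this, norm_smul, mul_pow, Real.norm_eq_abs, sq_abs]
      have hzp : inner ℝ (t • v) (aug (D.x p)) = z (Sum.inl p) * t := by
        rw [real_inner_smul_left, mul_comm]; rfl
      have hne := hz0 (Sum.inl p)
      simp only [hT, Sum.elim_inl, biasGrad, hsp, hzp, hθ, hf2, PiLp.smul_apply, smul_eq_mul]
      simp only [hf1]
      field_simp
      ring
    · have hzj : inner ℝ (t • v) (aug (D.y j)) = z (Sum.inr j) * t := by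
        rw [real_inner_smul_left, mul_comm]; rfl
      simp only [hT, Sum.elim_inr, biasGrad, hzj, hf]
  set P : Fin n₁ ⊕ Fin n₂ → ℕ → ℝ := Sum.elim
    (fun p k => c (Sum.inl p) * (k * (v 0 / z (Sum.inl p))
      - (k * k - k) * (S / z (Sum.inl p) ^ 2)))
    (fun j _ => c (Sum.inr j)) with hPdef
  have hTk : ∀ i k, c i * iteratedDeriv k (T i) 0
      = P i k * z i ^ k * iteratedDeriv k (deriv σ) 0 := by
    rintro (p | j) k
    · have a1 : ContDiff ℝ (⊤ : ℕ∞) (θ (f (Sum.inl p))) := hθs _ (hfs _)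
      have a2 := hθs _ a1
      have lk : ((k : ℕ∞) : WithTop ℕ∞) ≤ ((⊤ : ℕ∞) : WithTop ℕ∞) := by exact_mod_cast le_top
      have e1 : iteratedDeriv k (T (Sum.inl p)) 0
          = v 0 / z (Sum.inl p) * iteratedDeriv k (θ (f (Sum.inl p))) 0
            - S / z (Sum.inl p) ^ 2 * (iteratedDeriv k (θ (θ (f (Sum.inl p)))) 0
              - iteratedDeriv k (θ (f (Sum.inl p))) 0) := by
        simp only [hT, Sum.elim_inl]
        rw [iteratedDeriv_fun_sub, iteratedDeriv_const_mul_field, iteratedDeriv_const_mul_field,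
          iteratedDeriv_fun_sub]
        · exact (a2.of_le lk).contDiffAt
        · exact (a1.of_le lk).contDiffAt
        · exact ((contDiff_const.mul a1).of_le lk).contDiffAt
        · exact ((contDiff_const.mul (a2.sub a1)).of_le lk).contDiffAt
      rw [e1, hθk _ a1, hθk _ (hfs _), hfk]
      simp only [hPdef, Sum.elim_inl]
      ring
    · have : T (Sum.inr j) = f (Sum.inr j) := rfl
      rw [this, hfk]
      simp only [hPdef, Sum.elim_inr]
      ring
  have hsum : ∀ k, (∑ i, P i k * z i ^ k) * iteratedDeriv k (deriv σ) 0 = 0 := by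
    intro k
    have lk : ((k : ℕ∞) : WithTop ℕ∞) ≤ ((⊤ : ℕ∞) : WithTop ℕ∞) := by exact_mod_cast le_top
    have e0 : (fun t => ∑ i, c i * T i t) = fun _ => 0 := by
      funext t
      simp only [hTb]
      exact hall (t • v)
    have e1 : iteratedDeriv k (fun t => ∑ i, c i * T i t) 0 = 0 := by
      rw [e0, iteratedDeriv_const]; simp
    rw [iteratedDeriv_fun_sum fun i _ => ((contDiff_const.mul (hTs i)).of_le lk).contDiffAt] at e1
    simp only [iteratedDeriv_const_mul_field, hTk] at e1
    rw [Finset.sum_mul]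
    exact e1
  have hPzero := coefficients_eq_zero hz0 hzne (P := P) (by
      rintro (p | j)
      · by_cases hc0 : c (Sum.inl p) = 0
        · left; intro k; simp [hPdef, hc0]
        · right
          exact exists_scalar_lower (div_pos hS (by have := hz0 (Sum.inl p); positivity)) hc0
      · by_cases hc0 : c (Sum.inr j) = 0
        · left; intro k; simp [hPdef, hc0]
        · right
          exact ⟨|c (Sum.inr j)|, abs_pos.2 hc0, Filter.Eventually.of_forall fun k => le_rfl⟩)
    (by
      rintro (p | j)
      · refine ⟨|c (Sum.inl p)| * (|v 0 / z (Sum.inl p)| + 2 * |S / z (Sum.inl p) ^ 2|),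
          fun k => ?_⟩
        simp only [hPdef, Sum.elim_inl]
        rw [abs_mul, mul_assoc]
        refine mul_le_mul_of_nonneg_left ?_ (abs_nonneg _)
        have hk0 : (0 : ℝ) ≤ k := Nat.cast_nonneg k
        have hk1 : (k : ℝ) ≤ 1 + (k : ℝ) ^ 2 := by nlinarith [sq_nonneg ((k : ℝ) - 1)]
        have hk2 : |(k : ℝ) * k - k| ≤ 2 * (1 + (k : ℝ) ^ 2) := by
          rw [abs_le]; constructor <;> nlinarith
        refine (abs_sub _ _).trans ?_
        rw [abs_mul, abs_mul, abs_of_nonneg hk0]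
        have g1 := mul_le_mul_of_nonneg_right hk1 (abs_nonneg (v 0 / z (Sum.inl p)))
        have g2 := mul_le_mul_of_nonneg_right hk2 (abs_nonneg (S / z (Sum.inl p) ^ 2))
        linarith
      · refine ⟨|c (Sum.inr j)|, fun k => ?_⟩
        simp only [hPdef, Sum.elim_inr]
        exact le_mul_of_one_le_right (abs_nonneg _) (by nlinarith [sq_nonneg (k : ℝ)]))
    (h.frequently_ne_zero.mono fun k hk => (mul_eq_zero.1 (hsum k)).resolve_right hk)
  funext i
  rcases i with p | j
  · by_contra hc0
    obtain ⟨ε, hε, hev⟩ := exists_scalar_lower (A := v 0 / z (Sum.inl p))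
      (div_pos hS (by have := hz0 (Sum.inl p); positivity : 0 < z (Sum.inl p) ^ 2)) hc0
    obtain ⟨k, hk⟩ := hev.exists
    have := hPzero (Sum.inl p) k
    simp only [hPdef, Sum.elim_inl] at this
    rw [this, abs_zero] at hk
    linarith
  · exact hPzero (Sum.inr j) 0

/-! ### The least eigenvalue of the expected Gram matrix -/

lemma normFactor_pos (h₁ : 1 ≤ n₁) (h₂ : 1 ≤ n₂) (i : Fin n₁ ⊕ Fin n₂) :
    0 < normFactor n₁ n₂ i := by
  have : (0 : ℝ) < n₁ := by exact_mod_cast h₁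
  have : (0 : ℝ) < n₂ := by exact_mod_cast h₂
  rcases i with p | j <;> simp [normFactor] <;> assumption

lemma normFactor_sq_le_one (i : Fin n₁ ⊕ Fin n₂) : normFactor n₁ n₂ i ^ 2 ≤ 1 := by
  have key : ∀ n : ℕ, (1 / √(n : ℝ)) ^ 2 ≤ 1 := fun n => by
    rcases Nat.eq_zero_or_pos n with rfl | hn
    · simp
    · rw [div_pow, one_pow, Real.sq_sqrt (Nat.cast_nonneg n)]
      exact div_le_one_of_le₀ (by exact_mod_cast hn) (Nat.cast_nonneg n)
  rcases i with p | j
  · exact key n₁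
  · exact key n₂

section GramInf

variable {σ : ℝ → ℝ} {g : ℕ} {κ : ℝ → ℝ → ℝ} {A : ℝ} {D : Data d n₁ n₂}

lemma abs_inner_rawGrad_le (h : ActivationBounds σ g κ A) (hD : ∀ i, ‖D.sample i‖ ≤ 1)
    (w : Weight d) (i j : Fin n₁ ⊕ Fin n₂) :
    |inner ℝ (rawGrad σ D w i) (rawGrad σ D w j)| ≤ (100 * A) ^ 2 * (1 + ‖w‖) ^ 4 := by
  have hA := h.pos
  have hM : 1 ≤ 1 + ‖w‖ := by linarith [norm_nonneg w]
  have hw : ‖w‖ ≤ 2 * (1 + ‖w‖) := by linarith [norm_nonneg w]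
  refine (abs_real_inner_le_norm _ _).trans ?_
  calc ‖rawGrad σ D w i‖ * ‖rawGrad σ D w j‖
      ≤ (100 * A * (1 + ‖w‖) ^ 2) * (100 * A * (1 + ‖w‖) ^ 2) :=
        mul_le_mul (norm_rawGrad_le h D hD hM hw i) (norm_rawGrad_le h D hD hM hw j)
          (norm_nonneg _) (by positivity)
    _ = _ := by ring

lemma measurable_inner_rawGrad (h : ActivationBounds σ g κ A) (i j : Fin n₁ ⊕ Fin n₂) :
    Measurable fun w => (inner ℝ (rawGrad σ D w i) (rawGrad σ D w j) : ℝ) :=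
  (measurable_rawGrad h D i).inner (measurable_rawGrad h D j)

lemma integrable_inner_rawGrad (h : ActivationBounds σ g κ A) (hD : ∀ i, ‖D.sample i‖ ≤ 1)
    (i j : Fin n₁ ⊕ Fin n₂) :
    Integrable (fun w => (inner ℝ (rawGrad σ D w i) (rawGrad σ D w j) : ℝ))
      (stdGaussian (Weight d)) :=
  ((integrable_one_add_norm_pow (d + 2) 4).const_mul ((100 * A) ^ 2)).mono'
    (measurable_inner_rawGrad h i j).aestronglyMeasurable
    (ae_of_all _ fun w => abs_inner_rawGrad_le h hD w i j)

lemma gramInf_apply (i j : Fin n₁ ⊕ Fin n₂) :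
    gramInf σ D i j = normFactor n₁ n₂ i * normFactor n₁ n₂ j *
      ∫ w, inner ℝ (rawGrad σ D w i) (rawGrad σ D w j) ∂(stdGaussian (Weight d)) := by
  rw [gramInf, of_apply, ← integral_const_mul]
  congr 1
  funext w
  rw [neuronGrad_eq, neuronGrad_eq, real_inner_smul_left, real_inner_smul_right, mul_assoc]

lemma isHermitian_gramInf : (gramInf σ D).IsHermitian := by
  ext i j
  simp [gramInf, real_inner_comm]

lemma dotProduct_gramInf (h : ActivationBounds σ g κ A) (hD : ∀ i, ‖D.sample i‖ ≤ 1)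
    (v : Fin n₁ ⊕ Fin n₂ → ℝ) :
    v ⬝ᵥ (gramInf σ D *ᵥ v)
      = ∫ w, ‖∑ i, (v i * normFactor n₁ n₂ i) • rawGrad σ D w i‖ ^ 2 ∂(stdGaussian (Weight d)) := by
  have e : ∀ w : Weight d, ‖∑ i, (v i * normFactor n₁ n₂ i) • rawGrad σ D w i‖ ^ 2
      = ∑ i, ∑ j, (v i * normFactor n₁ n₂ i) * (v j * normFactor n₁ n₂ j)
        * inner ℝ (rawGrad σ D w i) (rawGrad σ D w j) := by
    intro w
    rw [← real_inner_self_eq_norm_sq, sum_inner]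
    refine Finset.sum_congr rfl fun i _ => ?_
    rw [inner_sum]
    refine Finset.sum_congr rfl fun j _ => ?_
    rw [real_inner_smul_left, real_inner_smul_right]
    ring
  have hi : ∀ i j, Integrable (fun w => (v i * normFactor n₁ n₂ i) * (v j * normFactor n₁ n₂ j)
        * inner ℝ (rawGrad σ D w i) (rawGrad σ D w j)) (stdGaussian (Weight d)) := fun i j =>
    (integrable_inner_rawGrad h hD i j).const_mul _
  simp only [e]
  rw [integral_finsetSum _ fun i _ => integrable_finsetSum _ fun j _ => hi i j]
  rw [dotProduct]
  refine Finset.sum_congr rfl fun i _ => ?_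
  rw [integral_finsetSum _ fun j _ => hi i j, mulVec, dotProduct, Finset.mul_sum]
  refine Finset.sum_congr rfl fun j _ => ?_
  rw [integral_const_mul, gramInf_apply]
  ring

lemma posDef_gramInf (h : ActivationBounds σ g κ A) (hD : ∀ i, ‖D.sample i‖ ≤ 1) (h₁ : 1 ≤ n₁)
    (h₂ : 1 ≤ n₂) (hind : BiasGradIndep σ D) : (gramInf σ D).PosDef := by
  refine PosDef.of_dotProduct_mulVec_pos isHermitian_gramInf fun v hv => ?_
  rw [star_trivial, dotProduct_gramInf h hD]
  have hnn : ∀ w : Weight d,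
      0 ≤ ‖∑ i, (v i * normFactor n₁ n₂ i) • rawGrad σ D w i‖ ^ 2 := fun w => sq_nonneg _
  refine lt_of_le_of_ne (integral_nonneg hnn) fun h0 => hv ?_
  have hint : Integrable (fun w : Weight d =>
      ‖∑ i, (v i * normFactor n₁ n₂ i) • rawGrad σ D w i‖ ^ 2) (stdGaussian (Weight d)) := by
    have hm : Measurable fun w : Weight d =>
        ∑ i, (v i * normFactor n₁ n₂ i) • rawGrad σ D w i :=
      Finset.measurable_fun_sum _ fun i _ => by
        have h1 := measurable_rawGrad h D i
        fun_prop
    have hA := h.pos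
    refine ((integrable_one_add_norm_pow (d + 2) 4).const_mul
      ((∑ i, |v i * normFactor n₁ n₂ i| * (100 * A)) ^ 2)).mono'
      (hm.norm.pow_const 2).aestronglyMeasurable (ae_of_all _ fun w => ?_)
    rw [Real.norm_eq_abs, abs_of_nonneg (hnn w)]
    have hM : 1 ≤ 1 + ‖w‖ := by linarith [norm_nonneg w]
    have hw : ‖w‖ ≤ 2 * (1 + ‖w‖) := by linarith [norm_nonneg w]
    have : ‖∑ i, (v i * normFactor n₁ n₂ i) • rawGrad σ D w i‖
        ≤ (∑ i, |v i * normFactor n₁ n₂ i| * (100 * A)) * (1 + ‖w‖) ^ 2 := by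
      rw [Finset.sum_mul]
      refine (norm_sum_le _ _).trans (Finset.sum_le_sum fun i _ => ?_)
      rw [norm_smul, Real.norm_eq_abs, mul_assoc]
      exact mul_le_mul_of_nonneg_left (norm_rawGrad_le h D hD hM hw i) (abs_nonneg _)
    calc _ ≤ ((∑ i, |v i * normFactor n₁ n₂ i| * (100 * A)) * (1 + ‖w‖) ^ 2) ^ 2 :=
          pow_le_pow_left₀ (norm_nonneg _) this 2
      _ = _ := by ring
  have hae := (integral_eq_zero_iff_of_nonneg hnn hint).1 h0.symm
  have hdense : Dense {w : Weight d |
      ∑ i, (v i * normFactor n₁ n₂ i) * biasGrad σ D w i = 0} := by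
    refine Measure.dense_of_ae (μ := stdGaussian (Weight d)) ?_
    filter_upwards [hae] with w hw
    have hw' : ∑ i, (v i * normFactor n₁ n₂ i) • rawGrad σ D w i = 0 := by
      simpa using hw
    have := congrArg (fun u : Weight d => u (Fin.last (d + 1))) hw'
    simpa [WithLp.ofLp_sum, Finset.sum_apply, rawGrad_last] using this
  have := hind _ hdense
  funext i
  have hi := congrFun this i
  exact (mul_eq_zero.1 hi).resolve_right (normFactor_pos h₁ h₂ i).ne'

lemma spectrum_gramInf_finite_nonempty (h₁ : 1 ≤ n₁) :
    (spectrum ℝ (gramInf σ D)).Finite ∧ (spectrum ℝ (gramInf σ D)).Nonempty := by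
  rw [(isHermitian_gramInf (σ := σ) (D := D)).spectrum_real_eq_range_eigenvalues]
  have : Nonempty (Fin n₁ ⊕ Fin n₂) := ⟨Sum.inl ⟨0, h₁⟩⟩
  exact ⟨Set.finite_range _, Set.range_nonempty _⟩

lemma lambda₀_pos (h : ActivationBounds σ g κ A) (hD : ∀ i, ‖D.sample i‖ ≤ 1) (h₁ : 1 ≤ n₁)
    (h₂ : 1 ≤ n₂) (hind : BiasGradIndep σ D) : 0 < lambda₀ σ D := by
  obtain ⟨hf, hn⟩ := spectrum_gramInf_finite_nonempty (σ := σ) (D := D) h₁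
  have hmem := hn.csInf_mem hf
  have hpd := posDef_gramInf h hD h₁ h₂ hind
  rw [hpd.isHermitian.spectrum_real_eq_range_eigenvalues] at hmem
  obtain ⟨i, hi⟩ := hmem
  rw [lambda₀, hpd.isHermitian.spectrum_real_eq_range_eigenvalues, ← hi]
  exact hpd.eigenvalues_pos i

/-- Rayleigh bound: the least eigenvalue bounds the quadratic form from below. -/
lemma lambda₀_mul_le (v : Fin n₁ ⊕ Fin n₂ → ℝ) (h₁ : 1 ≤ n₁) :
    lambda₀ σ D * l2 v ^ 2 ≤ v ⬝ᵥ (gramInf σ D *ᵥ v) := by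
  have hfin := spectrum_gramInf_finite_nonempty (σ := σ) (D := D) h₁
  have hps : (gramInf σ D - algebraMap ℝ _ (lambda₀ σ D)).PosSemidef := by
    rw [posSemidef_iff_isHermitian_and_spectrum_nonneg]
    constructor
    · refine isHermitian_gramInf.sub ?_
      rw [algebraMap_eq_diagonal]
      exact isHermitian_diagonal _
    · rw [← spectrum.sub_singleton_eq]
      rintro x ⟨a, ha, b, hb, rfl⟩
      have hb' : b = lambda₀ σ D := hb
      have : lambda₀ σ D ≤ a := csInf_le hfin.1.bddBelow ha
      show 0 ≤ a - b
      linarith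
  have := hps.dotProduct_mulVec_nonneg v
  rw [star_trivial, sub_mulVec, dotProduct_sub, algebraMap_eq_diagonal] at this
  have e : v ⬝ᵥ (diagonal ((algebraMap ℝ (Fin n₁ ⊕ Fin n₂ → ℝ)) (lambda₀ σ D)) *ᵥ v)
      = lambda₀ σ D * l2 v ^ 2 := by
    rw [l2_sq, dotProduct, Finset.mul_sum]
    refine Finset.sum_congr rfl fun i _ => ?_
    rw [mulVec_diagonal]
    simp
    ring
  rw [e] at this
  linarith

/-- The least eigenvalue grows at most quadratically in the dimension. -/
lemma lambda₀_le (h : ActivationBounds σ g κ A) (hD : ∀ i, ‖D.sample i‖ ≤ 1) (h₁ : 1 ≤ n₁) {C : ℝ}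
    (hC : ∫ w : Weight d, (1 + ‖w‖) ^ 4 ∂(stdGaussian (Weight d)) ≤ C * (d : ℝ) ^ 2) :
    lambda₀ σ D ≤ (100 * A) ^ 2 * (C * (d : ℝ) ^ 2) := by
  have i : Fin n₁ ⊕ Fin n₂ := Sum.inl ⟨0, h₁⟩
  have hr := lambda₀_mul_le (σ := σ) (D := D) (Pi.single i 1) h₁
  have e1 : l2 (Pi.single i (1 : ℝ) : Fin n₁ ⊕ Fin n₂ → ℝ) ^ 2 = 1 := by
    rw [l2_sq, Finset.sum_eq_single i]
    · simp
    · intro j _ hj; simp [Pi.single_eq_of_ne hj]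
    · simp
  rw [e1, mul_one, mulVec_single_one, single_dotProduct, one_mul, col_apply, gramInf_apply] at hr
  refine hr.trans ?_
  have hI : ∫ w, inner ℝ (rawGrad σ D w i) (rawGrad σ D w i) ∂(stdGaussian (Weight d))
      ≤ (100 * A) ^ 2 * (C * (d : ℝ) ^ 2) := by
    refine le_trans (integral_mono (integrable_inner_rawGrad h hD i i)
      ((integrable_one_add_norm_pow (d + 2) 4).const_mul ((100 * A) ^ 2)) fun w =>
        (le_abs_self _).trans (abs_inner_rawGrad_le h hD w i i)) ?_
    rw [integral_const_mul]
    exact mul_le_mul_of_nonneg_left hC (sq_nonneg _)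
  have hI0 : 0 ≤ ∫ w, inner ℝ (rawGrad σ D w i) (rawGrad σ D w i) ∂(stdGaussian (Weight d)) :=
    integral_nonneg fun w => real_inner_self_nonneg
  refine (mul_le_of_le_one_left hI0 ?_).trans hI
  rw [← sq]
  exact normFactor_sq_le_one i

end GramInf

/-! ### Properties of a random initialization -/

lemma measure_exists_le {Ω ι : Type*} [MeasurableSpace Ω] [Fintype ι] (μ : Measure Ω)
    {p : ι → Ω → Prop} {ε : ℝ} (hε : ∀ i, μ {ω | p i ω} ≤ ENNReal.ofReal ε) :
    μ {ω | ∃ i, p i ω} ≤ ENNReal.ofReal (Fintype.card ι * ε) := by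
  have e : {ω | ∃ i, p i ω} = ⋃ i, {ω | p i ω} := by ext; simp
  rw [e]
  refine (measure_iUnion_fintype_le _ _).trans ((Finset.sum_le_sum fun i _ => hε i).trans ?_)
  rw [Finset.sum_const, Finset.card_univ, nsmul_eq_mul, ENNReal.ofReal_mul (Nat.cast_nonneg _),
    ENNReal.ofReal_natCast]

/-- Five times the logarithm in the exponent suffices for a union bound over `n²` events. -/
lemma bernstein_tail_le {V l t n δ : ℝ} {m : ℕ} (hV : 0 < V) (hn : 2 ≤ n) (hδ : 0 < δ)
    (hδ1 : δ < 1) (hl : l = Real.log (n / δ)) (h : 20 * V * l ≤ m * t ^ 2) :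
    2 * Real.exp (-(m * t ^ 2 / (4 * V))) ≤ δ / (4 * n ^ 2) := by
  have hx : 0 < n / δ := by positivity
  have h1 : 5 * l ≤ m * t ^ 2 / (4 * V) := by
    rw [le_div_iff₀ (by positivity)]; linarith
  have h2 : Real.exp (-(m * t ^ 2 / (4 * V))) ≤ (δ / n) ^ 5 := by
    calc Real.exp (-(m * t ^ 2 / (4 * V))) ≤ Real.exp (-(5 * l)) := by
          apply Real.exp_le_exp.2; linarith
      _ = (δ / n) ^ 5 := by
          rw [hl, Real.exp_neg, show (5 : ℝ) * Real.log (n / δ) = (5 : ℕ) * Real.log (n / δ) by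
            norm_num, Real.exp_nat_mul, Real.exp_log hx, ← inv_pow, inv_div]
  have h3 : (δ / n) ^ 5 ≤ δ / n ^ 2 * (1 / 8) := by
    have e : (δ / n) ^ 5 = δ / n ^ 2 * (δ ^ 4 / n ^ 3) := by field_simp
    rw [e]
    refine mul_le_mul_of_nonneg_left ?_ (by positivity)
    rw [div_le_div_iff₀ (by positivity) (by norm_num)]
    have a1 : δ ^ 4 ≤ 1 := pow_le_one₀ hδ.le hδ1.le
    have a2 : (2 : ℝ) ^ 3 ≤ n ^ 3 := pow_le_pow_left₀ (by norm_num) hn 3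
    linarith
  calc 2 * Real.exp (-(m * t ^ 2 / (4 * V))) ≤ 2 * (δ / n ^ 2 * (1 / 8)) := by linarith
    _ = _ := by field_simp; norm_num

/-- The law of `m` independent neurons. -/
noncomputable abbrev neuronsLaw (d m : ℕ) : Measure (Fin m → Weight d × ℝ) :=
  Measure.pi fun _ => neuronLaw d

lemma integral_neuronLaw_fst (f : Weight d → ℝ) :
    ∫ p, f p.1 ∂(neuronLaw d) = ∫ w, f w ∂(stdGaussian (Weight d)) := by
  rw [neuronLaw, integral_fun_fst]
  simp

lemma neuronLaw_fst (S : Set (Weight d)) (hS : MeasurableSet S) :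
    neuronLaw d {p | p.1 ∈ S} = stdGaussian (Weight d) S := by
  have := (measurePreserving_fst (μ := stdGaussian (Weight d))
    (ν := uniformOn ({-1, 1} : Set ℝ))).measure_preimage hS.nullMeasurableSet
  exact this

lemma neuronsLaw_exists_le {P : Weight d × ℝ → Prop} (hP : MeasurableSet {p | P p}) {ε : ℝ}
    (h : neuronLaw d {p | P p} ≤ ENNReal.ofReal ε) :
    neuronsLaw d m {ω | ∃ r, P (ω r)} ≤ ENNReal.ofReal (m * ε) := by
  have := measure_exists_le (neuronsLaw d m) (ι := Fin m) (p := fun r ω => P (ω r)) (ε := ε)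
    fun r => by
      have h1 := (measurePreserving_eval (fun _ : Fin m => neuronLaw d) r).measure_preimage
        hP.nullMeasurableSet
      exact le_of_eq_of_le h1 h
  simpa using this

lemma neuronsLaw_sign_ne : neuronsLaw d m {ω | ∃ r, ¬((ω r).2 = -1 ∨ (ω r).2 = 1)} ≤ 0 := by
  have hms : MeasurableSet {a : ℝ | ¬(a = -1 ∨ a = 1)} := by
    have : {a : ℝ | ¬(a = -1 ∨ a = 1)} = ({-1, 1} : Set ℝ)ᶜ := by ext; simp
    rw [this]
    exact (Set.toFinite _).measurableSet.compl
  have h0 : neuronLaw d {p | ¬(p.2 = -1 ∨ p.2 = 1)} ≤ ENNReal.ofReal 0 := by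
    have h1 := (measurePreserving_snd (μ := stdGaussian (Weight d))
      (ν := uniformOn ({-1, 1} : Set ℝ))).measure_preimage hms.nullMeasurableSet
    have h2 := ae_sign_eq
    rw [ae_iff] at h2
    rw [h2] at h1
    rw [ENNReal.ofReal_zero]
    exact le_of_eq h1
  have := neuronsLaw_exists_le (m := m) (P := fun p : Weight d × ℝ => ¬(p.2 = -1 ∨ p.2 = 1))
    (measurable_snd hms) h0
  simpa using this

/-- The bound `M` on `1 + ‖w_r‖` that holds for all neurons with high probability. -/
noncomputable def radius (d m : ℕ) (δ : ℝ) : ℝ := √(100 * (d * Real.log (m * d / δ)))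

lemma half_le_log {x : ℝ} (hx : 2 ≤ x) : 1 / 2 ≤ Real.log x := by
  have h1 := Real.log_two_gt_d9
  have h2 := Real.log_le_log (by norm_num) hx
  linarith

lemma half_le_log_samples {δ : ℝ} (h₁ : 1 ≤ n₁) (h₂ : 1 ≤ n₂) (hδ : 0 < δ) (hδ1 : δ < 1) :
    1 / 2 ≤ Real.log (((n₁ : ℝ) + n₂) / δ) := by
  have h₁' : (1 : ℝ) ≤ n₁ := by exact_mod_cast h₁
  have h₂' : (1 : ℝ) ≤ n₂ := by exact_mod_cast h₂
  apply half_le_log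
  rw [le_div_iff₀ hδ]
  linarith

lemma two_le_ratio {δ : ℝ} (hd : 1 ≤ d) (hm : 2 ≤ m) (hδ : 0 < δ) (hδ1 : δ < 1) :
    2 ≤ (m * d / δ : ℝ) := by
  have hd' : (1 : ℝ) ≤ d := by exact_mod_cast hd
  have hm' : (2 : ℝ) ≤ m := by exact_mod_cast hm
  rw [le_div_iff₀ hδ]
  nlinarith

lemma radius_sq {δ : ℝ} (hd : 1 ≤ d) (hm : 2 ≤ m) (hδ : 0 < δ) (hδ1 : δ < 1) :
    radius d m δ ^ 2 = 100 * (d * Real.log (m * d / δ)) := by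
  have := half_le_log (two_le_ratio hd hm hδ hδ1)
  exact Real.sq_sqrt (by positivity)

lemma one_le_radius {δ : ℝ} (hd : 1 ≤ d) (hm : 2 ≤ m) (hδ : 0 < δ) (hδ1 : δ < 1) :
    1 ≤ radius d m δ := by
  have := half_le_log (two_le_ratio hd hm hδ hδ1)
  have hd' : (1 : ℝ) ≤ d := by exact_mod_cast hd
  apply Real.le_sqrt_of_sq_le
  nlinarith

lemma stdGaussian_radius_lt_le {δ : ℝ} (hd : 1 ≤ d) (hm : 2 ≤ m) (hδ : 0 < δ) (hδ1 : δ < 1) :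
    stdGaussian (Weight d) {w | radius d m δ < 1 + ‖w‖} ≤ ENNReal.ofReal (δ / (4 * m)) := by
  have hℓ := half_le_log (two_le_ratio hd hm hδ hδ1)
  have hx := two_le_ratio hd hm hδ hδ1
  have hM := radius_sq hd hm hδ hδ1
  have hd' : (1 : ℝ) ≤ d := by exact_mod_cast hd
  have hm' : (2 : ℝ) ≤ m := by exact_mod_cast hm
  set ℓ := Real.log (m * d / δ) with hℓdef
  set u := √(12 * ℓ) with hu
  have hu2 : u ^ 2 = 12 * ℓ := Real.sq_sqrt (by positivity)
  have hsub : {w : Weight d | radius d m δ < 1 + ‖w‖} ⊆ {w | (d + 2 : ℕ) * u ^ 2 < ‖w‖ ^ 2} := by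
    intro w hw
    rw [Set.mem_ofPred_eq] at hw ⊢
    by_contra hcon
    rw [not_lt, hu2] at hcon
    push_cast at hcon
    have h1 := pow_lt_pow_left₀ hw (Real.sqrt_nonneg _) two_ne_zero
    rw [hM] at h1
    have h2 : (1 + ‖w‖) ^ 2 ≤ 2 * (1 + ‖w‖ ^ 2) := by nlinarith [sq_nonneg (1 - ‖w‖)]
    have h3 : ℓ ≤ d * ℓ := le_mul_of_one_le_left (by linarith) hd'
    nlinarith
  refine (measure_mono hsub).trans ((stdGaussian_norm_gt_le (Real.sqrt_nonneg _)).trans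
    (ENNReal.ofReal_le_ofReal ?_))
  -- `u² = 12 log (m d / δ)` makes the Gaussian tail the sixth power of `δ / (m d)`.
  have he : Real.exp (-(u ^ 2 / 2)) = (δ / (m * d)) ^ 6 := by
    rw [hu2, show -(12 * ℓ / 2) = -((6 : ℕ) * ℓ) by push_cast; ring, Real.exp_neg,
      Real.exp_nat_mul, hℓdef, Real.exp_log (by positivity), ← inv_pow, inv_div]
  rw [he]
  push_cast
  set y := (m : ℝ) * d with hy
  have hy2 : 2 ≤ y := by nlinarith
  have h5 : (δ / y) ^ 6 ≤ δ / y * (1 / 2) ^ 5 := by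
    have : (δ / y) ^ 5 ≤ (1 / 2) ^ 5 := by
      refine pow_le_pow_left₀ (by positivity) ?_ 5
      rw [div_le_div_iff₀ (by positivity) (by norm_num)]
      linarith
    calc (δ / y) ^ 6 = δ / y * (δ / y) ^ 5 := by ring
      _ ≤ _ := by gcongr
  have h6 : δ / y * d = δ / m := by rw [hy]; field_simp
  have h7 : 0 < δ / y := by positivity
  calc ((d : ℝ) + 2) * (2 * (δ / y) ^ 6) ≤ (3 * d) * (2 * (δ / y * (1 / 2) ^ 5)) := by
        gcongr; linarith
    _ = 6 / 32 * (δ / y * d) := by ring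
    _ ≤ 1 / 4 * (δ / m) := by
        have : 0 < δ / m := div_pos hδ (by linarith)
        rw [h6]
        linarith
    _ = δ / (4 * m) := by ring

lemma neuronsLaw_radius_lt_le {δ : ℝ} (hd : 1 ≤ d) (hm : 2 ≤ m) (hδ : 0 < δ) (hδ1 : δ < 1) :
    neuronsLaw d m {ω | ∃ r, radius d m δ < 1 + ‖(ω r).1‖} ≤ ENNReal.ofReal (δ / 4) := by
  have hS : MeasurableSet {w : Weight d | radius d m δ < 1 + ‖w‖} :=
    measurableSet_lt measurable_const (by fun_prop)
  have h1 := neuronLaw_fst _ hS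
  have := neuronsLaw_exists_le (m := m) (P := fun p : Weight d × ℝ => radius d m δ < 1 + ‖p.1‖)
    (measurable_fst hS) (le_of_eq_of_le h1 (stdGaussian_radius_lt_le hd hm hδ hδ1))
  refine this.trans (le_of_eq ?_)
  congr 1
  have : (m : ℝ) ≠ 0 := by positivity
  field_simp

section Events

variable {σ : ℝ → ℝ} {g : ℕ} {κ : ℝ → ℝ → ℝ} {A M : ℝ} {D : Data d n₁ n₂}

/-- The entries of the unnormalized Gram matrix of one neuron, set to zero for large weights. -/
noncomputable def truncGram (σ : ℝ → ℝ) (D : Data d n₁ n₂) (M : ℝ) (i j : Fin n₁ ⊕ Fin n₂)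
    (w : Weight d) : ℝ :=
  {w : Weight d | 1 + ‖w‖ ≤ M}.indicator
    (fun w => inner ℝ (rawGrad σ D w i) (rawGrad σ D w j)) w

lemma measurableSet_ball_le (M : ℝ) : MeasurableSet {w : Weight d | 1 + ‖w‖ ≤ M} :=
  measurableSet_le (by fun_prop) measurable_const

lemma measurable_truncGram (h : ActivationBounds σ g κ A) (i j : Fin n₁ ⊕ Fin n₂) :
    Measurable (truncGram σ D M i j) :=
  (measurable_inner_rawGrad h i j).indicator (measurableSet_ball_le M)

lemma abs_truncGram_le (h : ActivationBounds σ g κ A) (hD : ∀ i, ‖D.sample i‖ ≤ 1)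
    (i j : Fin n₁ ⊕ Fin n₂) (w : Weight d) :
    |truncGram σ D M i j w| ≤ (100 * A) ^ 2 * (1 + ‖w‖) ^ 4 := by
  rw [truncGram, Set.indicator_apply]
  split_ifs
  · exact abs_inner_rawGrad_le h hD w i j
  · rw [abs_zero]; positivity

lemma abs_truncGram_le_radius (h : ActivationBounds σ g κ A) (hD : ∀ i, ‖D.sample i‖ ≤ 1)
    (i j : Fin n₁ ⊕ Fin n₂) (w : Weight d) :
    |truncGram σ D M i j w| ≤ (100 * A) ^ 2 * M ^ 4 := by
  rw [truncGram, Set.indicator_apply]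
  split_ifs with hw
  · refine (abs_inner_rawGrad_le h hD w i j).trans ?_
    have hw' : 1 + ‖w‖ ≤ M := hw
    gcongr
  · rw [abs_zero]
    exact mul_nonneg (sq_nonneg _) (by positivity)

/-- Truncation changes the expected Gram matrix by little: on the exceptional set the integrand is
split by the inequality `x y ≤ (τ x² + y² / τ) / 2` into a moment and a small probability. -/
lemma abs_integral_truncGram_sub_le (h : ActivationBounds σ g κ A) (hD : ∀ i, ‖D.sample i‖ ≤ 1)
    {C₈ lam p : ℝ} (hC₈ : 0 < C₈) (hd : 1 ≤ d)
    (h8 : ∫ w : Weight d, (1 + ‖w‖) ^ 8 ∂(stdGaussian (Weight d)) ≤ C₈ * (d : ℝ) ^ 4)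
    (hlam : 0 < lam) (hp : 0 ≤ p)
    (hM : stdGaussian (Weight d) {w | M < 1 + ‖w‖} ≤ ENNReal.ofReal p)
    (hpl : 256 * ((100 * A) ^ 4 * C₈ * (d : ℝ) ^ 4) * p ≤ lam ^ 2) (i j : Fin n₁ ⊕ Fin n₂) :
    |∫ w, truncGram σ D M i j w ∂(stdGaussian (Weight d))
      - ∫ w, inner ℝ (rawGrad σ D w i) (rawGrad σ D w j) ∂(stdGaussian (Weight d))| ≤ lam / 16 := by
  have hA := h.pos
  have hd0 : (0 : ℝ) < d := by exact_mod_cast hd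
  set W := (100 * A) ^ 4 * C₈ * (d : ℝ) ^ 4 with hW
  have hW0 : 0 < W := by positivity
  set S : Set (Weight d) := {w | M < 1 + ‖w‖} with hS
  have hSm : MeasurableSet S := measurableSet_lt measurable_const (by fun_prop)
  have hti : Integrable (truncGram σ D M i j) (stdGaussian (Weight d)) :=
    (integrable_inner_rawGrad h hD i j).indicator (measurableSet_ball_le M)
  rw [← integral_sub hti (integrable_inner_rawGrad h hD i j)]
  set τ := lam / (16 * W) with hτ
  have hτ0 : 0 < τ := by positivity
  have hpt : ∀ w : Weight d, ‖truncGram σ D M i j w - inner ℝ (rawGrad σ D w i) (rawGrad σ D w j)‖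
      ≤ τ / 2 * ((100 * A) ^ 4 * (1 + ‖w‖) ^ 8) + 1 / (2 * τ) * S.indicator (fun _ => 1) w := by
    intro w
    rw [truncGram, Set.indicator_apply, Set.indicator_apply, Real.norm_eq_abs]
    by_cases hw : w ∈ S
    · have hw1 : M < 1 + ‖w‖ := hw
      have hw' : ¬ w ∈ {w : Weight d | 1 + ‖w‖ ≤ M} := fun hc =>
        absurd (show 1 + ‖w‖ ≤ M from hc) (not_le.2 hw1)
      rw [if_neg hw', if_pos hw, zero_sub, abs_neg, mul_one]
      refine (abs_inner_rawGrad_le h hD w i j).trans ?_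
      set x := (100 * A) ^ 2 * (1 + ‖w‖) ^ 4
      have e : (100 * A) ^ 4 * (1 + ‖w‖) ^ 8 = x ^ 2 := by ring
      rw [e]
      have : τ / 2 * x ^ 2 + 1 / (2 * τ) - x = (τ * x - 1) ^ 2 / (2 * τ) := by field_simp; ring
      have : 0 ≤ (τ * x - 1) ^ 2 / (2 * τ) := by positivity
      linarith
    · have hw1 : 1 + ‖w‖ ≤ M := not_lt.1 fun hc => hw hc
      have hw' : w ∈ {w : Weight d | 1 + ‖w‖ ≤ M} := hw1
      rw [if_pos hw', if_neg hw, sub_self, abs_zero]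
      positivity
  have hi1 : Integrable (fun w : Weight d => τ / 2 * ((100 * A) ^ 4 * (1 + ‖w‖) ^ 8))
      (stdGaussian (Weight d)) := ((integrable_one_add_norm_pow (d + 2) 8).const_mul _).const_mul _
  have hi2 : Integrable (fun w : Weight d => 1 / (2 * τ) * S.indicator (fun _ => (1 : ℝ)) w)
      (stdGaussian (Weight d)) := ((integrable_const _).indicator hSm).const_mul _
  have hSp : (stdGaussian (Weight d)).real S ≤ p := by
    rw [measureReal_def]
    exact ENNReal.toReal_le_of_le_ofReal hp hM
  have hi : Integrable (fun w : Weight d => τ / 2 * ((100 * A) ^ 4 * (1 + ‖w‖) ^ 8)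
      + 1 / (2 * τ) * S.indicator (fun _ => (1 : ℝ)) w) (stdGaussian (Weight d)) := hi1.add hi2
  refine (norm_integral_le_of_norm_le hi (ae_of_all _ hpt)).trans ?_
  rw [integral_add hi1 hi2, integral_const_mul, integral_const_mul, integral_const_mul,
    integral_indicator_const _ hSm, smul_eq_mul, mul_one]
  have a1 : (100 * A) ^ 4 * ∫ w : Weight d, (1 + ‖w‖) ^ 8 ∂(stdGaussian (Weight d)) ≤ W := by
    rw [hW, mul_assoc]; gcongr
  calc _ ≤ τ / 2 * W + 1 / (2 * τ) * p := by gcongr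
    _ = lam / 32 + 8 * W * p / lam := by rw [hτ]; field_simp; ring
    _ ≤ lam / 32 + lam / 32 := by
        have : 8 * W * p / lam ≤ lam / 32 := by
          rw [div_le_iff₀ hlam]
          nlinarith
        linarith
    _ = lam / 16 := by ring

lemma card_samples : ((Fintype.card (Fin n₁ ⊕ Fin n₂) : ℕ) : ℝ) = n₁ + n₂ := by simp

/-- Concentration of the entries of the truncated Gram matrix. -/
lemma neuronsLaw_gram_le (h : ActivationBounds σ g κ A) (hD : ∀ i, ‖D.sample i‖ ≤ 1)
    {C₈ lam δ l : ℝ} (hC₈ : 0 < C₈) (hd : 1 ≤ d) (hm : 0 < m) (h₁ : 1 ≤ n₁) (h₂ : 1 ≤ n₂)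
    (h8 : ∫ w : Weight d, (1 + ‖w‖) ^ 8 ∂(stdGaussian (Weight d)) ≤ C₈ * (d : ℝ) ^ 4)
    (hlam : 0 < lam) (hδ : 0 < δ) (hδ1 : δ < 1) (hl : l = Real.log ((n₁ + n₂) / δ))
    (hmb : 20 * ((100 * A) ^ 4 * C₈ * (d : ℝ) ^ 4 + lam / 16 * ((100 * A) ^ 2 * M ^ 4)) * l
      ≤ m * (lam / 16) ^ 2) :
    neuronsLaw d m {ω | ∃ ij : (Fin n₁ ⊕ Fin n₂) × (Fin n₁ ⊕ Fin n₂), lam / 16 ≤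
      |(∑ r, truncGram σ D M ij.1 ij.2 (ω r).1) / m
        - ∫ w, truncGram σ D M ij.1 ij.2 w ∂(stdGaussian (Weight d))|} ≤ ENNReal.ofReal (δ / 4) := by
  have hA := h.pos
  have hd0 : (0 : ℝ) < d := by exact_mod_cast hd
  set V := (100 * A) ^ 4 * C₈ * (d : ℝ) ^ 4 + lam / 16 * ((100 * A) ^ 2 * M ^ 4) with hV
  have hB : 0 ≤ lam / 16 * ((100 * A) ^ 2 * M ^ 4) :=
    mul_nonneg (by positivity) (mul_nonneg (sq_nonneg _) (by positivity))
  have hW : 0 < (100 * A) ^ 4 * C₈ * (d : ℝ) ^ 4 := by positivity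
  have hV0 : 0 < V := by rw [hV]; linarith
  have hn : (2 : ℝ) ≤ n₁ + n₂ := by
    have : (1 : ℝ) ≤ n₁ := by exact_mod_cast h₁
    have : (1 : ℝ) ≤ n₂ := by exact_mod_cast h₂
    linarith
  have hone : ∀ ij : (Fin n₁ ⊕ Fin n₂) × (Fin n₁ ⊕ Fin n₂), neuronsLaw d m {ω | lam / 16 ≤
      |(∑ r, truncGram σ D M ij.1 ij.2 (ω r).1) / m
        - ∫ w, truncGram σ D M ij.1 ij.2 w ∂(stdGaussian (Weight d))|}
      ≤ ENNReal.ofReal (δ / (4 * ((n₁ : ℝ) + n₂) ^ 2)) := by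
    intro ij
    have hsq : ∫ p, truncGram σ D M ij.1 ij.2 p.1 ^ 2 ∂(neuronLaw d) ≤ V := by
      rw [integral_neuronLaw_fst (fun w => truncGram σ D M ij.1 ij.2 w ^ 2)]
      have hpt : ∀ w : Weight d, truncGram σ D M ij.1 ij.2 w ^ 2
          ≤ (100 * A) ^ 4 * (1 + ‖w‖) ^ 8 := fun w => by
        rw [← sq_abs]
        refine (pow_le_pow_left₀ (abs_nonneg _) (abs_truncGram_le h hD _ _ w) 2).trans (le_of_eq ?_)
        ring
      refine (integral_mono_of_nonneg (ae_of_all _ fun w => sq_nonneg _)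
        ((integrable_one_add_norm_pow (d + 2) 8).const_mul ((100 * A) ^ 4))
        (ae_of_all _ hpt)).trans ?_
      rw [integral_const_mul]
      have : (100 * A) ^ 4 * ∫ w : Weight d, (1 + ‖w‖) ^ 8 ∂(stdGaussian (Weight d))
          ≤ (100 * A) ^ 4 * (C₈ * (d : ℝ) ^ 4) := by gcongr
      rw [hV]
      linarith
    have hb := bernstein_mean (neuronLaw d) hm
      (Y := fun p => truncGram σ D M ij.1 ij.2 p.1)
      ((measurable_truncGram h ij.1 ij.2).comp measurable_fst)
      (B := (100 * A) ^ 2 * M ^ 4) (fun p => abs_truncGram_le_radius h hD _ _ p.1)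
      hsq hV0 (by positivity : 0 < lam / 16) (by rw [hV]; linarith)
    rw [integral_neuronLaw_fst] at hb
    exact hb.trans (ENNReal.ofReal_le_ofReal (bernstein_tail_le hV0 hn hδ hδ1 hl hmb))
  refine (measure_exists_le _ hone).trans (ENNReal.ofReal_le_ofReal (le_of_eq ?_))
  rw [Fintype.card_prod, Nat.cast_mul, card_samples]
  have : (n₁ : ℝ) + n₂ ≠ 0 := by positivity
  field_simp

/-- The signed contribution of one neuron to the output, set to zero for large weights. The sign is
truncated as well, so that the variable is bounded everywhere. -/
noncomputable def truncVal (σ : ℝ → ℝ) (D : Data d n₁ n₂) (M : ℝ) (i : Fin n₁ ⊕ Fin n₂)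
    (p : Weight d × ℝ) : ℝ :=
  {w : Weight d | 1 + ‖w‖ ≤ M}.indicator (fun w => neuronVal σ D w i) p.1
    * {a : ℝ | |a| ≤ 1}.indicator id p.2

lemma abs_indicator_sign_le (a : ℝ) : |{a : ℝ | |a| ≤ 1}.indicator id a| ≤ 1 := by
  rw [Set.indicator_apply]
  split_ifs with ha
  · exact ha
  · simp

lemma integral_truncVal (i : Fin n₁ ⊕ Fin n₂) : ∫ p, truncVal σ D M i p ∂(neuronLaw d) = 0 := by
  unfold truncVal neuronLaw
  rw [integral_prod_mul (f := fun w : Weight d =>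
    {w : Weight d | 1 + ‖w‖ ≤ M}.indicator (fun w => neuronVal σ D w i) w)]
  have : ∫ a, {a : ℝ | |a| ≤ 1}.indicator id a ∂(uniformOn ({-1, 1} : Set ℝ)) = 0 := by
    rw [← integral_sign]
    refine integral_congr_ae ?_
    filter_upwards [ae_sign_eq] with a ha
    have : |a| ≤ 1 := by rcases ha with rfl | rfl <;> simp
    rw [Set.indicator_of_mem (s := {a : ℝ | |a| ≤ 1}) this]
    rfl
  rw [this, mul_zero]

/-- Concentration of the network values (and their images under the heat operator) at the
initialization. The variance is bounded by a moment instead of a power of `M`, which keeps the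
logarithm in `M` out of the bound `ρ`. -/
lemma neuronsLaw_val_le (h : ActivationBounds σ g κ A) (hD : ∀ i, ‖D.sample i‖ ≤ 1)
    {Cg δ l ρ : ℝ} (hCg : 0 < Cg) (hd : 1 ≤ d) (hm : 0 < m) (h₁ : 1 ≤ n₁) (h₂ : 1 ≤ n₂)
    (hg : ∫ w : Weight d, (1 + ‖w‖) ^ (2 * (g + 2)) ∂(stdGaussian (Weight d))
      ≤ Cg * (d : ℝ) ^ (g + 2)) (hM : 0 ≤ M)
    (hδ : 0 < δ) (hδ1 : δ < 1) (hl : l = Real.log ((n₁ + n₂) / δ))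
    (hρ : 0 < ρ) (hρ2 : ρ ^ 2 = 20 * ((100 * A) ^ 2 * Cg * (d : ℝ) ^ (g + 2)) * l)
    (hmb : 20 * M ^ (2 * (g + 2)) * l ≤ Cg * (d : ℝ) ^ (g + 2) * m) :
    neuronsLaw d m {ω | ∃ i : Fin n₁ ⊕ Fin n₂, ρ / √m ≤
      |(∑ r, truncVal σ D M i (ω r)) / m|} ≤ ENNReal.ofReal (δ / 4) := by
  have hA := h.pos
  have hd0 : (0 : ℝ) < d := by exact_mod_cast hd
  have hm0 : (0 : ℝ) < m := by exact_mod_cast hm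
  have hsm : 0 < √(m : ℝ) := Real.sqrt_pos.2 hm0
  have hsm2 : √(m : ℝ) ^ 2 = m := Real.sq_sqrt hm0.le
  set V := (100 * A) ^ 2 * Cg * (d : ℝ) ^ (g + 2) with hV
  have hV0 : 0 < V := by positivity
  have hn : (2 : ℝ) ≤ n₁ + n₂ := by
    have : (1 : ℝ) ≤ n₁ := by exact_mod_cast h₁
    have : (1 : ℝ) ≤ n₂ := by exact_mod_cast h₂
    linarith
  have hone : ∀ i : Fin n₁ ⊕ Fin n₂, neuronsLaw d m {ω | ρ / √m ≤
      |(∑ r, truncVal σ D M i (ω r)) / m|}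
      ≤ ENNReal.ofReal (δ / (4 * ((n₁ : ℝ) + n₂) ^ 2)) := by
    intro i
    have hmeas : Measurable (truncVal σ D M i) := by
      refine Measurable.mul (((measurable_neuronVal h D i).indicator
        (measurableSet_ball_le M)).comp measurable_fst) ((measurable_id.indicator ?_).comp
          measurable_snd)
      exact measurableSet_le (by fun_prop) measurable_const
    have hbd : ∀ p, |truncVal σ D M i p| ≤ 100 * A * M ^ (g + 2) := fun p => by
      rw [truncVal]
      refine (abs_mul_le_mul (α := 100 * A * M ^ (g + 2)) ?_ (abs_indicator_sign_le p.2)).trans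
        (mul_one _).le
      rw [Set.indicator_apply]
      split_ifs with hw
      · have hw' : 1 + ‖p.1‖ ≤ M := hw
        refine (abs_neuronVal_le h D hD p.1 i).trans ?_
        gcongr
      · rw [abs_zero]; positivity
    have hsq : ∫ p, truncVal σ D M i p ^ 2 ∂(neuronLaw d) ≤ V := by
      have hpt : ∀ p : Weight d × ℝ, truncVal σ D M i p ^ 2
          ≤ (100 * A) ^ 2 * (1 + ‖p.1‖) ^ (2 * (g + 2)) := fun p => by
        have : |truncVal σ D M i p| ≤ 100 * A * (1 + ‖p.1‖) ^ (g + 2) := by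
          rw [truncVal]
          refine (abs_mul_le_mul (α := 100 * A * (1 + ‖p.1‖) ^ (g + 2)) ?_
            (abs_indicator_sign_le p.2)).trans (mul_one _).le
          rw [Set.indicator_apply]
          split_ifs
          · exact abs_neuronVal_le h D hD p.1 i
          · rw [abs_zero]; positivity
        rw [← sq_abs]
        refine (pow_le_pow_left₀ (abs_nonneg _) this 2).trans (le_of_eq ?_)
        ring
      have hint : Integrable (fun p : Weight d × ℝ =>
          (100 * A) ^ 2 * (1 + ‖p.1‖) ^ (2 * (g + 2))) (neuronLaw d) := by
        refine Integrable.const_mul ?_ _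
        exact (integrable_one_add_norm_pow (d + 2) (2 * (g + 2))).comp_fst _
      refine (integral_mono_of_nonneg (ae_of_all _ fun p => sq_nonneg _) hint
        (ae_of_all _ hpt)).trans ?_
      rw [integral_const_mul,
        integral_neuronLaw_fst (fun w : Weight d => (1 + ‖w‖) ^ (2 * (g + 2))), hV, mul_assoc]
      gcongr
    have hmt : (m : ℝ) * (ρ / √m) ^ 2 = ρ ^ 2 := by
      rw [div_pow, hsm2]; field_simp
    have htB : ρ / √m * (100 * A * M ^ (g + 2)) ≤ V := by
      have : (ρ / √m * (100 * A * M ^ (g + 2))) ^ 2 ≤ V ^ 2 := by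
        have e : (ρ / √m * (100 * A * M ^ (g + 2))) ^ 2
            = (100 * A) ^ 2 * V * (20 * M ^ (2 * (g + 2)) * l) / m := by
          rw [mul_pow, div_pow, hsm2, hρ2]
          ring
        rw [e, div_le_iff₀ hm0]
        calc (100 * A) ^ 2 * V * (20 * M ^ (2 * (g + 2)) * l)
            ≤ (100 * A) ^ 2 * V * (Cg * (d : ℝ) ^ (g + 2) * m) := by gcongr
          _ = V ^ 2 * m := by rw [hV]; ring
      exact (abs_le_of_sq_le_sq' this hV0.le).2
    have hb := bernstein_mean (neuronLaw d) hm hmeas hbd hsq hV0 (by positivity : 0 < ρ / √(m : ℝ))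
      htB
    simp only [integral_truncVal, sub_zero] at hb
    exact hb.trans (ENNReal.ofReal_le_ofReal (bernstein_tail_le hV0 hn hδ hδ1 hl
      (by rw [hmt, hρ2])))
  refine (measure_exists_le _ hone).trans (ENNReal.ofReal_le_ofReal ?_)
  rw [card_samples]
  set n := (n₁ : ℝ) + n₂
  have : n * (δ / (4 * n ^ 2)) = δ / 4 * (1 / n) := by field_simp
  rw [this]
  refine mul_le_of_le_one_right (by positivity) ?_
  rw [div_le_one (by positivity)]
  linarith

/-- Few neurons have their activation close to zero at a given sample. -/
lemma neuronsLaw_flip_le (D : Data d n₁ n₂) {δ l s : ℝ} (hm : 0 < m) (h₁ : 1 ≤ n₁) (h₂ : 1 ≤ n₂)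
    (hδ : 0 < δ) (hδ1 : δ < 1) (hl : l = Real.log ((n₁ + n₂) / δ)) (hs : 0 < s)
    (hmb : 20 * l ≤ m * s) :
    neuronsLaw d m {ω | ∃ i : Fin n₁ ⊕ Fin n₂, m * (2 * s) <
      ∑ r, {w : Weight d | |inner ℝ w (aug (D.sample i))| ≤ s}.indicator (fun _ => (1 : ℝ)) (ω r).1}
      ≤ ENNReal.ofReal (δ / 4) := by
  have hm0 : (0 : ℝ) < m := by exact_mod_cast hm
  have hn : (2 : ℝ) ≤ n₁ + n₂ := by
    have : (1 : ℝ) ≤ n₁ := by exact_mod_cast h₁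
    have : (1 : ℝ) ≤ n₂ := by exact_mod_cast h₂
    linarith
  have hone : ∀ i : Fin n₁ ⊕ Fin n₂, neuronsLaw d m {ω | m * (2 * s) <
      ∑ r, {w : Weight d | |inner ℝ w (aug (D.sample i))| ≤ s}.indicator
        (fun _ => (1 : ℝ)) (ω r).1}
      ≤ ENNReal.ofReal (δ / (4 * ((n₁ : ℝ) + n₂) ^ 2)) := by
    intro i
    set S : Set (Weight d) := {w | |inner ℝ w (aug (D.sample i))| ≤ s} with hS
    have hSm : MeasurableSet S := measurableSet_le (by fun_prop) measurable_const
    have hSs : (stdGaussian (Weight d)).real S ≤ s := by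
      rw [measureReal_def]
      exact ENNReal.toReal_le_of_le_ofReal hs.le
        (stdGaussian_abs_inner_le (one_le_norm_aug (D.sample i)) s)
    have hmean : ∫ p, S.indicator (fun _ => (1 : ℝ)) p.1 ∂(neuronLaw d)
        = (stdGaussian (Weight d)).real S := by
      rw [integral_neuronLaw_fst (S.indicator fun _ => (1 : ℝ)), integral_indicator_const _ hSm]
      simp
    have hsq : ∀ w, S.indicator (fun _ => (1 : ℝ)) w ^ 2 = S.indicator (fun _ => (1 : ℝ)) w := by
      intro w
      rw [Set.indicator_apply]
      split_ifs <;> norm_num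
    have hb := bernstein_mean (neuronLaw d) hm (Y := fun p => S.indicator (fun _ => (1 : ℝ)) p.1)
      ((measurable_const.indicator hSm).comp measurable_fst) (B := 1) (V := s) (t := s)
      (fun p => by rw [Set.indicator_apply]; split_ifs <;> norm_num)
      (by simp only [hsq]; rw [hmean]; exact hSs) hs hs (by linarith)
    rw [hmean] at hb
    refine le_trans (measure_mono fun ω hω => ?_) (hb.trans (ENNReal.ofReal_le_ofReal
      (bernstein_tail_le hs hn hδ hδ1 hl (by nlinarith))))
    rw [Set.mem_ofPred_eq] at hω ⊢
    have h1 : 2 * s < (∑ r, S.indicator (fun _ => (1 : ℝ)) (ω r).1) / m := by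
      rw [lt_div_iff₀ hm0, mul_comm]; exact hω
    refine le_trans ?_ (le_abs_self _)
    linarith
  refine (measure_exists_le _ hone).trans (ENNReal.ofReal_le_ofReal ?_)
  rw [card_samples]
  set n := (n₁ : ℝ) + n₂
  have : n * (δ / (4 * n ^ 2)) = δ / 4 * (1 / n) := by field_simp
  rw [this]
  refine mul_le_of_le_one_right (by positivity) ?_
  rw [div_le_one (by positivity)]
  linarith

end Events

/-! ### From a good initialization to convergence -/

section GoodInit

variable {σ : ℝ → ℝ} {g : ℕ} {κ : ℝ → ℝ → ℝ} {A M : ℝ} {D : Data d n₁ n₂}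
  {w₀ : Fin m → Weight d} {a : Fin m → ℝ}

lemma sq_sum_abs_mul_normFactor_le (h₁ : 1 ≤ n₁) (h₂ : 1 ≤ n₂) (v : Fin n₁ ⊕ Fin n₂ → ℝ) :
    (∑ i, |v i| * normFactor n₁ n₂ i) ^ 2 ≤ 2 * l2 v ^ 2 := by
  refine (Finset.sum_mul_sq_le_sq_mul_sq _ _ _).trans (le_of_eq ?_)
  rw [sum_normFactor_sq h₁ h₂, l2_sq, mul_comm]
  simp only [sq_abs]

/-- If the empirical averages of the entries of the Gram matrix are close to their means, then the
transposed Jacobian is bounded below by `√(λ₀ / 2)`. -/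
lemma le_l2_transpose_mulVec (h₁ : 1 ≤ n₁) (h₂ : 1 ≤ n₂) (hlam : 0 < lambda₀ σ D)
    (ha : ∀ r, a r = -1 ∨ a r = 1)
    (hG : ∀ i j, |(∑ r, inner ℝ (rawGrad σ D (w₀ r) i) (rawGrad σ D (w₀ r) j)) / m
      - ∫ w, inner ℝ (rawGrad σ D w i) (rawGrad σ D w j) ∂(stdGaussian (Weight d))|
        ≤ lambda₀ σ D / 8) (v : Fin n₁ ⊕ Fin n₂ → ℝ) :
    √(lambda₀ σ D / 2) * l2 v ≤ l2 ((jacobian σ D a w₀)ᵀ *ᵥ v) := by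
  have ha2 : ∀ r, a r ^ 2 = 1 := fun r => by rcases ha r with e | e <;> rw [e] <;> norm_num
  have hentry : ∀ i j, |v i * (gram σ D a w₀ i j - gramInf σ D i j) * v j|
      ≤ lambda₀ σ D / 8 * ((|v i| * normFactor n₁ n₂ i) * (|v j| * normFactor n₁ n₂ j)) := by
    intro i j
    have hij := normFactor_nonneg (n₁ := n₁) (n₂ := n₂) i
    have hj := normFactor_nonneg (n₁ := n₁) (n₂ := n₂) j
    rw [gram_apply, gramInf_apply]
    simp only [ha2, one_mul]
    rw [← mul_sub, abs_mul, abs_mul, abs_mul, abs_mul, abs_of_nonneg hij, abs_of_nonneg hj]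
    calc _ ≤ |v i| * (normFactor n₁ n₂ i * normFactor n₁ n₂ j * (lambda₀ σ D / 8)) * |v j| := by
          gcongr
          exact hG i j
      _ = _ := by ring
  have hdiff : |v ⬝ᵥ (gram σ D a w₀ *ᵥ v) - v ⬝ᵥ (gramInf σ D *ᵥ v)|
      ≤ lambda₀ σ D / 8 * (2 * l2 v ^ 2) := by
    have e : v ⬝ᵥ (gram σ D a w₀ *ᵥ v) - v ⬝ᵥ (gramInf σ D *ᵥ v)
        = ∑ i, ∑ j, v i * (gram σ D a w₀ i j - gramInf σ D i j) * v j := by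
      simp only [dotProduct, mulVec, Finset.mul_sum]
      rw [← Finset.sum_sub_distrib]
      refine Finset.sum_congr rfl fun i _ => ?_
      rw [← Finset.sum_sub_distrib]
      refine Finset.sum_congr rfl fun j _ => ?_
      ring
    rw [e]
    refine (Finset.abs_sum_le_sum_abs _ _).trans ((Finset.sum_le_sum fun i _ =>
      (Finset.abs_sum_le_sum_abs _ _).trans (Finset.sum_le_sum fun j _ => hentry i j)).trans ?_)
    simp only [← Finset.mul_sum]
    rw [← Finset.sum_mul, ← sq]
    exact mul_le_mul_of_nonneg_left (sq_sum_abs_mul_normFactor_le h₁ h₂ v) (by positivity)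
  have hR := lambda₀_mul_le (σ := σ) (D := D) v h₁
  have hv := sq_nonneg (l2 v)
  refine (abs_le_of_sq_le_sq' ?_ (l2_nonneg _)).2
  have hq : l2 ((jacobian σ D a w₀)ᵀ *ᵥ v) ^ 2 = v ⬝ᵥ (gram σ D a w₀ *ᵥ v) :=
    l2_transpose_mulVec_sq _ v
  rw [hq, mul_pow, Real.sq_sqrt (by positivity)]
  have := (abs_le.1 hdiff).1
  have : 0 ≤ lambda₀ σ D * l2 v ^ 2 := by positivity
  linarith

lemma l2_residual_le (hσ : ContDiff ℝ 2 σ) (h₁ : 1 ≤ n₁) (h₂ : 1 ≤ n₂) (hm : 0 < m) {ρ K : ℝ}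
    (hρ : 0 ≤ ρ) (hK : ∀ i, |D.target i| ≤ K)
    (hv : ∀ i, |(∑ r, a r * neuronVal σ D (w₀ r) i) / m| ≤ ρ / √m) :
    l2 (residual σ D a w₀) ≤ 2 * (ρ + K) := by
  have hm0 : (0 : ℝ) < m := by exact_mod_cast hm
  have hsm : 0 < √(m : ℝ) := Real.sqrt_pos.2 hm0
  have hsm2 : √(m : ℝ) * √(m : ℝ) = m := Real.mul_self_sqrt hm0.le
  have hK0 : 0 ≤ K := (abs_nonneg _).trans (hK (Sum.inl ⟨0, h₁⟩))
  refine l2_le_of_sq_le (by positivity) ?_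
  have hi : ∀ i, residual σ D a w₀ i ^ 2 ≤ normFactor n₁ n₂ i ^ 2 * (ρ + K) ^ 2 := by
    intro i
    rw [residual_eq hσ, mul_pow]
    refine mul_le_mul_of_nonneg_left ?_ (sq_nonneg _)
    rw [← sq_abs]
    refine pow_le_pow_left₀ (abs_nonneg _) ((abs_sub _ _).trans (add_le_add ?_ (hK i))) 2
    have := hv i
    rw [abs_div, abs_of_pos hm0, div_le_div_iff₀ hm0 hsm] at this
    have := le_of_mul_le_mul_right (this.trans_eq (by rw [mul_assoc, hsm2] :
      ρ * (m : ℝ) = ρ * √m * √m)) hsm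
    rw [abs_mul, abs_of_pos (by positivity), one_div, inv_mul_le_iff₀ hsm]
    linarith
  refine (Finset.sum_le_sum fun i _ => hi i).trans ?_
  rw [← Finset.sum_mul, sum_normFactor_sq h₁ h₂]
  nlinarith [sq_nonneg (ρ + K)]

/-- Weights that move by at most one remain in the ball where the bounds of the activation hold. -/
lemma locallyRegular_of_bounds (h : ActivationBounds σ g κ A) (hD : ∀ i, ‖D.sample i‖ ≤ 1)
    (hM : 1 ≤ M) (hw₀ : ∀ r, 1 + ‖w₀ r‖ ≤ M) {R Rg φ : ℝ} (hR : R ≤ 1)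
    {F : Fin n₁ ⊕ Fin n₂ → Weight d → ℝ} (hF : ∀ i w, F i w = 0 ∨ F i w = 1)
    (hκ : ∀ i u w w', ‖w - u‖ ≤ R → ‖w' - u‖ ≤ R →
      κ (inner ℝ w (aug (D.sample i))) (inner ℝ w' (aug (D.sample i))) ≤ F i u)
    (hsum : ∀ i, ∑ r, F i (w₀ r) ≤ m * φ) :
    LocallyRegular σ D w₀ (100 * A * M ^ 2) R Rg φ (fun i r => F i (w₀ r)) := by
  have hA := h.pos
  have hb : 0 < 100 * A * M ^ 2 := by positivity
  have hw : ∀ w : Fin m → Weight d, Region w₀ R Rg w → ∀ r, ‖w r‖ ≤ 2 * M := fun w hw r => by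
    have e : w r = (w r - w₀ r) + w₀ r := by abel
    have h1 := norm_add_le (w r - w₀ r) (w₀ r)
    rw [← e] at h1
    linarith [hw.1 r, hw₀ r]
  have hw' : ∀ r, ‖w₀ r‖ ≤ 2 * M := fun r => by linarith [hw₀ r]
  refine ⟨h.contDiff, hb, fun i r => hF i _, hsum, fun w hr i r =>
    norm_rawGrad_le h D hD hM (hw w hr r) i, fun w hr i r => ?_, fun w w' hr hr' i r => ?_⟩
  · refine (norm_rawGrad_sub_le h D hD hM (hw' r) (hw w hr r) i).trans ?_
    have h0 : ‖w₀ r - w₀ r‖ ≤ R := by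
      rw [sub_self, norm_zero]
      exact (norm_nonneg _).trans (hr.1 r)
    have := hκ i (w₀ r) (w₀ r) (w r) h0 (hr.1 r)
    gcongr
  · refine (abs_neuronVal_taylor_le h D hD hM (hw w hr r) (hw w' hr' r) i).trans ?_
    have := hκ i (w₀ r) (w r) (w' r) (hr.1 r) (hr'.1 r)
    gcongr

end GoodInit

/-- Convergence with high probability, under numerical conditions on the width. The bound on the
jumps of `σ'''` is abstract: `F i u` indicates that near the weight `u` a jump can occur at the
sample `i`, and `φ` bounds the fraction of such neurons. -/
theorem convergesWithProb_of_bounds {σ : ℝ → ℝ} {g : ℕ} {κ : ℝ → ℝ → ℝ} {A : ℝ}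
    {D : Data d n₁ n₂} (h : ActivationBounds σ g κ A) (hD : ∀ i, ‖D.sample i‖ ≤ 1)
    (hlam : 0 < lambda₀ σ D) (hd : 1 ≤ d) (h₁ : 1 ≤ n₁) (h₂ : 1 ≤ n₂) (hm : 2 ≤ m)
    {η δ l K C₈ Cg ρ₀ ρ R φ : ℝ} (hη : 0 < η) (hη1 : η < 1) (hδ : 0 < δ) (hδ1 : δ < 1)
    (hl : l = Real.log ((n₁ + n₂) / δ)) (hK : ∀ i, |D.target i| ≤ K)
    (hC₈ : 0 < C₈)
    (h8 : ∫ w : Weight d, (1 + ‖w‖) ^ 8 ∂(stdGaussian (Weight d)) ≤ C₈ * (d : ℝ) ^ 4)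
    (hCg : 0 < Cg)
    (hg : ∫ w : Weight d, (1 + ‖w‖) ^ (2 * (g + 2)) ∂(stdGaussian (Weight d))
      ≤ Cg * (d : ℝ) ^ (g + 2))
    {F : Fin n₁ ⊕ Fin n₂ → Weight d → ℝ} (hF : ∀ i w, F i w = 0 ∨ F i w = 1)
    (hκ : ∀ i u w w', ‖w - u‖ ≤ R → ‖w' - u‖ ≤ R →
      κ (inner ℝ w (aug (D.sample i))) (inner ℝ w' (aug (D.sample i))) ≤ F i u)
    (hφ : 0 ≤ φ)
    (hflip : neuronsLaw d m {ω | ∃ i, m * φ < ∑ r, F i (ω r).1} ≤ ENNReal.ofReal (δ / 4))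
    (hbias : 256 * ((100 * A) ^ 4 * C₈ * (d : ℝ) ^ 4) * (δ / (4 * m)) ≤ lambda₀ σ D ^ 2)
    (hgram : 20 * ((100 * A) ^ 4 * C₈ * (d : ℝ) ^ 4
      + lambda₀ σ D / 16 * ((100 * A) ^ 2 * radius d m δ ^ 4)) * l ≤ m * (lambda₀ σ D / 16) ^ 2)
    (hρ₀ : 0 < ρ₀) (hρ₀2 : ρ₀ ^ 2 = 20 * ((100 * A) ^ 2 * Cg * (d : ℝ) ^ (g + 2)) * l)
    (hval : 20 * radius d m δ ^ (2 * (g + 2)) * l ≤ Cg * (d : ℝ) ^ (g + 2) * m)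
    (hρ : 2 * (ρ₀ + K) ≤ ρ) (hR1 : R ≤ 1)
    (hR : 12 * (100 * A * radius d m δ ^ 2) * ρ / (√m * (lambda₀ σ D / 2)) ≤ R)
    (hsmall : 100 * A * radius d m δ ^ 2 * (4 * ρ / √(lambda₀ σ D / 2) / √m + √φ)
      ≤ √(1 - η) * √(lambda₀ σ D / 2) / 12) :
    ConvergesWithProb σ D m η δ := by
  have hm0 : 0 < m := by omega
  have hM := one_le_radius hd hm hδ hδ1
  set M := radius d m δ with hMdef
  -- The exceptional events: a sign, a large weight, the Gram matrix, the network, the jumps.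
  let B₀ : Set (Fin m → Weight d × ℝ) := {ω | ∃ r, ¬((ω r).2 = -1 ∨ (ω r).2 = 1)}
  let B₁ : Set (Fin m → Weight d × ℝ) := {ω | ∃ r, M < 1 + ‖(ω r).1‖}
  let B₂ : Set (Fin m → Weight d × ℝ) :=
    {ω | ∃ ij : (Fin n₁ ⊕ Fin n₂) × (Fin n₁ ⊕ Fin n₂), lambda₀ σ D / 16 ≤
      |(∑ r, truncGram σ D M ij.1 ij.2 (ω r).1) / m
        - ∫ w, truncGram σ D M ij.1 ij.2 w ∂(stdGaussian (Weight d))|}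
  let B₃ : Set (Fin m → Weight d × ℝ) := {ω | ∃ i : Fin n₁ ⊕ Fin n₂, ρ₀ / √m ≤
      |(∑ r, truncVal σ D M i (ω r)) / m|}
  let B₄ : Set (Fin m → Weight d × ℝ) := {ω | ∃ i, m * φ < ∑ r, F i (ω r).1}
  have e₀ : neuronsLaw d m B₀ ≤ 0 := neuronsLaw_sign_ne
  have e₁ : neuronsLaw d m B₁ ≤ ENNReal.ofReal (δ / 4) := neuronsLaw_radius_lt_le hd hm hδ hδ1
  have e₂ : neuronsLaw d m B₂ ≤ ENNReal.ofReal (δ / 4) :=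
    neuronsLaw_gram_le h hD hC₈ hd hm0 h₁ h₂ h8 hlam hδ hδ1 hl hgram
  have e₃ : neuronsLaw d m B₃ ≤ ENNReal.ofReal (δ / 4) :=
    neuronsLaw_val_le h hD hCg hd hm0 h₁ h₂ hg (by linarith) hδ hδ1 hl hρ₀ hρ₀2 hval
  have hprob : neuronsLaw d m (B₀ ∪ (B₁ ∪ (B₂ ∪ (B₃ ∪ B₄)))) ≤ ENNReal.ofReal δ := by
    calc _ ≤ 0 + (ENNReal.ofReal (δ / 4) + (ENNReal.ofReal (δ / 4)
          + (ENNReal.ofReal (δ / 4) + ENNReal.ofReal (δ / 4)))) :=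
          (measure_union_le _ _).trans (add_le_add e₀ ((measure_union_le _ _).trans
            (add_le_add e₁ ((measure_union_le _ _).trans (add_le_add e₂
              ((measure_union_le _ _).trans (add_le_add e₃ hflip)))))))
      _ = ENNReal.ofReal δ := by
          have h4 : 0 ≤ δ / 4 := by positivity
          rw [zero_add, ← ENNReal.ofReal_add h4 h4, ← ENNReal.ofReal_add h4 (by positivity),
            ← ENNReal.ofReal_add h4 (by positivity)]
          congr 1
          ring
  refine (initLaw_le_pi _ (B₀ ∪ (B₁ ∪ (B₂ ∪ (B₃ ∪ B₄)))) fun ω hω => ?_).trans hprob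
  by_contra hgood
  simp only [Set.mem_union, not_or] at hgood
  obtain ⟨g₀, g₁, g₂, g₃, g₄⟩ := hgood
  have hsign : ∀ r, (ω r).2 = -1 ∨ (ω r).2 = 1 := fun r => not_not.1 fun hc => g₀ ⟨r, hc⟩
  have habs : ∀ r, |(ω r).2| ≤ 1 := fun r => by rcases hsign r with e | e <;> rw [e] <;> simp
  have hrad : ∀ r, 1 + ‖(ω r).1‖ ≤ M := fun r => not_lt.1 fun hc => g₁ ⟨r, hc⟩
  have hgr : ∀ i j, |(∑ r, truncGram σ D M i j (ω r).1) / m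
      - ∫ w, truncGram σ D M i j w ∂(stdGaussian (Weight d))| ≤ lambda₀ σ D / 16 :=
    fun i j => le_of_lt (not_le.1 fun hc => g₂ ⟨(i, j), hc⟩)
  have hvl : ∀ i, |(∑ r, truncVal σ D M i (ω r)) / m| ≤ ρ₀ / √m :=
    fun i => le_of_lt (not_le.1 fun hc => g₃ ⟨i, hc⟩)
  have hfl : ∀ i, ∑ r, F i (ω r).1 ≤ m * φ := fun i => not_lt.1 fun hc => g₄ ⟨i, hc⟩
  have hmem : ∀ r, (ω r).1 ∈ {w : Weight d | 1 + ‖w‖ ≤ M} := hrad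
  have hmem' : ∀ r, (ω r).2 ∈ {a : ℝ | |a| ≤ 1} := habs
  have hG : ∀ i j, |(∑ r, inner ℝ (rawGrad σ D (ω r).1 i) (rawGrad σ D (ω r).1 j)) / m
      - ∫ w, inner ℝ (rawGrad σ D w i) (rawGrad σ D w j) ∂(stdGaussian (Weight d))|
        ≤ lambda₀ σ D / 8 := by
    intro i j
    have hb := abs_integral_truncGram_sub_le h hD hC₈ hd h8 hlam (by positivity)
      (stdGaussian_radius_lt_le hd hm hδ hδ1) hbias i j
    have hc := hgr i j
    have e : ∑ r, truncGram σ D M i j (ω r).1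
        = ∑ r, inner ℝ (rawGrad σ D (ω r).1 i) (rawGrad σ D (ω r).1 j) :=
      Finset.sum_congr rfl fun r _ => by rw [truncGram, Set.indicator_of_mem (hmem r)]
    rw [e] at hc
    refine (abs_sub_le _ _ _).trans ((add_le_add hc hb).trans ?_)
    linarith
  have hV : ∀ i, |(∑ r, (ω r).2 * neuronVal σ D (ω r).1 i) / m| ≤ ρ₀ / √m := by
    intro i
    have e : ∑ r, (ω r).2 * neuronVal σ D (ω r).1 i = ∑ r, truncVal σ D M i (ω r) :=
      Finset.sum_congr rfl fun r _ => by
        rw [truncVal, Set.indicator_of_mem (hmem r), Set.indicator_of_mem (hmem' r), mul_comm]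
        rfl
    rw [e]
    exact hvl i
  have hreg := locallyRegular_of_bounds (Rg := 4 * ρ / √(lambda₀ σ D / 2)) h hD hM hrad hR1 hF hκ
    hfl
  have hω' : ¬ ∀ k : ℕ, IsUnit (gram σ D (fun r => (ω r).2)
        (ngd σ D η (fun r => (ω r).2) (fun r => (ω r).1) k)) ∧
      loss σ D (fun r => (ω r).2) (ngd σ D η (fun r => (ω r).2) (fun r => (ω r).1) k)
        ≤ (1 - η) ^ k * loss σ D (fun r => (ω r).2) (fun r => (ω r).1) := hω
  exact hω' fun k => hreg.converges h₁ h₂ hm0 habs hφ hη hη1 (by positivity)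
    (le_l2_transpose_mulVec h₁ h₂ hlam hsign hG)
    ((l2_residual_le h.contDiff h₁ h₂ hm0 hρ₀.le hK hV).trans hρ) hR le_rfl hsmall k

/-! ### The required width -/

lemma abs_target_le {D : Data d n₁ n₂} {K : ℝ} (hf : ∀ p, |D.f (D.x p)| ≤ K)
    (hg : ∀ j, |D.g (D.y j)| ≤ K) (i : Fin n₁ ⊕ Fin n₂) : |D.target i| ≤ K := by
  rcases i with p | j
  · exact hf p
  · exact hg j

/-- The constant in the width condition `convergesWithProb_of_width` common to both activations. Its
summands serve, in this order, the truncation bias, the concentration of the Gram matrix, that of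
the network values, and the size of the region. The `Cᵢ` bound Gaussian moments, and `100 A`,
`10000 A` come from the bound `100 A M²` on the gradients, with `M² = 100 d log (m d / δ)`. -/
noncomputable def baseConst (g : ℕ) (A K C₄ C₈ Cg : ℝ) : ℝ :=
  1024 * ((100 * A) ^ 4 * C₈) + 5120 * (8 * ((100 * A) ^ 4 * C₈)
      + 1250 * (((100 * A) ^ 2 * C₄) * (100 * A) ^ 2))
    + 20 * 100 ^ (g + 2) * ((100 * A) ^ 2 * C₄) ^ 2 / Cg
    + 73728 * ((10000 * A) ^ 2 * (160 * ((100 * A) ^ 2 * Cg) + 16 * K ^ 2))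

lemma baseConst_pos (g : ℕ) {A K C₄ C₈ Cg : ℝ} (hA : 0 < A) (hC₄ : 0 < C₄) (hC₈ : 0 < C₈)
    (hCg : 0 < Cg) : 0 < baseConst g A K C₄ C₈ Cg := by
  unfold baseConst; positivity

/-- The bound `ρ` on the norm of the residual vector at initialization. -/
noncomputable def residualBound (g d : ℕ) (A K Cg l : ℝ) : ℝ :=
  √((160 * ((100 * A) ^ 2 * Cg) + 16 * K ^ 2) * ((d : ℝ) ^ (g + 2) * l))

/-- The distance that no single weight vector exceeds during training. -/
noncomputable def travel (g d m : ℕ) (A K Cg ℓ l lam : ℝ) : ℝ :=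
  24 * (10000 * A * (d * ℓ)) * residualBound g d A K Cg l / (√m * lam)

/-- Monomial comparisons behind the width conditions. -/
lemma width_monomials {g : ℕ} (hg : g ≤ 1) {x ℓ l : ℝ} (hx : 1 ≤ x) (hℓ : 1 / 2 ≤ ℓ)
    (hl : 1 / 2 ≤ l) :
    x ^ 4 ≤ 16 * (x ^ (g + 4) * ℓ ^ (g + 2) * l) ∧
    x ^ 4 * l ≤ 8 * (x ^ (g + 4) * ℓ ^ (g + 2) * l) ∧
    x ^ (g + 4) * ℓ ^ 2 * l ≤ 2 * (x ^ (g + 4) * ℓ ^ (g + 2) * l) ∧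
    x ^ 4 * ℓ ^ (g + 2) * l ≤ x ^ (g + 4) * ℓ ^ (g + 2) * l := by
  have hx0 : 0 < x := by linarith
  have hℓ0 : 0 < ℓ := by linarith
  have hl0 : 0 < l := by linarith
  have hxg : x ^ 4 ≤ x ^ (g + 4) := pow_le_pow_right₀ hx (by omega)
  have hℓg : ℓ ^ 2 ≤ 2 * ℓ ^ (g + 2) := by
    have : 0 < ℓ ^ 2 := by positivity
    interval_cases g
    · show ℓ ^ 2 ≤ 2 * ℓ ^ 2
      linarith
    · show ℓ ^ 2 ≤ 2 * ℓ ^ 3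
      nlinarith
  have hℓ2 : 1 ≤ 4 * ℓ ^ 2 := by nlinarith
  have hℓ3 : 1 ≤ 8 * ℓ ^ (g + 2) := by linarith
  have hx4 : 0 < x ^ 4 := by positivity
  have h2 : x ^ 4 * l ≤ 8 * (x ^ (g + 4) * ℓ ^ (g + 2) * l) := by
    calc x ^ 4 * l = x ^ 4 * 1 * l := by ring
      _ ≤ x ^ (g + 4) * (8 * ℓ ^ (g + 2)) * l := by gcongr
      _ = _ := by ring
  refine ⟨?_, h2, ?_, by gcongr⟩
  · have : x ^ 4 ≤ 2 * (x ^ 4 * l) := by nlinarith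
    linarith
  · calc _ ≤ x ^ (g + 4) * (2 * ℓ ^ (g + 2)) * l := by gcongr
      _ = _ := by ring

set_option maxHeartbeats 1000000 in
/-- Convergence with high probability under a single condition on the width, apart from the jumps of
`σ'''`: these are left to the hypotheses on `F` and `φ`. -/
theorem convergesWithProb_of_width {σ : ℝ → ℝ} {g : ℕ} {κ : ℝ → ℝ → ℝ} {A : ℝ}
    {D : Data d n₁ n₂} (h : ActivationBounds σ g κ A) (hD : ∀ i, ‖D.sample i‖ ≤ 1)
    (hlam : 0 < lambda₀ σ D) (hd : 1 ≤ d) (h₁ : 1 ≤ n₁) (h₂ : 1 ≤ n₂) (hm : 2 ≤ m)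
    {η δ ℓ l K C₄ C₈ Cg φ R : ℝ} (hη : 0 < η) (hη1 : η < 1) (hδ : 0 < δ) (hδ1 : δ < 1)
    (hℓ : ℓ = Real.log (m * d / δ)) (hl : l = Real.log ((n₁ + n₂) / δ))
    (hK : ∀ i, |D.target i| ≤ K)
    (hC₄ : 0 < C₄)
    (h4 : ∫ w : Weight d, (1 + ‖w‖) ^ 4 ∂(stdGaussian (Weight d)) ≤ C₄ * (d : ℝ) ^ 2)
    (hC₈ : 0 < C₈)
    (h8 : ∫ w : Weight d, (1 + ‖w‖) ^ 8 ∂(stdGaussian (Weight d)) ≤ C₈ * (d : ℝ) ^ 4)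
    (hCg : 0 < Cg)
    (hg : ∫ w : Weight d, (1 + ‖w‖) ^ (2 * (g + 2)) ∂(stdGaussian (Weight d))
      ≤ Cg * (d : ℝ) ^ (g + 2))
    (hR : R = travel g d m A K Cg ℓ l (lambda₀ σ D))
    {F : Fin n₁ ⊕ Fin n₂ → Weight d → ℝ} (hF : ∀ i w, F i w = 0 ∨ F i w = 1)
    (hκ : ∀ i u w w', ‖w - u‖ ≤ R → ‖w' - u‖ ≤ R →
      κ (inner ℝ w (aug (D.sample i))) (inner ℝ w' (aug (D.sample i))) ≤ F i u)
    (hφ : 0 ≤ φ)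
    (hflip : neuronsLaw d m {ω | ∃ i, m * φ < ∑ r, F i (ω r).1} ≤ ENNReal.ofReal (δ / 4))
    (hφs : 10000 * A * (d * ℓ) * √φ ≤ √(1 - η) * √(lambda₀ σ D / 2) / 24)
    (hwidth : baseConst g A K C₄ C₈ Cg * ((d : ℝ) ^ (g + 4) * ℓ ^ (g + 2) * l)
      ≤ (1 - η) * (lambda₀ σ D ^ 2 * m)) :
    ConvergesWithProb σ D m η δ := by
  have hA := h.pos
  have hm0 : (0 : ℝ) < m := by positivity
  have hx : (1 : ℝ) ≤ d := by exact_mod_cast hd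
  have hℓ2 : 1 / 2 ≤ ℓ := hℓ ▸ half_le_log (two_le_ratio hd hm hδ hδ1)
  have hl2 : 1 / 2 ≤ l := hl ▸ half_le_log_samples h₁ h₂ hδ hδ1
  have hM := radius_sq hd hm hδ hδ1
  rw [← hℓ] at hM
  have hΛ := lambda₀_le h hD h₁ h4
  set lam := lambda₀ σ D with hlamdef
  set M := radius d m δ
  set x : ℝ := (d : ℝ) with hxdef
  set a := 100 * A with ha
  have ha0 : 0 < a := by positivity
  have hx0 : 0 < x := by linarith
  have hℓ0 : 0 < ℓ := by linarith
  have hl0 : 0 < l := by linarith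
  have hK0 : 0 ≤ K := (abs_nonneg _).trans (hK (Sum.inl ⟨0, h₁⟩))
  set P := 160 * (a ^ 2 * Cg) + 16 * K ^ 2 with hP
  have hP0 : 0 < P := by positivity
  set ρ := residualBound g d A K Cg l with hρdef
  have hρ2 : ρ ^ 2 = P * (x ^ (g + 2) * l) := Real.sq_sqrt (by positivity)
  have hρ0 : 0 ≤ ρ := Real.sqrt_nonneg _
  obtain ⟨u1, u2, u3, u4⟩ := width_monomials h.le_one hx hℓ2 hl2
  set U := x ^ (g + 4) * ℓ ^ (g + 2) * l with hU
  have hU0 : 0 < U := by positivity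
  have hmU : baseConst g A K C₄ C₈ Cg * U ≤ lam ^ 2 * m :=
    hwidth.trans (mul_le_of_le_one_left (by positivity) (by linarith))
  have t1 : 0 ≤ 1024 * (a ^ 4 * C₈) * U := by positivity
  have t2 : 0 ≤ 5120 * (8 * (a ^ 4 * C₈) + 1250 * ((a ^ 2 * C₄) * a ^ 2)) * U := by positivity
  have t3 : 0 ≤ 20 * 100 ^ (g + 2) * (a ^ 2 * C₄) ^ 2 / Cg * U := by positivity
  have t4 : 0 ≤ 73728 * ((10000 * A) ^ 2 * P) * U := by positivity
  have hexp : baseConst g A K C₄ C₈ Cg * U = 1024 * (a ^ 4 * C₈) * U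
      + 5120 * (8 * (a ^ 4 * C₈) + 1250 * ((a ^ 2 * C₄) * a ^ 2)) * U
      + 20 * 100 ^ (g + 2) * (a ^ 2 * C₄) ^ 2 / Cg * U
      + 73728 * ((10000 * A) ^ 2 * P) * U := by rw [baseConst]; ring
  have w1 : 1024 * (a ^ 4 * C₈) * U ≤ lam ^ 2 * m := by linarith
  have w2 : 5120 * (8 * (a ^ 4 * C₈) + 1250 * ((a ^ 2 * C₄) * a ^ 2)) * U ≤ lam ^ 2 * m := by
    linarith
  have w3 : 20 * 100 ^ (g + 2) * (a ^ 2 * C₄) ^ 2 / Cg * U ≤ lam ^ 2 * m := by linarith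
  have w4 : 73728 * ((10000 * A) ^ 2 * P) * U ≤ (1 - η) * (lam ^ 2 * m) := by linarith
  clear hmU hexp hwidth t1 t2 t3 t4
  have hb : 100 * A * M ^ 2 = 10000 * A * (x * ℓ) := by rw [hM]; ring
  set b := 10000 * A * (x * ℓ) with hbdef
  have hb0 : 0 < b := by positivity
  have hbρ : (b * ρ) ^ 2 * 36864 ≤ (1 - η) * (lam ^ 2 * m) := by
    refine le_trans (le_of_eq_of_le ?_ (mul_le_mul_of_nonneg_left u3
      (by positivity : 0 ≤ 36864 * ((10000 * A) ^ 2 * P)))) (le_of_eq_of_le ?_ w4)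
    · rw [mul_pow, hρ2, hbdef]; ring
    · ring
  have hsm : 0 < √(m : ℝ) := Real.sqrt_pos.2 hm0
  have hsm2 : √(m : ℝ) ^ 2 = m := Real.sq_sqrt hm0.le
  have hRdef : R = 24 * b * ρ / (√m * lam) := hR
  have hη' : 0 < 1 - η := by linarith
  refine convergesWithProb_of_bounds (ρ₀ := √(20 * (a ^ 2 * Cg * x ^ (g + 2)) * l)) (ρ := ρ)
    h hD hlam hd h₁ h₂ hm hη hη1 hδ hδ1 hl hK hC₈ h8 hCg hg hF hκ hφ hflip ?_ ?_ (by positivity)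
    (Real.sq_sqrt (by positivity)) ?_ ?_ ?_ ?_ ?_
  · -- truncation bias
    have e : 256 * (a ^ 4 * C₈ * x ^ 4) * (δ / (4 * m)) = 64 * (a ^ 4 * C₈ * x ^ 4) * δ / m := by
      field_simp; norm_num
    rw [e, div_le_iff₀ hm0]
    calc 64 * (a ^ 4 * C₈ * x ^ 4) * δ ≤ 64 * (a ^ 4 * C₈ * x ^ 4) * 1 := by gcongr
      _ = 64 * (a ^ 4 * C₈) * x ^ 4 := by ring
      _ ≤ 64 * (a ^ 4 * C₈) * (16 * U) := by gcongr
      _ ≤ _ := by linarith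
  · -- concentration of the Gram matrix
    have e : M ^ 4 = (100 * (x * ℓ)) ^ 2 := by rw [← hM]; ring
    have hv : lam * (x ^ 2 * ℓ ^ 2 * l) ≤ a ^ 2 * C₄ * (2 * U) := by
      calc lam * (x ^ 2 * ℓ ^ 2 * l) ≤ a ^ 2 * (C₄ * x ^ 2) * (x ^ 2 * ℓ ^ 2 * l) := by gcongr
        _ = a ^ 2 * C₄ * (x ^ 4 * ℓ ^ 2 * l) := by ring
        _ ≤ a ^ 2 * C₄ * (x ^ (g + 4) * ℓ ^ 2 * l) := by
            gcongr
            exact Nat.le_add_left 4 g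
        _ ≤ _ := by gcongr
    have e2 : 20 * (a ^ 4 * C₈ * x ^ 4 + lam / 16 * (a ^ 2 * M ^ 4)) * l * 256
        = 5120 * ((a ^ 4 * C₈) * (x ^ 4 * l) + 625 * a ^ 2 * (lam * (x ^ 2 * ℓ ^ 2 * l))) := by
      rw [e]; ring
    have e3 : 5120 * ((a ^ 4 * C₈) * (x ^ 4 * l) + 625 * a ^ 2 * (lam * (x ^ 2 * ℓ ^ 2 * l)))
        ≤ 5120 * ((a ^ 4 * C₈) * (8 * U) + 625 * a ^ 2 * (a ^ 2 * C₄ * (2 * U))) := by gcongr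
    have e4 : 5120 * ((a ^ 4 * C₈) * (8 * U) + 625 * a ^ 2 * (a ^ 2 * C₄ * (2 * U)))
        = 5120 * (8 * (a ^ 4 * C₈) + 1250 * ((a ^ 2 * C₄) * a ^ 2)) * U := by ring
    have e5 : m * (lam / 16) ^ 2 * 256 = lam ^ 2 * m := by ring
    linarith
  · -- concentration of the network values
    have e : M ^ (2 * (g + 2)) = 100 ^ (g + 2) * (x ^ (g + 2) * ℓ ^ (g + 2)) := by
      rw [pow_mul, hM, mul_pow, mul_pow]
    have hlam2 : lam ^ 2 ≤ (a ^ 2 * C₄) ^ 2 * x ^ 4 := by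
      calc lam ^ 2 ≤ (a ^ 2 * (C₄ * x ^ 2)) ^ 2 := by gcongr
        _ = _ := by ring
    have hmain : 20 * 100 ^ (g + 2) * (ℓ ^ (g + 2) * l) ≤ Cg * m := by
      have s1 : 20 * 100 ^ (g + 2) * (a ^ 2 * C₄) ^ 2 / Cg * (x ^ 4 * ℓ ^ (g + 2) * l)
          ≤ (a ^ 2 * C₄) ^ 2 * x ^ 4 * m := by
        refine (mul_le_mul_of_nonneg_left u4 (by positivity)).trans (w3.trans ?_)
        gcongr
      have e1 : 20 * 100 ^ (g + 2) * (a ^ 2 * C₄) ^ 2 / Cg * (x ^ 4 * ℓ ^ (g + 2) * l)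
          = (a ^ 2 * C₄) ^ 2 * x ^ 4 * (20 * 100 ^ (g + 2) * (ℓ ^ (g + 2) * l) / Cg) := by ring
      rw [e1] at s1
      have := le_of_mul_le_mul_left s1 (by positivity)
      rwa [div_le_iff₀ hCg, mul_comm (m : ℝ)] at this
    rw [e]
    calc _ = x ^ (g + 2) * (20 * 100 ^ (g + 2) * (ℓ ^ (g + 2) * l)) := by ring
      _ ≤ x ^ (g + 2) * (Cg * m) := by gcongr
      _ = _ := by ring
  · -- size of the initial residual
    set ρ₀ := √(20 * (a ^ 2 * Cg * x ^ (g + 2)) * l) with hρ₀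
    have hρ₀2 : ρ₀ ^ 2 = 20 * (a ^ 2 * Cg * x ^ (g + 2)) * l := Real.sq_sqrt (by positivity)
    refine (abs_le_of_sq_le_sq' ?_ hρ0).2
    rw [hρ2]
    have hxl : 1 ≤ 2 * (x ^ (g + 2) * l) := by
      calc 1 ≤ 2 * (1 * l) := by linarith
        _ ≤ 2 * (x ^ (g + 2) * l) := by
            gcongr
            exact one_le_pow₀ hx
    have hK2 : K ^ 2 * 1 ≤ K ^ 2 * (2 * (x ^ (g + 2) * l)) := by gcongr
    calc (2 * (ρ₀ + K)) ^ 2 ≤ 8 * (ρ₀ ^ 2 + K ^ 2 * 1) := by nlinarith [sq_nonneg (ρ₀ - K)]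
      _ ≤ 8 * (ρ₀ ^ 2 + K ^ 2 * (2 * (x ^ (g + 2) * l))) := by linarith
      _ = _ := by rw [hρ₀2, hP]; ring
  · -- every weight moves by at most one
    rw [hRdef, div_le_one (by positivity)]
    refine (abs_le_of_sq_le_sq' ?_ (by positivity)).2
    have e1 : (24 * b * ρ) ^ 2 = 576 * (b * ρ) ^ 2 := by ring
    have e2 : (√(m : ℝ) * lam) ^ 2 = lam ^ 2 * m := by rw [mul_pow, hsm2]; ring
    rw [e1, e2]
    have : (1 - η) * (lam ^ 2 * m) ≤ lam ^ 2 * m :=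
      mul_le_of_le_one_left (by positivity) (by linarith)
    linarith [sq_nonneg (b * ρ)]
  · rw [hb, hRdef, ← hlamdef]
    refine le_of_eq ?_
    field_simp
    ring
  · rw [hb, mul_add]
    have hμ : 0 < √(lam / 2) := Real.sqrt_pos.2 (by positivity)
    have hμ2 : √(lam / 2) * √(lam / 2) = lam / 2 := Real.mul_self_sqrt (by positivity)
    have hq2 : √(1 - η) ^ 2 = 1 - η := Real.sq_sqrt hη'.le
    have hmain : 96 * (b * ρ) ≤ √(1 - η) * (lam / 2) * √m := by
      refine (abs_le_of_sq_le_sq' ?_ (by positivity)).2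
      have e1 : (√(1 - η) * (lam / 2) * √(m : ℝ)) ^ 2 = (1 - η) * (lam ^ 2 * m) / 4 := by
        rw [mul_pow, mul_pow, hsm2, hq2]; ring
      rw [e1]
      linarith
    have h1 : b * (4 * ρ / √(lam / 2) / √m) ≤ √(1 - η) * √(lam / 2) / 24 := by
      rw [div_div, mul_div_assoc', div_le_div_iff₀ (by positivity) (by norm_num)]
      calc b * (4 * ρ) * 24 = 96 * (b * ρ) := by ring
        _ ≤ _ := hmain
        _ = √(1 - η) * (√(lam / 2) * √(lam / 2)) * √m := by rw [hμ2]
        _ = _ := by ring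
    linarith

/-! ### The two activations -/

/-- For smooth activations no jumps occur, and one factor `1 / λ₀` of the width pays for the
bound `λ₀ ≤ Λ d²`. -/
theorem exists_const_smooth (c K : ℝ) : ∃ C : ℝ, 0 < C ∧
    ∀ σ : ℝ → ℝ, SmoothActivation c σ →
    ∀ (d n₁ n₂ m : ℕ), 1 ≤ d → 1 ≤ n₁ → 1 ≤ n₂ → 2 ≤ m →
    ∀ D : Data d n₁ n₂, (∀ i, ‖D.sample i‖ ≤ 1) → D.NoTwoParallel →
      (∀ p, |D.f (D.x p)| ≤ K) → (∀ j, |D.g (D.y j)| ≤ K) →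
    ∀ η δ : ℝ, 0 < η → η < 1 → 0 < δ → δ < 1 →
      0 < lambda₀ σ D ∧
      (C * (1 / (1 - η) * ((d : ℝ) ^ 6 / lambda₀ σ D ^ 3)
          * Real.log (m * d / δ) ^ 2 * Real.log ((n₁ + n₂) / δ)) ≤ m →
        ConvergesWithProb σ D m η δ) := by
  rcases lt_or_ge c 0 with hc | hc
  -- A Lipschitz constant cannot be negative.
  · exact ⟨1, one_pos, fun σ hσ => absurd ((abs_nonneg _).trans hσ.abs_zero_le) (not_le.2 hc)⟩
  obtain ⟨C₄, hC₄, h4⟩ := exists_moment_bound 2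
  obtain ⟨C₈, hC₈, h8⟩ := exists_moment_bound 4
  set A := 5 * c + 1 with hAdef
  have hA : 0 < A := by positivity
  have hB := baseConst_pos 0 (K := K) hA hC₄ hC₈ hC₄
  refine ⟨baseConst 0 A K C₄ C₈ C₄ * ((100 * A) ^ 2 * C₄), by positivity, ?_⟩
  intro σ hσ d n₁ n₂ m hd h₁ h₂ hm D hD hpar hf hg η δ hη hη1 hδ hδ1
  have h := hσ.activationBounds
  have hlam := lambda₀_pos h hD h₁ h₂ (hσ.biasGradIndep hd D hpar)
  refine ⟨hlam, fun hwidth => ?_⟩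
  have hΛ := lambda₀_le h hD h₁ (h4 d hd)
  have hℓ := half_le_log (two_le_ratio hd hm hδ hδ1)
  have hl := half_le_log_samples h₁ h₂ hδ hδ1
  set ℓ := Real.log (m * d / δ) with hℓdef
  set l := Real.log (((n₁ : ℝ) + n₂) / δ) with hldef
  set lam := lambda₀ σ D with hlamdef
  have hη' : 0 < 1 - η := by linarith
  have hd0 : (0 : ℝ) < d := by exact_mod_cast hd
  refine convergesWithProb_of_width h hD hlam hd h₁ h₂ hm hη hη1 hδ hδ1 hℓdef hldef
    (abs_target_le hf hg) hC₄ (h4 d hd) hC₈ (h8 d hd) hC₄ (h4 d hd) rfl (F := fun _ _ => 0)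
    (φ := 0) (fun _ _ => Or.inl rfl) (fun _ _ _ _ _ _ => le_rfl) le_rfl ?_ ?_ ?_
  · simp
  · rw [Real.sqrt_zero, mul_zero]
    positivity
  · have e : baseConst 0 A K C₄ C₈ C₄ * ((100 * A) ^ 2 * C₄) * (1 / (1 - η) * ((d : ℝ) ^ 6 / lam ^ 3)
        * ℓ ^ 2 * l) = baseConst 0 A K C₄ C₈ C₄ * ((d : ℝ) ^ (0 + 4) * ℓ ^ (0 + 2) * l)
          * ((100 * A) ^ 2 * (C₄ * (d : ℝ) ^ 2)) / ((1 - η) * lam ^ 3) := by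
      field_simp
    rw [e, div_le_iff₀ (by positivity)] at hwidth
    have hX : 0 < baseConst 0 A K C₄ C₈ C₄ * ((d : ℝ) ^ (0 + 4) * ℓ ^ (0 + 2) * l) := by positivity
    set X := baseConst 0 A K C₄ C₈ C₄ * ((d : ℝ) ^ (0 + 4) * ℓ ^ (0 + 2) * l)
    have h1 : X * lam ≤ (1 - η) * (lam ^ 2 * m) * lam := by
      calc X * lam ≤ X * ((100 * A) ^ 2 * (C₄ * (d : ℝ) ^ 2)) := by gcongr
        _ ≤ _ := hwidth
        _ = _ := by ring
    exact le_of_mul_le_mul_right h1 hlam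

/-- If two weights within distance `R` of `u` lie on different sides of the hyperplane `x̃ᗮ`, then
`u` is within `2 R` of it. -/
lemma signFlip_le_indicator {x : Point d} (hx : ‖x‖ ≤ 1) {R : ℝ} {u w w' : Weight d}
    (hw : ‖w - u‖ ≤ R) (hw' : ‖w' - u‖ ≤ R) :
    signFlip (inner ℝ w (aug x)) (inner ℝ w' (aug x))
      ≤ {w : Weight d | |inner ℝ w (aug x)| ≤ 2 * R}.indicator (fun _ => (1 : ℝ)) u := by
  have key : ∀ v : Weight d, ‖v - u‖ ≤ R → |inner ℝ v (aug x) - inner ℝ u (aug x)| ≤ 2 * R := by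
    intro v hv
    rw [← inner_sub_left]
    exact (abs_inner_aug_le hx _).trans (by linarith)
  have h1 := abs_le.1 (key w hw)
  have h2 := abs_le.1 (key w' hw')
  rw [Set.indicator_apply]
  split_ifs with hu
  · unfold signFlip
    split_ifs <;> norm_num
  · have hu' : ¬ |inner ℝ u (aug x)| ≤ 2 * R := hu
    rw [not_le, lt_abs] at hu'
    have hiff : (0 ≤ inner ℝ w (aug x) ↔ 0 ≤ inner ℝ w' (aug x)) := by
      rcases hu' with h | h
      · constructor <;> intro _ <;> linarith
      · constructor <;> intro _ <;> exfalso <;> linarith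
    unfold signFlip
    rw [if_pos hiff]

/-- For the cubed ReLU a fraction of order `R` of the neurons may cross a jump of `σ'''`, where `R`
is the distance travelled by a weight; this costs the higher powers in the width. -/
theorem exists_const_relu3 (K : ℝ) : ∃ C : ℝ, 0 < C ∧
    ∀ (d n₁ n₂ m : ℕ), 1 ≤ d → 1 ≤ n₁ → 1 ≤ n₂ → 2 ≤ m →
    ∀ D : Data d n₁ n₂, (∀ i, ‖D.sample i‖ ≤ 1) → D.NoTwoParallel →
      (∀ p, |D.f (D.x p)| ≤ K) → (∀ j, |D.g (D.y j)| ≤ K) →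
    ∀ η δ : ℝ, 0 < η → η < 1 → 0 < δ → δ < 1 →
      0 < lambda₀ relu3 D ∧
      (C * (1 / (1 - η) ^ 2 * ((d : ℝ) ^ 12 / lambda₀ relu3 D ^ 4)
          * Real.log (m * d / δ) ^ 6 * Real.log ((n₁ + n₂) / δ)) ≤ m →
        ConvergesWithProb relu3 D m η δ) := by
  obtain ⟨C₄, hC₄, h4⟩ := exists_moment_bound 2
  obtain ⟨C₆, hC₆, h6⟩ := exists_moment_bound 3
  obtain ⟨C₈, hC₈, h8⟩ := exists_moment_bound 4
  obtain ⟨A, hAdef⟩ : ∃ A : ℝ, A = 100 := ⟨_, rfl⟩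
  have hA : 0 < A := by rw [hAdef]; norm_num
  have h : ActivationBounds relu3 1 signFlip A := hAdef ▸ activationBounds_relu3
  obtain ⟨Λ, hΛdef⟩ : ∃ Λ : ℝ, Λ = (100 * A) ^ 2 * C₄ := ⟨_, rfl⟩
  have hΛ0 : 0 < Λ := by rw [hΛdef]; positivity
  obtain ⟨P, hP⟩ : ∃ P : ℝ, P = 160 * ((100 * A) ^ 2 * C₆) + 16 * K ^ 2 := ⟨_, rfl⟩
  have hP0 : 0 < P := by rw [hP]; positivity
  have hB := baseConst_pos 1 (K := K) hA hC₄ hC₈ hC₆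
  set Q := baseConst 1 A K C₄ C₈ C₆ with hQ
  obtain ⟨B, hBdef⟩ : ∃ B : ℝ, B = 10000 * A := ⟨_, rfl⟩
  have hB0 : 0 < B := by rw [hBdef]; positivity
  -- The summands serve the common conditions, the number of jumps, and its concentration.
  refine ⟨8 * Λ ^ 2 * Q + 110592 ^ 2 * (B ^ 6 * P) + 64 * Λ ^ 6 / (B ^ 2 * P), by positivity, ?_⟩
  intro d n₁ n₂ m hd h₁ h₂ hm D hD hpar hf hg η δ hη hη1 hδ hδ1
  have hlam := lambda₀_pos h hD h₁ h₂ (biasGradIndep_relu3 hd D hpar)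
  refine ⟨hlam, fun hwidth => ?_⟩
  have hΛ := lambda₀_le h hD h₁ (h4 d hd)
  rw [← mul_assoc, ← hΛdef] at hΛ
  have hℓ := half_le_log (two_le_ratio hd hm hδ hδ1)
  have hl := half_le_log_samples h₁ h₂ hδ hδ1
  set ℓ := Real.log (m * d / δ) with hℓdef
  set l := Real.log (((n₁ : ℝ) + n₂) / δ) with hldef
  set lam := lambda₀ relu3 D with hlamdef
  have hη' : 0 < 1 - η := by linarith
  have hη'' : 1 - η ≤ 1 := by linarith
  have hx : (1 : ℝ) ≤ d := by exact_mod_cast hd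
  have hd0 : (0 : ℝ) < d := by linarith
  have hm0 : (0 : ℝ) < m := by positivity
  have hℓ0 : 0 < ℓ := by linarith
  have hl0 : 0 < l := by linarith
  have hlam2 : lam ^ 2 ≤ Λ ^ 2 * (d : ℝ) ^ 4 := by
    calc lam ^ 2 ≤ (Λ * (d : ℝ) ^ 2) ^ 2 := by gcongr
      _ = _ := by ring
  have hsm : 0 < √(m : ℝ) := Real.sqrt_pos.2 hm0
  have hsm2 : √(m : ℝ) ^ 2 = m := Real.sq_sqrt hm0.le
  have hU0 : 0 < (d : ℝ) ^ 12 * ℓ ^ 6 * l := by positivity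
  have hmain : (8 * Λ ^ 2 * Q + 110592 ^ 2 * (B ^ 6 * P) + 64 * Λ ^ 6 / (B ^ 2 * P))
      * ((d : ℝ) ^ 12 * ℓ ^ 6 * l) ≤ (1 - η) ^ 2 * lam ^ 4 * m := by
    have e : 1 / (1 - η) ^ 2 * ((d : ℝ) ^ 12 / lam ^ 4) * ℓ ^ 6 * l
        = ((d : ℝ) ^ 12 * ℓ ^ 6 * l) / ((1 - η) ^ 2 * lam ^ 4) := by field_simp
    rw [e, ← mul_div_assoc, div_le_iff₀ (by positivity)] at hwidth
    linarith
  set U := (d : ℝ) ^ 12 * ℓ ^ 6 * l with hU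
  have t1 : 0 ≤ 8 * Λ ^ 2 * Q * U := by positivity
  have t2 : 0 ≤ 110592 ^ 2 * (B ^ 6 * P) * U := by positivity
  have t3 : 0 ≤ 64 * Λ ^ 6 / (B ^ 2 * P) * U := by positivity
  rw [add_mul, add_mul] at hmain
  have w1 : 8 * Λ ^ 2 * Q * U ≤ (1 - η) ^ 2 * lam ^ 4 * m := by linarith
  have w2 : 110592 ^ 2 * (B ^ 6 * P) * U ≤ (1 - η) ^ 2 * lam ^ 4 * m := by linarith
  have w3 : 64 * Λ ^ 6 / (B ^ 2 * P) * U ≤ (1 - η) ^ 2 * lam ^ 4 * m := by linarith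
  clear hmain t1 t2 t3 hwidth
  -- Comparison with the common width condition.
  have hbase : Q * ((d : ℝ) ^ (1 + 4) * ℓ ^ (1 + 2) * l) ≤ (1 - η) * (lam ^ 2 * m) := by
    have hpow : (d : ℝ) ^ 4 * ((d : ℝ) ^ (1 + 4) * ℓ ^ (1 + 2) * l) ≤ 8 * U := by
      have e1 : (1 : ℝ) ≤ 8 * ℓ ^ 3 := by
        have := pow_le_pow_left₀ (by norm_num) hℓ 3
        linarith
      calc _ = (d : ℝ) ^ 9 * (ℓ ^ 3 * 1) * l := by ring
        _ ≤ (d : ℝ) ^ 12 * (ℓ ^ 3 * (8 * ℓ ^ 3)) * l := by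
            gcongr
            norm_num
        _ = _ := by rw [hU]; ring
    have h1 : Λ ^ 2 * (d : ℝ) ^ 4 * (Q * ((d : ℝ) ^ (1 + 4) * ℓ ^ (1 + 2) * l))
        ≤ Λ ^ 2 * (d : ℝ) ^ 4 * ((1 - η) * (lam ^ 2 * m)) := by
      calc _ = Λ ^ 2 * Q * ((d : ℝ) ^ 4 * ((d : ℝ) ^ (1 + 4) * ℓ ^ (1 + 2) * l)) := by ring
        _ ≤ Λ ^ 2 * Q * (8 * U) := by gcongr
        _ = 8 * Λ ^ 2 * Q * U := by ring
        _ ≤ (1 - η) ^ 2 * lam ^ 4 * m := w1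
        _ = (1 - η) * lam ^ 2 * ((1 - η) * (lam ^ 2 * m)) := by ring
        _ ≤ 1 * (Λ ^ 2 * (d : ℝ) ^ 4) * ((1 - η) * (lam ^ 2 * m)) := by gcongr
        _ = _ := by ring
    exact le_of_mul_le_mul_left h1 (by positivity)
  set ρ := residualBound 1 d A K C₆ l with hρdef
  have hρ2 : ρ ^ 2 = P * ((d : ℝ) ^ 3 * l) := by
    rw [hP]
    exact Real.sq_sqrt (by positivity)
  have hρ0 : 0 < ρ := by
    rw [hρdef, residualBound, ← hP]
    positivity
  obtain ⟨b, hb⟩ : ∃ b : ℝ, b = B * (d * ℓ) := ⟨_, rfl⟩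
  have hb0 : 0 < b := by rw [hb]; positivity
  set R := travel 1 d m A K C₆ ℓ l lam with hRdef
  have hR : R = 24 * b * ρ / (√m * lam) := by rw [hRdef, hb, hBdef, travel]
  have hR0 : 0 < R := by rw [hR]; positivity
  refine convergesWithProb_of_width h hD hlam hd h₁ h₂ hm hη hη1 hδ hδ1 hℓdef hldef
    (abs_target_le hf hg) hC₄ (h4 d hd) hC₈ (h8 d hd) hC₆ (h6 d hd) rfl
    (F := fun i => {w : Weight d | |inner ℝ w (aug (D.sample i))| ≤ 2 * R}.indicator
      (fun _ => (1 : ℝ))) (φ := 2 * (2 * R)) (fun i w => ?_)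
    (fun i u w w' hw hw' => signFlip_le_indicator (hD i) hw hw') (by positivity) ?_ ?_ hbase
  · rw [Set.indicator_apply]
    split_ifs
    · exact Or.inr rfl
    · exact Or.inl rfl
  · refine neuronsLaw_flip_le D (by omega) h₁ h₂ hδ hδ1 hldef (by positivity) ?_
    have h20 : 20 * l * lam ≤ 48 * (b * ρ) * √m := by
      refine (abs_le_of_sq_le_sq' ?_ (by positivity)).2
      have e1 : (48 * (b * ρ) * √(m : ℝ)) ^ 2
          = 2304 * (B ^ 2 * P) * ((d : ℝ) ^ 5 * ℓ ^ 2 * l) * m := by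
        rw [mul_pow, mul_pow, mul_pow, hρ2, hb, hsm2]; ring
      have hℓ2 : (1 : ℝ) ≤ 4 * ℓ ^ 2 := by
        have := pow_le_pow_left₀ (by norm_num) hℓ 2
        linarith
      have hℓ6 : (1 : ℝ) ≤ 64 * ℓ ^ 6 := by
        have := pow_le_pow_left₀ (by norm_num) hℓ 6
        linarith
      have hlm : Λ ^ 2 * l ≤ B ^ 2 * P * m := by
        have h1 : Λ ^ 4 * (d : ℝ) ^ 8 * (Λ ^ 2 * l / (B ^ 2 * P)) ≤ Λ ^ 4 * (d : ℝ) ^ 8 * m := by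
          calc _ = Λ ^ 6 / (B ^ 2 * P) * ((d : ℝ) ^ 8 * 1 * l) := by ring
            _ ≤ Λ ^ 6 / (B ^ 2 * P) * ((d : ℝ) ^ 12 * (64 * ℓ ^ 6) * l) := by
                gcongr
                norm_num
            _ = 64 * Λ ^ 6 / (B ^ 2 * P) * U := by rw [hU]; ring
            _ ≤ (1 - η) ^ 2 * lam ^ 4 * m := w3
            _ = (1 - η) ^ 2 * (lam ^ 2) ^ 2 * m := by ring
            _ ≤ 1 ^ 2 * (Λ ^ 2 * (d : ℝ) ^ 4) ^ 2 * m := by gcongr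
            _ = _ := by ring
        have := le_of_mul_le_mul_left h1 (by positivity)
        rw [div_le_iff₀ (by positivity)] at this
        linarith
      rw [e1]
      calc (20 * l * lam) ^ 2 = 400 * l ^ 2 * lam ^ 2 := by ring
        _ ≤ 400 * l ^ 2 * (Λ ^ 2 * (d : ℝ) ^ 4) := by gcongr
        _ = 400 * l * (d : ℝ) ^ 4 * (Λ ^ 2 * l) * 1 := by ring
        _ ≤ 576 * l * (d : ℝ) ^ 5 * (B ^ 2 * P * m) * (4 * ℓ ^ 2) := by
            gcongr <;> norm_num
        _ = _ := by ring
    rw [hR, mul_div_assoc', mul_div_assoc', le_div_iff₀ (by positivity)]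
    calc 20 * l * (√m * lam) = 20 * l * lam * √m := by ring
      _ ≤ 48 * (b * ρ) * √m * √m := by gcongr
      _ = 48 * (b * ρ) * √m ^ 2 := by ring
      _ = _ := by rw [hsm2]; ring
  · rw [← hBdef, ← hb]
    refine (abs_le_of_sq_le_sq' ?_ (by positivity)).2
    have e1 : (√(1 - η) * √(lam / 2) / 24) ^ 2 = (1 - η) * lam / 1152 := by
      rw [div_pow, mul_pow, Real.sq_sqrt hη'.le, Real.sq_sqrt (by positivity)]; ring
    have e2 : (b * √(2 * (2 * R))) ^ 2 = 96 * (b ^ 3 * ρ) / (√m * lam) := by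
      rw [mul_pow, Real.sq_sqrt (by positivity), hR]; ring
    rw [e1, e2, div_le_div_iff₀ (by positivity) (by norm_num)]
    have h1 : 110592 * (b ^ 3 * ρ) ≤ (1 - η) * lam ^ 2 * √m := by
      refine (abs_le_of_sq_le_sq' ?_ (by positivity)).2
      calc (110592 * (b ^ 3 * ρ)) ^ 2 = 110592 ^ 2 * (B ^ 6 * P) * ((d : ℝ) ^ 9 * ℓ ^ 6 * l) := by
            rw [mul_pow, mul_pow, hρ2, hb]; ring
        _ ≤ 110592 ^ 2 * (B ^ 6 * P) * U := by
            rw [hU]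
            gcongr
            norm_num
        _ ≤ (1 - η) ^ 2 * lam ^ 4 * m := w2
        _ = _ := by rw [mul_pow, hsm2]; ring
    linarith

end PINN

theorem theorem3 :
    -- the cubed ReLU
    (∀ K : ℝ, ∃ C : ℝ, 0 < C ∧
      ∀ (d n₁ n₂ m : ℕ), 1 ≤ d → 1 ≤ n₁ → 1 ≤ n₂ → 2 ≤ m →
      ∀ D : PINN.Data d n₁ n₂,
        (∀ i, ‖D.sample i‖ ≤ 1) → D.NoTwoParallel →
        (∀ p, |D.f (D.x p)| ≤ K) → (∀ j, |D.g (D.y j)| ≤ K) →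
      ∀ η δ : ℝ, 0 < η → η < 1 → 0 < δ → δ < 1 →
        0 < PINN.lambda₀ PINN.relu3 D ∧
        (C * (1 / (1 - η) ^ 2 * ((d : ℝ) ^ 12 / PINN.lambda₀ PINN.relu3 D ^ 4)
            * Real.log (m * d / δ) ^ 6 * Real.log ((n₁ + n₂) / δ)) ≤ m →
          PINN.ConvergesWithProb PINN.relu3 D m η δ)) ∧
    -- smooth activations
    (∀ c K : ℝ, ∃ C : ℝ, 0 < C ∧
      ∀ σ : ℝ → ℝ, PINN.SmoothActivation c σ →
      ∀ (d n₁ n₂ m : ℕ), 1 ≤ d → 1 ≤ n₁ → 1 ≤ n₂ → 2 ≤ m →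
      ∀ D : PINN.Data d n₁ n₂,
        (∀ i, ‖D.sample i‖ ≤ 1) → D.NoTwoParallel →
        (∀ p, |D.f (D.x p)| ≤ K) → (∀ j, |D.g (D.y j)| ≤ K) →
      ∀ η δ : ℝ, 0 < η → η < 1 → 0 < δ → δ < 1 →
        0 < PINN.lambda₀ σ D ∧
        (C * (1 / (1 - η) * ((d : ℝ) ^ 6 / PINN.lambda₀ σ D ^ 3)
            * Real.log (m * d / δ) ^ 2 * Real.log ((n₁ + n₂) / δ)) ≤ m →
          PINN.ConvergesWithProb σ D m η δ)) :=
  ⟨PINN.exists_const_relu3, PINN.exists_const_smooth⟩
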